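/- **Setting.** Let $\{\eta_i\}_{i\in\mathbb Z}$ and $\{\zeta_i\}_{i\in\mathbb Z}$ be two independent sequences, each i.i.d., and let $\eta_0^*,\zeta_0^*$ be copies of $\eta_0,\zeta_0$, independent of each other and of both sequences. Put $\mathcal F_k=(\dots,\eta_{k-1},\eta_k)$, $\mathcal G_k=(\dots,\zeta_{k-1},\zeta_k)$, and let $\mathcal F_k^*,\mathcal G_k^*$ be obtained by replacing $\eta_0$ by $\eta_0^*$ and $\zeta_0$ by $\zeta_0^*$. Let $0=b_0<b_1<\dots<b_{R+1}=1$, and let $H_0,\dots,H_R$ ($\mathbb R^p$-valued, $p\ge 1$) and $D_0,\dots,D_R$ (real-valued) be measurable filters. For $1\le i\le n$ and $b_r<i/n\le b_{r+1}$ let $$x_i=H_r(\tfrac in,\mathcal F_{i-1},\mathcal G_i),\qquad \epsilon_i=D_r(\tfrac in,\mathcal F_i,\mathcal G_i),\qquad y_i=x_i^\top\beta_0+\epsilon_i ,$$ where $\beta_0\in\mathbb R^p$ is fixed, the first coordinate of $x_i$ is $1$, and, for a fixed $\tau\in(0,1)$, $0$ is a conditional $\tau$-quantile of $\epsilon_i$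 given $x_i$. Write $\|Z\|_v=(E|Z|^v)^{1/v}$, $\rho_\tau(u)=u(\tau-I(u<0))$, $\psi_\tau(u)=\tau-I(u<0)$, and for $b_r<t\le b_{r+1}$ $$F_r^{(q)}(t,u\mid\mathcal F_{k-1},\mathcal G_k)=\frac{\partial^q}{\partial u^q}P(D_r(t,\mathcal F_k,\mathcal G_k)\le u\mid\mathcal F_{k-1},\mathcal G_k),\qquad f_r=F_r^{(1)},$$ where these derivatives are assumed to exist for $0\le q\le p$. The following is assumed for some constants $M<\infty$, $\chi\in(0,1)$, $c>0$, $\varepsilon>0$, $\kappa>0$, which may differ from line to line; $r$ ranges over $0,\dots,R$ and $t,t_1,t_2$ over $(b_r,b_{r+1})$. (C1) $\|H_r(t_1,\mathcal F_{-1},\mathcal G_0)-H_r(t_2,\mathcal F_{-1},\mathcal G_0)\|_4\le M|t_1-t_2|$; $\;\max_r\sup_t\|H_r(t,\mathcal F_{k-1},\mathcal G_k)-H_r(t,\mathcal F_{k-1}^*,\mathcal G_k^*)\|_4=O(\chi^k)$ as $k\to\infty$; $\;\max_{1\le i\le n}\|x_i\|_{4+\kappa}\le M$ for all $n$. (C2)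 $\|D_r(t_1,\mathcal F_0,\mathcal G_0)-D_r(t_2,\mathcal F_0,\mathcal G_0)\|_4\le M|t_1-t_2|$, and for $0\le q\le p$, as $k\to\infty$, $$\max_r\sup_{t,\,|u|<c}\big\|F_r^{(q)}(t,H_r(t,\mathcal F_{k-1},\mathcal G_k)^\top u\mid\mathcal F_{k-1},\mathcal G_k)-F_r^{(q)}(t,H_r(t,\mathcal F_{k-1}^*,\mathcal G_k^*)^\top u\mid\mathcal F_{k-1}^*,\mathcal G_k^*)\big\|_4=O(\chi^k).$$ (C3) For each $t$, almost surely: $|f_r(t,u\mid\mathcal F_{-1},\mathcal G_0)|\ge\varepsilon$ for $|u|<c$; $|f_r(t,u\mid\mathcal F_{-1},\mathcal G_0)|\le M$ for all $u\in\mathbb R$; and $f_r(t,\cdot\mid\mathcal F_{-1},\mathcal G_0)$ is $M$-Lipschitz on $(-c,c)$. Moreover $\|f_r(t_1,0\mid\mathcal F_{-1},\mathcal G_0)-f_r(t_2,0\mid\mathcal F_{-1},\mathcal G_0)\|_2\le M|t_1-t_2|$. (C4) The smallest eigenvalue of $E\big(H_r(t,\mathcal F_{-1},\mathcal G_0)H_r(t,\mathcal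 F_{-1},\mathcal G_0)^\top\big)$ is at least $\varepsilon$. **Claim.** Let $G_n=\sum_{i=1}^n x_i\psi_\tau(\epsilon_i)$ and $K_n=\sum_{i=1}^nE\big(f_r(\tfrac in,0\mid\mathcal F_{i-1},\mathcal G_i)\,x_ix_i^\top\big)$, where $r$ in the $i$-th term is the index with $b_r<i/n\le b_{r+1}$. The expectations in $K_n$ exist whenever $i/n$ is not a break point (at $i/n=b_{r+1}$, where (C1)–(C4) do not bound $f_r$, an entry whose expectation does not exist is read as $0$), and, as $n\to\infty$, $$\sup_{|\beta-\beta_0|\le n^{-1/2}\log n}\Big|\sum_{i=1}^n\big(\rho_\tau(y_i-x_i^\top\beta)-\rho_\tau(y_i-x_i^\top\beta_0)\big)+(\beta-\beta_0)^\top G_n-\tfrac12(\beta-\beta_0)^\top K_n(\beta-\beta_0)\Big|=o_p(1).$$ -/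

import Mathlib

open MeasureTheory ProbabilityTheory Filter Topology Set
open scoped ENNReal

noncomputable section

namespace QuantReg

/-- The check loss `ρ_τ(u) = u (τ - 1{u < 0})`. -/
def checkLoss (τ u : ℝ) : ℝ := u * (τ - if u < 0 then 1 else 0)

/-- The score `ψ_τ(u) = τ - 1{u < 0}`. -/
def score (τ u : ℝ) : ℝ := τ - if u < 0 then 1 else 0

/-- The history `(s k, s (k - 1), s (k - 2), …)` of a two-sided sequence, newest entry first. -/
def hist {α : Type*} (s : ℤ → α) (k : ℤ) : ℕ → α := fun j => s (k - j)

/-- `push e h` is the history obtained from `h` by adding the newest entry `e`. -/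
def push {α : Type*} (e : α) (h : ℕ → α) : ℕ → α
  | 0 => e
  | j + 1 => h j

/-- A piecewise locally stationary design and error process with `R` break points and `p`
predictors: innovations `η`, `ζ` together with the independent copies `η'`, `ζ'` of `η 0`, `ζ 0`,
break points `0 = b 0 < b 1 < … < b (R + 1) = 1`, and the filters `H r` of the predictors and
`D r` of the errors, used on `(b r, b (r + 1)]`. -/
structure PLSModel {Ω : Type*} [MeasurableSpace Ω] (P : Measure Ω)
    (E₁ E₂ : Type*) [MeasurableSpace E₁] [MeasurableSpace E₂] (p R : ℕ) where
  /-- the innovations generating `F_k` -/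
  η : ℤ → Ω → E₁
  /-- the innovations generating `G_k` -/
  ζ : ℤ → Ω → E₂
  /-- the independent copy of `η 0` -/
  η' : Ω → E₁
  /-- the independent copy of `ζ 0` -/
  ζ' : Ω → E₂
  measurable_η : ∀ k, Measurable (η k)
  measurable_ζ : ∀ k, Measurable (ζ k)
  measurable_η' : Measurable η'
  measurable_ζ' : Measurable ζ'
  iIndep_η : iIndepFun η P
  iIndep_ζ : iIndepFun ζ P
  ident_η : ∀ k, IdentDistrib (η k) (η 0) P P
  ident_ζ : ∀ k, IdentDistrib (ζ k) (ζ 0) P P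
  indep_η_ζ : IndepFun (fun ω k => η k ω) (fun ω k => ζ k ω) P
  ident_η' : IdentDistrib η' (η 0) P P
  ident_ζ' : IdentDistrib ζ' (ζ 0) P P
  indep_η'_ζ' : IndepFun η' ζ' P
  indep_copies : IndepFun (fun ω => (η' ω, ζ' ω))
    (fun ω => ((fun k => η k ω), (fun k => ζ k ω))) P
  /-- the break points -/
  b : Fin (R + 2) → ℝ
  b_zero : b 0 = 0
  b_last : b (Fin.last (R + 1)) = 1
  b_strictMono : StrictMono b
  /-- the filters of the predictors -/
  H : Fin (R + 1) → ℝ → (ℕ → E₁) → (ℕ → E₂) → EuclideanSpace ℝ (Fin p)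
  /-- the filters of the errors -/
  D : Fin (R + 1) → ℝ → (ℕ → E₁) → (ℕ → E₂) → ℝ
  measurable_H : ∀ r t, Measurable (fun h : (ℕ → E₁) × (ℕ → E₂) => H r t h.1 h.2)
  measurable_D : ∀ r t, Measurable (fun h : (ℕ → E₁) × (ℕ → E₂) => D r t h.1 h.2)

namespace PLSModel

variable {Ω : Type*} [MeasurableSpace Ω] {P : Measure Ω}
  {E₁ E₂ : Type*} [MeasurableSpace E₁] [MeasurableSpace E₂] {p R : ℕ}
  (m : PLSModel P E₁ E₂ p R)

/-- `F_k = (…, η_{k-1}, η_k)`. -/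
def F (k : ℤ) (ω : Ω) : ℕ → E₁ := hist (fun i => m.η i ω) k

/-- `G_k = (…, ζ_{k-1}, ζ_k)`. -/
def G (k : ℤ) (ω : Ω) : ℕ → E₂ := hist (fun i => m.ζ i ω) k

/-- `F_k^*`: the history `F_k` with `η_0` replaced by its independent copy. -/
def Fstar (k : ℤ) (ω : Ω) : ℕ → E₁ := hist (Function.update (fun i => m.η i ω) 0 (m.η' ω)) k

/-- `G_k^*`: the history `G_k` with `ζ_0` replaced by its independent copy. -/
def Gstar (k : ℤ) (ω : Ω) : ℕ → E₂ := hist (Function.update (fun i => m.ζ i ω) 0 (m.ζ' ω)) k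

/-- The open interval `(b_r, b_{r+1})`. -/
def piece (r : Fin (R + 1)) : Set ℝ := Ioo (m.b r.castSucc) (m.b r.succ)

/-- The interval `(b_r, b_{r+1}]`. -/
def piece' (r : Fin (R + 1)) : Set ℝ := Ioc (m.b r.castSucc) (m.b r.succ)

open Classical in
/-- The predictors `x_i = H_r(i/n, F_{i-1}, G_i)`, for `b_r < i/n ≤ b_{r+1}`. -/
def x (n i : ℕ) (ω : Ω) : EuclideanSpace ℝ (Fin p) :=
  ∑ r, if (i : ℝ) / n ∈ m.piece' r then m.H r ((i : ℝ) / n) (m.F (i - 1) ω) (m.G i ω) else 0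

open Classical in
/-- The errors `ε_i = D_r(i/n, F_i, G_i)`, for `b_r < i/n ≤ b_{r+1}`. -/
def err (n i : ℕ) (ω : Ω) : ℝ :=
  ∑ r, if (i : ℝ) / n ∈ m.piece' r then m.D r ((i : ℝ) / n) (m.F i ω) (m.G i ω) else 0

/-- The responses `y_i = x_iᵀ β₀ + ε_i`. -/
def y (β₀ : EuclideanSpace ℝ (Fin p)) (n i : ℕ) (ω : Ω) : ℝ :=
  inner ℝ (m.x n i ω) β₀ + m.err n i ω

/-- The conditional distribution function `P(D_r(t, F_k, G_k) ≤ u | F_{k-1} = h, G_k = g)`, as a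
function of the conditioning histories. Since `η_k` is independent of `(F_{k-1}, G_k)` with the law
of `η_0`, it is obtained by integrating out the newest innovation; see `condCDF_ae_eq_condExp`. -/
def condCDF (r : Fin (R + 1)) (t : ℝ) (h : ℕ → E₁) (g : ℕ → E₂) (u : ℝ) : ℝ :=
  (P.map (m.η 0)).real {e | m.D r t (push e h) g ≤ u}

/-- `F_r^{(q)}(t, u | h, g)`, the `q`-th derivative in `u` of the conditional distribution
function. -/
def condCDFDeriv (q : ℕ) (r : Fin (R + 1)) (t : ℝ) (h : ℕ → E₁) (g : ℕ → E₂) (u : ℝ) : ℝ :=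
  iteratedDeriv q (m.condCDF r t h g) u

/-- The conditional density `f_r(t, u | h, g)`. -/
def condDensity (r : Fin (R + 1)) (t : ℝ) (h : ℕ → E₁) (g : ℕ → E₂) (u : ℝ) : ℝ :=
  deriv (m.condCDF r t h g) u

/-- The `k`-th dependence measure `Δ_v(H, k)` of the predictors. -/
def depMeasureH (v : ℝ≥0∞) (k : ℕ) : ℝ≥0∞ :=
  ⨆ r, ⨆ t ∈ m.piece r,
    eLpNorm (fun ω => m.H r t (m.F (k - 1) ω) (m.G k ω)
      - m.H r t (m.Fstar (k - 1) ω) (m.Gstar k ω)) v P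

/-- The `k`-th dependence measure, in `L⁴`, of
`F_r^{(q)}(t, H_r(t, F_{k-1}, G_k)ᵀ u | F_{k-1}, G_k)`, uniformly over `|u| < c`. -/
def depMeasureCDF (q : ℕ) (c : ℝ) (k : ℕ) : ℝ≥0∞ :=
  ⨆ r, ⨆ t ∈ m.piece r, ⨆ u ∈ Metric.ball (0 : EuclideanSpace ℝ (Fin p)) c,
    eLpNorm (fun ω =>
      m.condCDFDeriv q r t (m.F (k - 1) ω) (m.G k ω)
          (inner ℝ (m.H r t (m.F (k - 1) ω) (m.G k ω)) u)
        - m.condCDFDeriv q r t (m.Fstar (k - 1) ω) (m.Gstar k ω)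
          (inner ℝ (m.H r t (m.Fstar (k - 1) ω) (m.Gstar k ω)) u)) 4 P

/-- The predictors contain the intercept: the first coordinate of `x_i` is `1`. -/
def HasIntercept [NeZero p] : Prop :=
  ∀ n : ℕ, ∀ i ∈ Finset.Icc 1 n, ∀ᵐ ω ∂P, m.x n i ω 0 = 1

/-- Given `x_i`, zero is a conditional `τ`-quantile of `ε_i`:
`P(ε_i < 0 | x_i) ≤ τ ≤ P(ε_i ≤ 0 | x_i)`. -/
def ZeroQuantile (τ : ℝ) : Prop :=
  ∀ n : ℕ, ∀ i ∈ Finset.Icc 1 n,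
    (∀ᵐ ω ∂P, (P[{ω' | m.err n i ω' < 0}.indicator (fun _ => (1 : ℝ)) |
      MeasurableSpace.comap (m.x n i) inferInstance]) ω ≤ τ) ∧
    (∀ᵐ ω ∂P, τ ≤ (P[{ω' | m.err n i ω' ≤ 0}.indicator (fun _ => (1 : ℝ)) |
      MeasurableSpace.comap (m.x n i) inferInstance]) ω)

/-- Predictors: piecewise stochastic Lipschitz continuity in `L⁴`, geometrically decaying
dependence measure in `L⁴`, and bounded moments of an order larger than `4`. -/
structure DesignRegular : Prop where
  lipschitz : ∃ M : ℝ, ∀ r, ∀ t₁ ∈ m.piece r, ∀ t₂ ∈ m.piece r, t₁ < t₂ →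
    eLpNorm (fun ω => (t₁ - t₂)⁻¹ •
      (m.H r t₁ (m.F (-1) ω) (m.G 0 ω) - m.H r t₂ (m.F (-1) ω) (m.G 0 ω))) 4 P
      ≤ ENNReal.ofReal M
  dependence : ∃ χ ∈ Ioo (0 : ℝ) 1, ∃ C : ℝ, ∀ᶠ k : ℕ in atTop,
    m.depMeasureH 4 k ≤ ENNReal.ofReal (C * χ ^ k)
  moments : ∃ κ > (0 : ℝ), ∃ M : ℝ, ∀ n : ℕ, ∀ i ∈ Finset.Icc 1 n,
    eLpNorm (m.x n i) (ENNReal.ofReal (4 + κ)) P ≤ ENNReal.ofReal M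

/-- Errors: piecewise stochastic Lipschitz continuity in `L⁴`, and existence and geometrically
decaying dependence of the derivatives, up to the order `p`, of the conditional distribution
functions. -/
structure ErrorRegular : Prop where
  lipschitz : ∃ M : ℝ, ∀ r, ∀ t₁ ∈ m.piece r, ∀ t₂ ∈ m.piece r, t₁ < t₂ →
    eLpNorm (fun ω => (t₁ - t₂)⁻¹ *
      (m.D r t₁ (m.F 0 ω) (m.G 0 ω) - m.D r t₂ (m.F 0 ω) (m.G 0 ω))) 4 P
      ≤ ENNReal.ofReal M
  differentiable : ∀ r, ∀ t ∈ m.piece' r, ∀ᵐ ω ∂P, ∀ q < p,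
    Differentiable ℝ (m.condCDFDeriv q r t (m.F (-1) ω) (m.G 0 ω))
  dependence : ∃ c > (0 : ℝ), ∀ q ≤ p, ∃ χ ∈ Ioo (0 : ℝ) 1, ∃ C : ℝ, ∀ᶠ k : ℕ in atTop,
    m.depMeasureCDF q c k ≤ ENNReal.ofReal (C * χ ^ k)

/-- Conditional density: bounded, bounded away from zero near the origin, Lipschitz in its argument
near the origin, and stochastic Lipschitz in time at the origin. -/
structure DensityRegular : Prop where
  bounds : ∃ c > (0 : ℝ), ∃ ε > (0 : ℝ), ∃ M : ℝ,
    (∀ r, ∀ t ∈ m.piece r, ∀ᵐ ω ∂P,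
      (∀ u : ℝ, |u| < c → ε ≤ |m.condDensity r t (m.F (-1) ω) (m.G 0 ω) u|) ∧
      (∀ u : ℝ, |m.condDensity r t (m.F (-1) ω) (m.G 0 ω) u| ≤ M) ∧
      (∀ u₁ u₂ : ℝ, -c < u₁ → u₁ < u₂ → u₂ < c →
        |(m.condDensity r t (m.F (-1) ω) (m.G 0 ω) u₁
          - m.condDensity r t (m.F (-1) ω) (m.G 0 ω) u₂) / (u₁ - u₂)| ≤ M))
  lipschitz : ∃ M : ℝ, ∀ r, ∀ t₁ ∈ m.piece r, ∀ t₂ ∈ m.piece r, t₁ < t₂ →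
    eLpNorm (fun ω => (t₁ - t₂)⁻¹ *
      (m.condDensity r t₁ (m.F (-1) ω) (m.G 0 ω) 0
        - m.condDensity r t₂ (m.F (-1) ω) (m.G 0 ω) 0)) 2 P
      ≤ ENNReal.ofReal M

/-- The matrix `E(H_r(t, F_{-1}, G_0) H_r(t, F_{-1}, G_0)ᵀ)`. -/
def designMoment (r : Fin (R + 1)) (t : ℝ) : Matrix (Fin p) (Fin p) ℝ :=
  Matrix.of fun a a' => ∫ ω, m.H r t (m.F (-1) ω) (m.G 0 ω) a *
    m.H r t (m.F (-1) ω) (m.G 0 ω) a' ∂P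

/-- The eigenvalues of the second moment matrices of the predictors are bounded away from zero. -/
def DesignNondegenerate : Prop :=
  ∃ ε > (0 : ℝ), ∀ r, ∀ t ∈ m.piece r, ∀ l : ℝ,
    Module.End.HasEigenvalue (Matrix.toLin' (m.designMoment r t)) l → ε ≤ l

/-- `G_n = ∑ x_i ψ_τ(ε_i)`. -/
def gradSum (τ : ℝ) (n : ℕ) (ω : Ω) : EuclideanSpace ℝ (Fin p) :=
  ∑ i ∈ Finset.Icc 1 n, score τ (m.err n i ω) • m.x n i ω

open Classical in
/-- `f_r(i/n, 0 | F_{i-1}, G_i)`, for `b_r < i/n ≤ b_{r+1}`. -/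
def densityAtZero (n i : ℕ) (ω : Ω) : ℝ :=
  ∑ r, if (i : ℝ) / n ∈ m.piece' r then
    m.condDensity r ((i : ℝ) / n) (m.F (i - 1) ω) (m.G i ω) 0 else 0

/-- `K_n = ∑ E(f_r(i/n, 0 | F_{i-1}, G_i) x_i x_iᵀ)`. -/
def weightedDesign (n : ℕ) : Matrix (Fin p) (Fin p) ℝ :=
  ∑ i ∈ Finset.Icc 1 n, Matrix.of fun a a' =>
    ∫ ω, m.densityAtZero n i ω * (m.x n i ω a * m.x n i ω a') ∂P

/-- The remainder of the quadratic approximation of the check loss increment. -/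
def remainder (τ : ℝ) (β₀ : EuclideanSpace ℝ (Fin p)) (n : ℕ) (ω : Ω)
    (β : EuclideanSpace ℝ (Fin p)) : ℝ :=
  ∑ i ∈ Finset.Icc 1 n,
      (checkLoss τ (m.y β₀ n i ω - inner ℝ (m.x n i ω) β)
        - checkLoss τ (m.y β₀ n i ω - inner ℝ (m.x n i ω) β₀))
    + inner ℝ (β - β₀) (m.gradSum τ n ω)
    - 1 / 2 * ((β - β₀).ofLp ⬝ᵥ (m.weightedDesign n).mulVec (β - β₀).ofLp)

/-! ### The conditional distribution function is a version of the conditional probability -/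

lemma measurable_F (k : ℤ) : Measurable (m.F k) :=
  measurable_pi_lambda _ fun _ => m.measurable_η _

lemma measurable_G (k : ℤ) : Measurable (m.G k) :=
  measurable_pi_lambda _ fun _ => m.measurable_ζ _

lemma push_F (k : ℤ) (ω : Ω) : push (m.η k ω) (m.F (k - 1) ω) = m.F k ω := by
  funext j
  cases j with
  | zero => simp [push, F, hist]
  | succ j =>
    simp only [push, F, hist]
    congr 1
    push_cast
    ring

lemma measurable_push : Measurable (fun z : E₁ × (ℕ → E₁) => push z.1 z.2) := by
  refine measurable_pi_lambda _ fun j => ?_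
  cases j with
  | zero => exact measurable_fst
  | succ j => exact (measurable_pi_apply j).comp measurable_snd

/-- `η_k` is independent of `(F_{k-1}, G_k)`. -/
lemma map_innovation [IsProbabilityMeasure P] (k : ℤ) :
    P.map (fun ω => ((m.F (k - 1) ω, m.G k ω), m.η k ω))
      = (P.map (fun ω => (m.F (k - 1) ω, m.G k ω))).prod (P.map (m.η 0)) := by
  have hF := m.measurable_F (k - 1)
  have hG := m.measurable_G k
  have hη := m.measurable_η k
  have hpast : IndepFun (m.F (k - 1)) (m.η k) P := by
    have h0 := indep_iSup_of_disjoint (fun i => (m.measurable_η i).comap_le) m.iIndep_η.iIndep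
      (S := {i | i < k}) (T := {k}) (by simp)
    refine indep_of_indep_of_le_left (indep_of_indep_of_le_right h0 ?_) ?_
    · exact le_iSup₂_of_le (f := fun i (_ : i ∈ ({k} : Set ℤ)) =>
        MeasurableSpace.comap (m.η i) inferInstance) k rfl le_rfl
    · refine Measurable.comap_le ?_
      refine @measurable_pi_lambda _ _ _ (_) _ _ fun j => ?_
      refine Measurable.of_comap_le ?_
      exact le_iSup₂_of_le (f := fun i (_ : i ∈ {i : ℤ | i < k}) =>
        MeasurableSpace.comap (m.η i) inferInstance) (k - 1 - j)
        (by simp only [mem_ofPred_eq]; omega) le_rfl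
  have hmix : IndepFun (fun ω => (m.F (k - 1) ω, m.η k ω)) (m.G k) P :=
    m.indep_η_ζ.comp
      (φ := fun s : ℤ → E₁ => (hist s (k - 1), s k)) (ψ := fun s : ℤ → E₂ => hist s k)
      ((measurable_pi_lambda _ fun j => measurable_pi_apply _).prodMk (measurable_pi_apply _))
      (measurable_pi_lambda _ fun j => measurable_pi_apply _)
  have hFG : IndepFun (m.F (k - 1)) (m.G k) P :=
    hmix.comp (φ := Prod.fst) (ψ := id) measurable_fst measurable_id
  have e1 := (indepFun_iff_map_prod_eq_prod_map_map hF.aemeasurable hη.aemeasurable).1 hpast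
  have e2 := (indepFun_iff_map_prod_eq_prod_map_map
    (hF.prodMk hη).aemeasurable hG.aemeasurable).1 hmix
  have e3 := (indepFun_iff_map_prod_eq_prod_map_map hF.aemeasurable hG.aemeasurable).1 hFG
  have := Measure.isProbabilityMeasure_map (μ := P) hF.aemeasurable
  have := Measure.isProbabilityMeasure_map (μ := P) hG.aemeasurable
  have := Measure.isProbabilityMeasure_map (μ := P) (m.measurable_η 0).aemeasurable
  rw [← (m.ident_η k).map_eq] at *
  rw [e1] at e2
  rw [e3]
  let T : ((ℕ → E₁) × E₁) × (ℕ → E₂) → ((ℕ → E₁) × (ℕ → E₂)) × E₁ :=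
    fun z => ((z.1.1, z.2), z.1.2)
  have hT : Measurable T := by fun_prop
  have e4 : P.map (fun ω => ((m.F (k - 1) ω, m.G k ω), m.η k ω))
      = (P.map (fun ω => ((m.F (k - 1) ω, m.η k ω), m.G k ω))).map T := by
    rw [Measure.map_map hT ((hF.prodMk hη).prodMk hG)]
    rfl
  rw [e4, e2]
  exact ((measurePreserving_prodAssoc (P.map (m.F (k - 1))) (P.map (m.G k))
    (P.map (m.η k))).symm.comp (((MeasurePreserving.id (P.map (m.F (k - 1)))).prod
    Measure.measurePreserving_swap).comp (measurePreserving_prodAssoc (P.map (m.F (k - 1)))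
    (P.map (m.η k)) (P.map (m.G k))))).map_eq

/-- `condCDF`, evaluated at `(F_{k-1}, G_k)`, is the conditional probability of
`D_r(t, F_k, G_k) ≤ u` given `(F_{k-1}, G_k)`. -/
theorem condCDF_ae_eq_condExp [IsProbabilityMeasure P] (r : Fin (R + 1)) (t u : ℝ) (k : ℤ) :
    (fun ω => m.condCDF r t (m.F (k - 1) ω) (m.G k ω) u) =ᵐ[P]
      P[{ω | m.D r t (m.F k ω) (m.G k ω) ≤ u}.indicator (fun _ => (1 : ℝ)) |
        MeasurableSpace.comap (fun ω => (m.F (k - 1) ω, m.G k ω)) inferInstance] := by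
  have hX : Measurable (fun ω => (m.F (k - 1) ω, m.G k ω)) :=
    (m.measurable_F _).prodMk (m.measurable_G _)
  have := Measure.isProbabilityMeasure_map (μ := P) (m.measurable_η 0).aemeasurable
  have := Measure.isProbabilityMeasure_map (μ := P) hX.aemeasurable
  let A : Set (((ℕ → E₁) × (ℕ → E₂)) × E₁) := {z | m.D r t (push z.2 z.1.1) z.1.2 ≤ u}
  have hA : MeasurableSet A :=
    measurableSet_le ((m.measurable_D r t).comp
      ((measurable_push.comp (measurable_snd.prodMk measurable_fst.fst)).prodMk
        measurable_fst.snd)) measurable_const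
  have hg : Measurable (fun h : (ℕ → E₁) × (ℕ → E₂) => m.condCDF r t h.1 h.2 u) :=
    (measurable_measure_prodMk_left (ν := P.map (m.η 0)) hA).ennreal_toReal
  have hB : {ω | m.D r t (m.F k ω) (m.G k ω) ≤ u}
      = (fun ω => ((m.F (k - 1) ω, m.G k ω), m.η k ω)) ⁻¹' A := by
    ext ω
    simp [A, push_F]
  have hZ : Measurable (fun ω => ((m.F (k - 1) ω, m.G k ω), m.η k ω)) :=
    hX.prodMk (m.measurable_η k)
  have hBm : MeasurableSet {ω | m.D r t (m.F k ω) (m.G k ω) ≤ u} := hB ▸ hZ hA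
  have hint : Integrable (fun ω => m.condCDF r t (m.F (k - 1) ω) (m.G k ω) u) P :=
    Integrable.of_bound (hg.comp hX).aestronglyMeasurable 1
      (ae_of_all _ fun ω => by
        rw [Real.norm_eq_abs, condCDF, abs_of_nonneg measureReal_nonneg]
        exact measureReal_le_one)
  refine ae_eq_condExp_of_forall_setIntegral_eq hX.comap_le
    ((integrable_const _).indicator hBm) (fun s _ _ => hint.integrableOn) ?_
    ((hg.comp (comap_measurable _)).aestronglyMeasurable)
  rintro _ ⟨S, hS, rfl⟩ _
  rw [setIntegral_indicator hBm, setIntegral_const, smul_eq_mul, mul_one, hB]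
  have e1 : ((fun ω => (m.F (k - 1) ω, m.G k ω)) ⁻¹' S) ∩
      ((fun ω => ((m.F (k - 1) ω, m.G k ω), m.η k ω)) ⁻¹' A)
      = (fun ω => ((m.F (k - 1) ω, m.G k ω), m.η k ω)) ⁻¹' (A ∩ Prod.fst ⁻¹' S) := by
    ext ω
    simp [and_comm]
  have hAS : MeasurableSet (A ∩ Prod.fst ⁻¹' S) := hA.inter (measurable_fst hS)
  rw [e1, measureReal_def, ← Measure.map_apply hZ hAS, m.map_innovation k,
    Measure.prod_apply hAS,
    ← setIntegral_map (f := fun h : (ℕ → E₁) × (ℕ → E₂) => m.condCDF r t h.1 h.2 u) hS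
      hg.aestronglyMeasurable hX.aemeasurable,
    integral_eq_lintegral_of_nonneg_ae
      (f := fun h : (ℕ → E₁) × (ℕ → E₂) => m.condCDF r t h.1 h.2 u) (ae_of_all _ fun _ => measureReal_nonneg)
      hg.aestronglyMeasurable, ← lintegral_indicator hS]
  congr 1
  refine lintegral_congr fun h => ?_
  by_cases hh : h ∈ S
  · rw [indicator_of_mem hh]
    have : Prod.mk h ⁻¹' (A ∩ Prod.fst ⁻¹' S) = {e | m.D r t (push e h.1) h.2 ≤ u} := by
      ext e
      simp [A, hh]
    rw [this, condCDF, ofReal_measureReal]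
  · rw [indicator_of_notMem hh]
    have : Prod.mk h ⁻¹' (A ∩ Prod.fst ⁻¹' S) = ∅ := by
      ext e
      simp [hh]
    rw [this, measure_empty]

end PLSModel

end QuantReg

end

/-!
# Quadratic approximation of the quantile regression objective

Put `δ = β - β₀` and `v_i = x_iᵀ δ`. Knight's identity (`checkLoss_sub_checkLoss`,
`excess_eq_intervalIntegral`) writes each difference of check losses as `-v_i ψ_τ(ε_i)` plus a
nonnegative `excess v_i ε_i` that does not involve `τ`. Hence the remainder is
`∑ excess v_i ε_i - ½ δᵀ K_n δ` (`remainder_eq`), and its supremum over `‖δ‖ ≤ ρ`, with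
`ρ = n^{-1/2} log n`, is split as follows.

* *Martingale part.* Given `(F_{i-1}, G_i)`, the predictor is known and the error is a function of
  the fresh innovation `η_i`, so the excesses minus their conditional means are martingale
  differences. By the bounded density, their second moments are of order `ρ³`, so at a fixed `δ`
  their sum is of order `√(n ρ³)`, a negative power of `n` up to logarithms
  (`UniformBounds.l1Bound_sum_centredExcess`). A grid of polylogarithmic size suffices to pass to
  the supremum, because excesses at two points of the ball differ only when `|ε_i|` is at most of
  order `ρ ‖x_i‖`, which is rare (`abs_centredExcess_sub_le`, `UniformBounds.l1Bound_smallError`).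
* *Conditional means.* The integrated form of Knight's identity and the Lipschitz density give
  `½ f(0) v_i²` with an error of order `|v_i|³` (`RegularLaw.abs_integral_excess_sub_le`); these
  errors sum to `O(n ρ³)`.
* *Quadratic form.* What remains is `½ δᵀ (∑ f x_i x_iᵀ - E) δ`. By Lévy's upward theorem and a
  telescoping sum of the dependence measures (`spliceCost_le_tsum`, `swapCost_toCond`), each entry
  is within `O(χ^w)` in `L¹` of a function of the last `w` innovations. Such functions are
  independent at distance `w`, whence a weak law with an error of order `n χ^w + √(n w)`
  (`l1Bound_sum_centered`), used with `w = √n`.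
* *Break points.* At most `R + 2` of the points `i/n` are break points. Their excesses are
  `O(ρ ‖x_i‖)`, and their terms of `K_n` take finitely many fixed values (`exists_break_bound`).

These bounds form a random `majorant` of the remainder (`UniformBounds.ae_abs_remainder_le`) whose
mean tends to zero (`UniformBounds.l1Bound_majorant`, `tendsto_majorantBound`), and Markov's
inequality concludes.

The assumptions hold almost surely at one fixed time, whereas the sums run over all times. By
stationarity they can be transferred once they define measurable sets of histories. For this
reason only bounds on the distribution function are used (`RegularLaw`), which by right-continuity
can be tested at rational points, together with a measurable version of the density at zero
(`densityVersion`).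
-/

noncomputable section

namespace QuantReg

/-! ### The excess of the check loss -/

/-- The excess of the check loss over its linearisation,
`ρ_τ(ε - v) - ρ_τ(ε) + v ψ_τ(ε)`. It does not depend on `τ`. -/
def excess (v ε : ℝ) : ℝ := if 0 ≤ ε then max (v - ε) 0 else max (ε - v) 0

lemma checkLoss_sub_checkLoss (τ ε v : ℝ) :
    checkLoss τ (ε - v) - checkLoss τ ε = excess v ε - v * score τ ε := by
  unfold checkLoss score excess
  split_ifs <;> first
    | linarith
    | (rw [max_eq_left (by linarith)]; ring)
    | (rw [max_eq_right (by linarith)]; ring)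

lemma measurable_excess : Measurable (fun z : ℝ × ℝ => excess z.1 z.2) := by
  unfold excess
  exact Measurable.ite (measurableSet_le measurable_const measurable_snd) (by fun_prop)
    (by fun_prop)

lemma excess_nonneg (v ε : ℝ) : 0 ≤ excess v ε := by
  unfold excess; split_ifs <;> exact le_max_right _ _

lemma excess_le (v ε : ℝ) : excess v ε ≤ |v| := by
  unfold excess
  split_ifs
  · exact max_le (by linarith [le_abs_self v]) (abs_nonneg _)
  · exact max_le (by linarith [neg_abs_le v]) (abs_nonneg _)

lemma abs_excess_le (v ε : ℝ) : |excess v ε| ≤ |v| := by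
  rw [abs_of_nonneg (excess_nonneg v ε)]; exact excess_le v ε

lemma sq_excess_le (v ε : ℝ) : excess v ε ^ 2 ≤ |v| * excess v ε := by
  rw [sq]
  exact mul_le_mul_of_nonneg_right (excess_le v ε) (excess_nonneg v ε)

lemma abs_excess_sub_excess_le (v w ε : ℝ) : |excess v ε - excess w ε| ≤ |v - w| := by
  unfold excess
  split_ifs
  · refine (abs_max_sub_max_le_abs _ _ _).trans (le_of_eq ?_)
    congr 1; ring
  · refine (abs_max_sub_max_le_abs _ _ _).trans (le_of_eq ?_)
    rw [← abs_neg]; congr 1; ring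

lemma excess_eq_zero {v ε a : ℝ} (hv : |v| ≤ a) (hε : a < |ε|) : excess v ε = 0 := by
  have h1 := abs_le.1 hv
  unfold excess
  split_ifs with h
  · rw [abs_of_nonneg h] at hε
    exact max_eq_right (by linarith)
  · rw [abs_of_neg (not_le.1 h)] at hε
    exact max_eq_right (by linarith)

/-- Local Lipschitz bound: a change of `v` within `[-a, a]` is only felt when `|ε| ≤ a`. -/
lemma abs_excess_sub_excess_le_indicator {v w ε a : ℝ} (hv : |v| ≤ a) (hw : |w| ≤ a) :
    |excess v ε - excess w ε| ≤ |v - w| * (Icc (-a) a).indicator (fun _ => (1 : ℝ)) ε := by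
  by_cases h : ε ∈ Icc (-a) a
  · rw [indicator_of_mem h, mul_one]
    exact abs_excess_sub_excess_le v w ε
  · have h' : a < |ε| := by
      by_contra hc
      exact h (abs_le.1 (not_lt.1 hc))
    rw [excess_eq_zero hv h', excess_eq_zero hw h']
    simp only [sub_zero, abs_zero]
    exact mul_nonneg (abs_nonneg _) (indicator_nonneg (fun _ _ => zero_le_one) _)

/-- An indicator is dominated by two excesses, so that bounds for mean excesses give small-ball
bounds. -/
lemma indicator_Icc_le_excess (a ε : ℝ) :
    a * (Icc (-a) a).indicator (fun _ => (1 : ℝ)) ε ≤ excess (2 * a) ε + excess (-(2 * a)) ε := by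
  by_cases h : ε ∈ Icc (-a) a
  · rw [indicator_of_mem h, mul_one]
    have hp := excess_nonneg (2 * a) ε
    have hn := excess_nonneg (-(2 * a)) ε
    by_cases h0 : 0 ≤ ε
    · have : a ≤ excess (2 * a) ε := by
        unfold excess; rw [if_pos h0]; exact le_max_of_le_left (by linarith [h.2])
      linarith
    · have : a ≤ excess (-(2 * a)) ε := by
        unfold excess; rw [if_neg h0]; exact le_max_of_le_left (by linarith [h.1])
      linarith
  · rw [indicator_of_notMem h, mul_zero]
    exact add_nonneg (excess_nonneg _ _) (excess_nonneg _ _)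

lemma hasDerivWithinAt_excess (ε s : ℝ) :
    HasDerivWithinAt (fun v => excess v ε)
      ((Ici ε).indicator (fun _ => (1 : ℝ)) s - (Ioi ε).indicator (fun _ => (1 : ℝ)) 0)
      (Ioi s) s := by
  have hlin : HasDerivWithinAt (fun v : ℝ => v - ε) 1 (Ioi s) s :=
    ((hasDerivAt_id s).sub_const ε).hasDerivWithinAt
  have hlin' : HasDerivWithinAt (fun v : ℝ => ε - v) (-1) (Ioi s) s :=
    ((hasDerivAt_id s).const_sub ε).hasDerivWithinAt
  have hzero : HasDerivWithinAt (fun _ : ℝ => (0 : ℝ)) 0 (Ioi s) s := hasDerivWithinAt_const _ _ _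
  by_cases h0 : 0 ≤ ε
  · rw [indicator_of_notMem (show (0 : ℝ) ∉ Ioi ε from not_lt.2 h0), sub_zero]
    simp only [excess, if_pos h0]
    by_cases hs : ε ≤ s
    · rw [indicator_of_mem (show s ∈ Ici ε from hs)]
      exact hlin.congr (fun x hx => max_eq_left (by linarith [mem_Ioi.1 hx]))
        (max_eq_left (by linarith))
    · rw [indicator_of_notMem (show s ∉ Ici ε from hs)]
      refine hzero.congr_of_eventuallyEq ?_ (max_eq_right (by linarith [not_le.1 hs]))
      filter_upwards [mem_nhdsWithin_of_mem_nhds (Iio_mem_nhds (not_le.1 hs))] with x hx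
      exact max_eq_right (by linarith [mem_Iio.1 hx])
  · rw [indicator_of_mem (show (0 : ℝ) ∈ Ioi ε from not_le.1 h0)]
    simp only [excess, if_neg h0]
    by_cases hs : ε ≤ s
    · rw [indicator_of_mem (show s ∈ Ici ε from hs), sub_self]
      exact hzero.congr (fun x hx => max_eq_right (by linarith [mem_Ioi.1 hx]))
        (max_eq_right (by linarith))
    · rw [indicator_of_notMem (show s ∉ Ici ε from hs), zero_sub]
      refine hlin'.congr_of_eventuallyEq ?_ (max_eq_left (by linarith [not_le.1 hs]))
      filter_upwards [mem_nhdsWithin_of_mem_nhds (Iio_mem_nhds (not_le.1 hs))] with x hx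
      exact max_eq_left (by linarith [mem_Iio.1 hx])

/-- Knight's identity, `excess v ε = ∫₀ᵛ (1{ε ≤ s} - 1{ε < 0}) ds`. -/
lemma excess_eq_intervalIntegral (v ε : ℝ) :
    excess v ε = ∫ s in (0 : ℝ)..v,
      ((Ici ε).indicator (fun _ => (1 : ℝ)) s - (Ioi ε).indicator (fun _ => (1 : ℝ)) 0) := by
  have hz : excess 0 ε = 0 := by
    have := abs_excess_le 0 ε
    rw [abs_zero] at this
    exact abs_nonpos_iff.1 this
  rw [intervalIntegral.integral_eq_sub_of_hasDeriv_right (f := fun v => excess v ε), hz, sub_zero]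
  · refine Continuous.continuousOn ?_
    unfold excess
    split_ifs <;> fun_prop
  · exact fun s _ => hasDerivWithinAt_excess ε s
  · refine IntervalIntegrable.sub ?_ intervalIntegrable_const
    rw [intervalIntegrable_iff]
    exact (integrableOn_const (by simp)).indicator measurableSet_Ici

/-! ### The mean excess under a law with a regular distribution function -/

section OneDim

variable {μ : Measure ℝ} [IsProbabilityMeasure μ]

lemma integrable_excess (v : ℝ) : Integrable (excess v) μ :=
  Integrable.of_bound (measurable_excess.comp measurable_prodMk_left).aestronglyMeasurable |v|
    (ae_of_all _ fun ε => by rw [Real.norm_eq_abs]; exact abs_excess_le v ε)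

omit [IsProbabilityMeasure μ] in
lemma integral_excess_nonneg (v : ℝ) : 0 ≤ ∫ ε, excess v ε ∂μ :=
  integral_nonneg fun ε => excess_nonneg v ε

/-- Integrated Knight identity: `E excess(v, ε) = ∫₀ᵛ (F(s) - F(0-)) ds`. -/
lemma integral_excess (v : ℝ) :
    ∫ ε, excess v ε ∂μ = ∫ s in (0 : ℝ)..v, (μ.real (Iic s) - μ.real (Iio 0)) := by
  have hS : MeasurableSet {z : ℝ × ℝ | z.2 ≤ z.1} := measurableSet_le measurable_snd measurable_fst
  have hm : Measurable (fun z : ℝ × ℝ => ((Ici z.2).indicator (fun _ => (1 : ℝ)) z.1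
      - (Ioi z.2).indicator (fun _ => (1 : ℝ)) 0)) := by
    refine Measurable.sub ?_ ?_
    · exact (measurable_const (a := (1 : ℝ))).indicator hS
    · exact (measurable_const (a := (1 : ℝ))).indicator
        (measurableSet_lt measurable_snd (measurable_const (a := (0 : ℝ))))
  simp_rw [excess_eq_intervalIntegral v]
  rw [← intervalIntegral_integral_swap]
  · congr 1
    ext s
    rw [integral_sub]
    · congr 1
      · rw [← integral_indicator_one measurableSet_Iic]
        rfl
      · rw [← integral_indicator_one measurableSet_Iio]
        rfl
    · exact (integrable_const (1 : ℝ)).indicator (measurableSet_Iic (a := s))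
    · exact (integrable_const (1 : ℝ)).indicator (measurableSet_Iio (a := (0 : ℝ)))
  · have : IsFiniteMeasure (volume.restrict (uIoc (0 : ℝ) v)) := ⟨by simp [uIoc]⟩
    refine Integrable.of_bound hm.aestronglyMeasurable 1 (ae_of_all _ fun z => ?_)
    simp only [Function.uncurry, indicator]
    split_ifs <;> simp

/-- The conditions on a law near zero that the argument needs: the distribution function has slope
`f` at zero, with quadratic remainder, and grows at most linearly. The remainder is controlled on
the whole line; away from zero this follows from the linear growth. -/
structure RegularLaw (μ : Measure ℝ) (f A : ℝ) : Prop where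
  linear : ∀ s : ℝ, |μ.real (Iic s) - μ.real (Iic 0)| ≤ A * |s|
  quadratic : ∀ s : ℝ, |μ.real (Iic s) - μ.real (Iic 0) - s * f| ≤ A * s ^ 2

namespace RegularLaw

variable {f A : ℝ}

omit [IsProbabilityMeasure μ] in
lemma nonneg (h : RegularLaw μ f A) : 0 ≤ A := by
  simpa using (abs_nonneg _).trans (h.linear 1)

lemma real_Iio (h : RegularLaw μ f A) : μ.real (Iio 0) = μ.real (Iic 0) := by
  refine le_antisymm (measureReal_mono Iio_subset_Iic_self) ?_
  refine le_of_forall_pos_lt_add fun η hη => ?_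
  have hA := h.nonneg
  have h1 := h.linear (-(η / (A + 1)))
  have hpos : 0 < η / (A + 1) := by positivity
  rw [abs_neg (η / (A + 1)), abs_of_pos hpos] at h1
  have h2 : μ.real (Iic (-(η / (A + 1)))) ≤ μ.real (Iio 0) :=
    measureReal_mono (Iic_subset_Iio.2 (neg_lt_zero.2 hpos))
  have h3 : A * (η / (A + 1)) < η := by
    rw [← mul_div_assoc, div_lt_iff₀ (by positivity)]
    nlinarith
  have := (abs_le.1 h1).1
  linarith

lemma integral_excess_eq (h : RegularLaw μ f A) (v : ℝ) :
    ∫ ε, excess v ε ∂μ = ∫ s in (0 : ℝ)..v, (μ.real (Iic s) - μ.real (Iic 0)) := by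
  rw [integral_excess, h.real_Iio]

lemma intervalIntegrable (v : ℝ) :
    IntervalIntegrable (fun s => μ.real (Iic s) - μ.real (Iic 0)) volume 0 v := by
  refine IntervalIntegrable.sub (Monotone.intervalIntegrable fun s t hst => ?_)
    intervalIntegrable_const
  exact measureReal_mono (Iic_subset_Iic.2 hst)

lemma abs_le_of_mem_uIoc {s v : ℝ} (hs : s ∈ uIoc 0 v) : |s| ≤ |v| := by
  rcases mem_uIoc.1 hs with ⟨h1, h2⟩ | ⟨h1, h2⟩
  · rw [abs_of_pos h1, abs_of_pos (h1.trans_le h2)]; exact h2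
  · rw [abs_of_nonpos h2, abs_of_neg (h1.trans_le h2)]; linarith

/-- The mean excess is at most quadratic. -/
lemma integral_excess_le (h : RegularLaw μ f A) (v : ℝ) : ∫ ε, excess v ε ∂μ ≤ A * v ^ 2 := by
  rw [h.integral_excess_eq]
  refine (le_abs_self _).trans ?_
  rw [← Real.norm_eq_abs]
  refine (intervalIntegral.norm_integral_le_of_norm_le_const (C := A * |v|) fun s hs => ?_).trans ?_
  · exact (h.linear s).trans (mul_le_mul_of_nonneg_left (abs_le_of_mem_uIoc hs) h.nonneg)
  · rw [sub_zero, mul_assoc, abs_mul_abs_self, sq]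

/-- The mean excess is quadratic up to a cubic error. -/
lemma abs_integral_excess_sub_le (h : RegularLaw μ f A) (v : ℝ) :
    |∫ ε, excess v ε ∂μ - 1 / 2 * (f * v ^ 2)| ≤ A * |v| ^ 3 := by
  have h2 : 1 / 2 * (f * v ^ 2) = ∫ s in (0 : ℝ)..v, s * f := by
    rw [intervalIntegral.integral_mul_const, integral_id]; ring
  rw [h.integral_excess_eq, h2, ← intervalIntegral.integral_sub (intervalIntegrable v)
    (by apply Continuous.intervalIntegrable; fun_prop), ← Real.norm_eq_abs]
  refine (intervalIntegral.norm_integral_le_of_norm_le_const (C := A * |v| ^ 2)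
    fun s hs => ?_).trans (le_of_eq ?_)
  · refine (h.quadratic s).trans (mul_le_mul_of_nonneg_left ?_ h.nonneg)
    rw [← sq_abs]
    exact pow_le_pow_left₀ (abs_nonneg _) (abs_le_of_mem_uIoc hs) 2
  · rw [sub_zero]; ring

/-- Small-ball bound. -/
lemma real_Icc_le (h : RegularLaw μ f A) {a : ℝ} (ha : 0 ≤ a) :
    μ.real (Icc (-a) a) ≤ 8 * A * a := by
  rcases ha.eq_or_lt with rfl | ha
  · have h0 : μ.real (Iic 0) = μ.real (Iio 0) + μ.real {0} := by
      rw [← measureReal_union (by simp) (measurableSet_singleton _)]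
      congr 1; ext x; simp [le_iff_lt_or_eq]
    rw [h.real_Iio] at h0
    simp only [neg_zero, Icc_self, mul_zero]
    linarith
  · have h1 : a * μ.real (Icc (-a) a) ≤ A * (2 * a) ^ 2 + A * (-(2 * a)) ^ 2 := by
      rw [← integral_indicator_one measurableSet_Icc, ← integral_const_mul]
      refine (integral_mono (((integrable_const (1 : ℝ)).indicator measurableSet_Icc).const_mul a)
        ((integrable_excess (2 * a)).add (integrable_excess (-(2 * a))))
        (fun ε => indicator_Icc_le_excess a ε)).trans ?_
      simp only [Pi.add_apply]
      rw [integral_add (integrable_excess _) (integrable_excess _)]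
      exact add_le_add (h.integral_excess_le _) (h.integral_excess_le _)
    nlinarith

end RegularLaw

end OneDim

/-! ### Independent families and finite-window approximation -/

section Indep

variable {Ω : Type*} [MeasurableSpace Ω] {P : Measure Ω}

/-- Subfamilies of an independent family along disjoint index sets are independent; neither index map
need be injective. -/
lemma indepFun_of_disjoint_indices {ι α α' E : Type*} [MeasurableSpace E] {X : ι → Ω → E}
    (h : iIndepFun X P) (hX : ∀ i, Measurable (X i)) {σ : α → ι} {σ' : α' → ι}
    (hd : ∀ a a', σ a ≠ σ' a') :
    IndepFun (fun ω a => X (σ a) ω) (fun ω a => X (σ' a) ω) P := by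
  have h0 := indep_iSup_of_disjoint (fun i => (hX i).comap_le) h.iIndep
    (S := range σ) (T := range σ') (by
      rw [Set.disjoint_left]
      rintro _ ⟨a, rfl⟩ ⟨a', ha'⟩
      exact hd a a' ha'.symm)
  refine indep_of_indep_of_le_left (indep_of_indep_of_le_right h0 ?_) ?_ <;>
  · refine Measurable.comap_le ?_
    refine @measurable_pi_lambda _ _ _ (_) _ _ fun j => ?_
    refine Measurable.of_comap_le ?_
    exact le_iSup₂_of_le (f := fun i _ => MeasurableSpace.comap (X i) inferInstance) _
      (mem_range_self j) le_rfl

lemma iIndepFun_prodMk_of_indepFun {ι E₁ E₂ : Type*} [MeasurableSpace E₁] [MeasurableSpace E₂]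
    {X : ι → Ω → E₁} {Y : ι → Ω → E₂} (hX : iIndepFun X P) (hY : iIndepFun Y P)
    (hXm : ∀ i, Measurable (X i)) (hYm : ∀ i, Measurable (Y i))
    (hXY : IndepFun (fun ω i => X i ω) (fun ω i => Y i ω) P) :
    iIndepFun (fun i ω => (X i ω, Y i ω)) P := by
  let π : ι → Set (Set Ω) := fun i =>
    preimage (fun ω => (X i ω, Y i ω)) '' image2 (· ×ˢ ·) {s | MeasurableSet s} {t | MeasurableSet t}
  refine iIndepSets.iIndep (π := π) (fun i => ((hXm i).prodMk (hYm i)).comap_le) (fun i => ?_)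
    (fun i => ?_) ?_
  · exact isPiSystem_prod.comap _
  · rw [← generateFrom_prod, MeasurableSpace.comap_generateFrom]
  · rw [iIndepSets_iff]
    intro S f hf
    have : ∀ i : ι, ∃ A : Set E₁, ∃ B : Set E₂, MeasurableSet A ∧ MeasurableSet B ∧
        (i ∈ S → f i = X i ⁻¹' A ∩ Y i ⁻¹' B) := by
      intro i
      by_cases hi : i ∈ S
      · obtain ⟨_, ⟨A, hA, B, hB, rfl⟩, hfi⟩ := hf i hi
        refine ⟨A, B, hA, hB, fun _ => ?_⟩
        rw [← hfi]; rfl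
      · exact ⟨∅, ∅, .empty, .empty, fun h => absurd h hi⟩
    choose A B hA hB hAB using this
    have e : ⋂ i ∈ S, f i = (⋂ i ∈ S, X i ⁻¹' A i) ∩ (⋂ i ∈ S, Y i ⁻¹' B i) := by
      simp only [← iInter_inter_distrib]
      exact iInter₂_congr fun i hi => hAB i hi
    have hpair : ∀ i, IndepFun (X i) (Y i) P := fun i =>
      hXY.comp (measurable_pi_apply i) (measurable_pi_apply i)
    have hbig : P ((⋂ i ∈ S, X i ⁻¹' A i) ∩ (⋂ i ∈ S, Y i ⁻¹' B i))
        = P (⋂ i ∈ S, X i ⁻¹' A i) * P (⋂ i ∈ S, Y i ⁻¹' B i) := by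
      have := hXY.measure_inter_preimage_eq_mul (⋂ i ∈ S, (fun x : ι → E₁ => x i) ⁻¹' A i)
        (⋂ i ∈ S, (fun x : ι → E₂ => x i) ⁻¹' B i)
        (S.measurableSet_biInter fun i _ => measurable_pi_apply i (hA i))
        (S.measurableSet_biInter fun i _ => measurable_pi_apply i (hB i))
      simp only [preimage_iInter] at this
      exact this
    rw [e, hbig, hX.measure_inter_preimage_eq_mul S fun i _ => hA i,
      hY.measure_inter_preimage_eq_mul S fun i _ => hB i, ← Finset.prod_mul_distrib]
    refine Finset.prod_congr rfl fun i hi => ?_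
    rw [hAB i hi, (hpair i).measure_inter_preimage_eq_mul _ _ (hA i) (hB i)]

end Indep

section Window

variable {E : Type*} [MeasurableSpace E] (κ : Measure E) [IsProbabilityMeasure κ]

/-- The law of an i.i.d. one-sided sequence with marginal `κ`. -/
abbrev iidLaw : Measure (ℕ → E) := Measure.infinitePi fun _ : ℕ => κ

/-- The sequence that agrees with `s` before the index `m` and with `s'` from `m` on. -/
def splice (m : ℕ) (s s' : ℕ → E) : ℕ → E := fun l => if l < m then s l else s' l

omit [MeasurableSpace E] in
lemma splice_eq_update (k : ℕ) (s s' : ℕ → E) :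
    splice k s s' = Function.update (splice (k + 1) s s') k (s' k) := by
  funext l
  by_cases h : l = k
  · subst h; simp [splice]
  · rw [Function.update_of_ne h]
    simp only [splice]
    have : l < k ↔ l < k + 1 := by omega
    simp only [this]

lemma measurable_splice (m : ℕ) :
    Measurable (fun z : (ℕ → E) × (ℕ → E) => splice m z.1 z.2) := by
  refine measurable_pi_lambda _ fun l => ?_
  simp only [splice]
  split_ifs <;> fun_prop

/-- Two independent i.i.d. sequences, read off a single i.i.d. family. -/
lemma iidLaw_prod_iidLaw :
    (iidLaw κ).prod (iidLaw κ) = (Measure.infinitePi fun _ : ℕ ⊕ ℕ => κ).map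
      (fun ω => ((fun l => ω (.inl l)), (fun l => ω (.inr l)))) := by
  have hi : iIndepFun (fun (o : ℕ ⊕ ℕ) (ω : ℕ ⊕ ℕ → E) => ω o)
      (Measure.infinitePi fun _ : ℕ ⊕ ℕ => κ) :=
    iIndepFun_infinitePi (X := fun _ x => x) (by fun_prop)
  have h := indepFun_of_disjoint_indices hi (by fun_prop) (σ := Sum.inl) (σ' := Sum.inr) (by simp)
  rw [h.map_prod_eq_prod_map_map (Measurable.aemeasurable (by fun_prop))
      (Measurable.aemeasurable (by fun_prop)),
    Measure.map_infinitePi_infinitePi_of_inj (P := fun _ : ℕ ⊕ ℕ => κ) Sum.inl_injective,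
    Measure.map_infinitePi_infinitePi_of_inj (P := fun _ : ℕ ⊕ ℕ => κ) Sum.inr_injective]

/-- The pair `(splice (k + 1) s s', s' k)` consists of an i.i.d. sequence and an independent copy of
its coordinate `k`; putting the copy in that place gives `splice k s s'`. -/
lemma measurePreserving_splice_snd (k : ℕ) :
    MeasurePreserving (fun z : (ℕ → E) × (ℕ → E) => (splice (k + 1) z.1 z.2, z.2 k))
      ((iidLaw κ).prod (iidLaw κ)) ((iidLaw κ).prod κ) := by
  have hm : Measurable (fun z : (ℕ → E) × (ℕ → E) => (splice (k + 1) z.1 z.2, z.2 k)) :=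
    (measurable_splice _).prodMk (by fun_prop)
  refine ⟨hm, ?_⟩
  have hi : iIndepFun (fun (o : ℕ ⊕ ℕ) (ω : ℕ ⊕ ℕ → E) => ω o)
      (Measure.infinitePi fun _ : ℕ ⊕ ℕ => κ) :=
    iIndepFun_infinitePi (X := fun _ x => x) (by fun_prop)
  let σ : ℕ → ℕ ⊕ ℕ := fun l => if l < k + 1 then .inl l else .inr l
  have hσ : Function.Injective σ := by
    intro a b hab
    simp only [σ] at hab
    split_ifs at hab <;> simpa using hab
  have h := indepFun_of_disjoint_indices hi (by fun_prop) (σ := σ)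
    (σ' := fun _ : Unit => .inr k) (by
      intro a _
      simp only [σ]
      split_ifs with ha
      · simp
      · intro hc
        have : a = k := by simpa using hc
        omega)
  have h' : IndepFun (fun (ω : ℕ ⊕ ℕ → E) a => ω (σ a)) (fun ω => ω (.inr k))
      (Measure.infinitePi fun _ : ℕ ⊕ ℕ => κ) :=
    h.comp (ψ := fun x : Unit → E => x ()) measurable_id (by fun_prop)
  rw [iidLaw_prod_iidLaw, Measure.map_map hm (by fun_prop)]
  have e : ((fun z : (ℕ → E) × (ℕ → E) => (splice (k + 1) z.1 z.2, z.2 k)) ∘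
      fun ω : ℕ ⊕ ℕ → E => ((fun l => ω (.inl l)), (fun l => ω (.inr l))))
      = fun ω => ((fun a => ω (σ a)), ω (.inr k)) := by
    funext ω
    simp only [Function.comp, Prod.mk.injEq, and_true]
    funext l
    simp only [splice, σ]
    split_ifs <;> rfl
  rw [e, h'.map_prod_eq_prod_map_map (Measurable.aemeasurable (by fun_prop))
      (Measurable.aemeasurable (by fun_prop)),
    Measure.map_infinitePi_infinitePi_of_inj (P := fun _ : ℕ ⊕ ℕ => κ) hσ,
    Measure.infinitePi_map_eval]

lemma measurePreserving_splice (m : ℕ) :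
    MeasurePreserving (fun z : (ℕ → E) × (ℕ → E) => splice m z.1 z.2)
      ((iidLaw κ).prod (iidLaw κ)) (iidLaw κ) := by
  cases m with
  | zero =>
    have : (fun z : (ℕ → E) × (ℕ → E) => splice 0 z.1 z.2) = Prod.snd := by
      funext z l; simp [splice]
    rw [this]; exact measurePreserving_snd
  | succ k => exact measurePreserving_fst.comp (measurePreserving_splice_snd κ k)

/-- The `L¹` cost of replacing the coordinate `k` by an independent copy. -/
def swapCost (g : (ℕ → E) → ℝ) (k : ℕ) : ℝ≥0∞ :=
  ∫⁻ z, ‖g z.1 - g (Function.update z.1 k z.2)‖ₑ ∂((iidLaw κ).prod κ)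

/-- The `L¹` cost of replacing all coordinates from `m` on by independent copies. -/
def spliceCost (g : (ℕ → E) → ℝ) (m : ℕ) : ℝ≥0∞ :=
  ∫⁻ z, ‖g z.1 - g (splice m z.1 z.2)‖ₑ ∂((iidLaw κ).prod (iidLaw κ))

variable {κ} {g : (ℕ → E) → ℝ}

lemma spliceCost_le_succ (hg : Measurable g) (m : ℕ) :
    spliceCost κ g m ≤ spliceCost κ g (m + 1) + swapCost κ g m := by
  have hs := measurePreserving_splice_snd κ m
  have hm1 : Measurable (fun z : (ℕ → E) × E => ‖g z.1 - g (Function.update z.1 m z.2)‖ₑ) := by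
    have : Measurable (fun z : (ℕ → E) × E => Function.update z.1 m z.2) := by
      refine measurable_pi_lambda _ fun l => ?_
      by_cases h : l = m
      · subst h; simpa using measurable_snd
      · simp only [Function.update_of_ne h]; fun_prop
    fun_prop
  have hm2 : Measurable (fun z : (ℕ → E) × (ℕ → E) => ‖g z.1 - g (splice (m + 1) z.1 z.2)‖ₑ) := by
    have := measurable_splice (E := E) (m + 1)
    fun_prop
  rw [swapCost, ← hs.lintegral_comp hm1, spliceCost, spliceCost, ← lintegral_add_left hm2]
  refine lintegral_mono fun z => ?_
  simp only [← splice_eq_update]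
  refine le_trans (le_of_eq ?_) (enorm_add_le _ _)
  congr 1; ring

lemma spliceCost_le_add_sum (hg : Measurable g) (m N : ℕ) :
    spliceCost κ g m ≤ spliceCost κ g (m + N) + ∑ k ∈ Finset.range N, swapCost κ g (m + k) := by
  induction N with
  | zero => simp
  | succ N ih =>
    rw [Finset.sum_range_succ]
    refine ih.trans ?_
    rw [add_comm (∑ k ∈ _, _), ← add_assoc]
    exact add_le_add_left (spliceCost_le_succ hg (m + N)) _

/-- The distant past is negligible: by Lévy's upward theorem `g` is close to a function of finitely
many coordinates, which splicing does not change. -/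
lemma tendsto_spliceCost (hg : Measurable g) (hi : Integrable g (iidLaw κ)) :
    Tendsto (spliceCost κ g) atTop (𝓝 0) := by
  let ℱ : Filtration ℕ (inferInstance : MeasurableSpace (ℕ → E)) :=
    { seq := fun m => ⨆ l : {l // l < m}, MeasurableSpace.comap (fun s : ℕ → E => s l) inferInstance
      mono' := fun m m' h => iSup_le fun l =>
        le_iSup (fun l : {l // l < m'} => MeasurableSpace.comap (fun s : ℕ → E => s l) inferInstance)
          ⟨l, l.2.trans_le h⟩
      le' := fun m => iSup_le fun l => (measurable_pi_apply _).comap_le }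
  have hsup : ⨆ m, ℱ m = (inferInstance : MeasurableSpace (ℕ → E)) := by
    refine le_antisymm (iSup_le fun m => ℱ.le m) (iSup_le fun l => ?_)
    exact (le_iSup (fun j : {j // j < l + 1} =>
      MeasurableSpace.comap (fun s : ℕ → E => s j) inferInstance) ⟨l, l.lt_succ_self⟩).trans
        (le_iSup (fun m => ℱ m) (l + 1))
  have hL := hi.tendsto_eLpNorm_condExp (ℱ := ℱ) (by rw [hsup]; exact hg.stronglyMeasurable)
  have h2 : Tendsto (fun m => 2 * eLpNorm ((iidLaw κ)[g | ℱ m] - g) 1 (iidLaw κ)) atTop (𝓝 0) := by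
    simpa using ENNReal.Tendsto.const_mul hL (Or.inr (by simp : (2 : ℝ≥0∞) ≠ ∞))
  refine tendsto_of_tendsto_of_tendsto_of_le_of_le tendsto_const_nhds h2 (fun _ => zero_le)
    fun m => ?_
  set c := (iidLaw κ)[g | ℱ m] with hc
  have hcm : Measurable[ℱ m] c := stronglyMeasurable_condExp.measurable
  have hcm' : Measurable c := hcm.mono (ℱ.le m) le_rfl
  have hcs : ∀ s s' : ℕ → E, c (splice m s s') = c s := by
    intro s s'
    have hS : Measurable[ℱ m] (fun z : ℕ → E => splice m z s') := by
      refine @measurable_pi_lambda _ _ _ (_) _ _ fun l => ?_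
      by_cases hl : l < m
      · simp only [splice, if_pos hl]
        exact Measurable.of_comap_le (le_iSup (fun j : {j // j < m} =>
          MeasurableSpace.comap (fun s : ℕ → E => s j) inferInstance) ⟨l, hl⟩)
      · simp only [splice, if_neg hl]
        exact measurable_const
    -- a set in `ℱ m` is a preimage under the first `m` coordinates; apply this to a fibre of `c`
    have hset : MeasurableSet[ℱ m] (c ⁻¹' {c s}) := hcm (measurableSet_singleton _)
    have key : ∀ A : Set (ℕ → E), MeasurableSet[ℱ m] A → (s ∈ A ↔ splice m s s' ∈ A) := by
      have hle : ℱ m ≤ MeasurableSpace.comap (fun z : ℕ → E => fun l : {l // l < m} => z l)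
          inferInstance := iSup_le fun l => by
        refine Measurable.comap_le ?_
        exact (measurable_pi_apply (X := fun _ : {l // l < m} => E) l).comp
          (comap_measurable (fun z : ℕ → E => fun l : {l // l < m} => z l))
      intro A hA
      obtain ⟨B, -, rfl⟩ := hle A hA
      have : (fun l : {l // l < m} => splice m s s' l) = fun l : {l // l < m} => s l := by
        funext l; simp [splice, l.2]
      simp only [mem_preimage, this]
    exact (key _ hset).1 rfl
  have hmeas : Measurable (fun s => ‖(c - g) s‖ₑ) := (hcm'.sub hg).enorm
  have e1 : ∫⁻ z, ‖(c - g) z.1‖ₑ ∂((iidLaw κ).prod (iidLaw κ)) = eLpNorm (c - g) 1 (iidLaw κ) := by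
    rw [eLpNorm_one_eq_lintegral_enorm]
    exact (measurePreserving_fst (μ := iidLaw κ) (ν := iidLaw κ)).lintegral_comp hmeas
  have e2 : ∫⁻ z, ‖(c - g) (splice m z.1 z.2)‖ₑ ∂((iidLaw κ).prod (iidLaw κ))
      = eLpNorm (c - g) 1 (iidLaw κ) := by
    rw [eLpNorm_one_eq_lintegral_enorm]
    exact (measurePreserving_splice κ m).lintegral_comp hmeas
  rw [two_mul]
  nth_rewrite 1 [← e1]
  have hmeas1 : Measurable (fun z : (ℕ → E) × (ℕ → E) => ‖(c - g) z.1‖ₑ) :=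
    hmeas.comp measurable_fst
  rw [← e2, spliceCost, ← lintegral_add_left hmeas1]
  refine lintegral_mono fun z => ?_
  rw [← enorm_neg ((c - g) z.1)]
  refine le_trans (le_of_eq ?_) (enorm_add_le _ _)
  simp only [Pi.sub_apply, hcs]
  congr 1; ring

/-- Splicing replaces the coordinates from `m` on, which is done one at a time. -/
lemma spliceCost_le_tsum (hg : Measurable g) (hi : Integrable g (iidLaw κ)) (m : ℕ) :
    spliceCost κ g m ≤ ∑' k, swapCost κ g (m + k) := by
  have h1 : Tendsto (fun N => spliceCost κ g (m + N) + ∑' k, swapCost κ g (m + k)) atTop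
      (𝓝 (0 + ∑' k, swapCost κ g (m + k))) := by
    refine Tendsto.add ?_ tendsto_const_nhds
    exact (tendsto_spliceCost hg hi).comp (tendsto_add_atTop_nat m |>.congr fun N => add_comm N m)
  rw [zero_add] at h1
  refine ge_of_tendsto' h1 fun N => (spliceCost_le_add_sum hg m N).trans ?_
  gcongr
  exact ENNReal.sum_le_tsum _

/-- The average of `g` over the coordinates from `m` on, that is, its conditional expectation given
the coordinates before `m`. -/
def windowMean (κ : Measure E) [IsProbabilityMeasure κ] (g : (ℕ → E) → ℝ) (m : ℕ) (s : ℕ → E) : ℝ :=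
  ∫ s', g (splice m s s') ∂(iidLaw κ)

lemma measurable_windowMean (hg : Measurable g) (m : ℕ) : Measurable (windowMean κ g m) := by
  have : Measurable (fun z : (ℕ → E) × (ℕ → E) => g (splice m z.1 z.2)) :=
    hg.comp (measurable_splice m)
  exact this.stronglyMeasurable.integral_prod_right.measurable

/-- `windowMean g m` depends on the coordinates before `m` only. -/
lemma windowMean_congr {m : ℕ} {s t : ℕ → E} (h : ∀ l < m, s l = t l) :
    windowMean κ g m s = windowMean κ g m t := by
  have : ∀ s', splice m s s' = splice m t s' := by
    intro s'; funext l
    simp only [splice]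
    split_ifs with hl
    · exact h l hl
    · rfl
  simp only [windowMean, this]

lemma lintegral_sub_windowMean_le (hg : Measurable g) (hi : Integrable g (iidLaw κ)) (m : ℕ) :
    ∫⁻ s, ‖g s - windowMean κ g m s‖ₑ ∂(iidLaw κ) ≤ spliceCost κ g m := by
  have hm := measurable_splice (E := E) m
  have hint : Integrable (fun z : (ℕ → E) × (ℕ → E) => g (splice m z.1 z.2))
      ((iidLaw κ).prod (iidLaw κ)) := (measurePreserving_splice κ m).integrable_comp_of_integrable hi
  rw [spliceCost, lintegral_prod _ (by fun_prop)]
  refine lintegral_mono_ae ?_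
  filter_upwards [hint.prod_right_ae] with s hs
  have : g s - windowMean κ g m s = ∫ s', (g s - g (splice m s s')) ∂(iidLaw κ) := by
    rw [integral_sub (integrable_const _) hs, integral_const]
    simp [windowMean]
  rw [this]
  exact enorm_integral_le_lintegral_enorm _

/-- Window averages do not increase second moments, by Jensen's inequality. -/
lemma sq_windowMean_le (hg : Measurable g) (h2 : Integrable (fun s => g s ^ 2) (iidLaw κ)) (m : ℕ) :
    Integrable (fun s => windowMean κ g m s ^ 2) (iidLaw κ) ∧
    ∫ s, windowMean κ g m s ^ 2 ∂(iidLaw κ) ≤ ∫ s, g s ^ 2 ∂(iidLaw κ) := by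
  have hint2 : Integrable (fun z : (ℕ → E) × (ℕ → E) => g (splice m z.1 z.2) ^ 2)
      ((iidLaw κ).prod (iidLaw κ)) := (measurePreserving_splice κ m).integrable_comp_of_integrable h2
  have hm := measurable_splice (E := E) m
  have hle : ∀ᵐ s ∂(iidLaw κ), windowMean κ g m s ^ 2 ≤ ∫ s', g (splice m s s') ^ 2 ∂(iidLaw κ) := by
    filter_upwards [hint2.prod_right_ae] with s hs
    have hL2 : MemLp (fun s' => g (splice m s s')) 2 (iidLaw κ) :=
      (memLp_two_iff_integrable_sq
        (hg.comp (hm.comp measurable_prodMk_left)).aestronglyMeasurable).2 hs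
    have hv := variance_nonneg (fun s' => g (splice m s s')) (iidLaw κ)
    rw [variance_eq_sub hL2] at hv
    have : ∫ s', ((fun s' => g (splice m s s')) ^ 2) s' ∂(iidLaw κ)
        = ∫ s', g (splice m s s') ^ 2 ∂(iidLaw κ) := rfl
    simp only [windowMean]
    linarith
  have hI : Integrable (fun s => ∫ s', g (splice m s s') ^ 2 ∂(iidLaw κ)) (iidLaw κ) :=
    hint2.integral_prod_left
  have hI' : Integrable (fun s => windowMean κ g m s ^ 2) (iidLaw κ) := by
    refine hI.mono' ((measurable_windowMean hg m).pow_const 2).aestronglyMeasurable ?_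
    filter_upwards [hle] with s hs
    rwa [Real.norm_eq_abs, abs_of_nonneg (sq_nonneg _)]
  refine ⟨hI', (integral_mono_ae hI' hI hle).trans (le_of_eq ?_)⟩
  rw [integral_integral (f := fun s s' => g (splice m s s') ^ 2) hint2]
  have := integral_map (μ := (iidLaw κ).prod (iidLaw κ)) (f := fun s => g s ^ 2) hm.aemeasurable
    (hg.pow_const 2).aestronglyMeasurable
  rw [(measurePreserving_splice κ m).map_eq] at this
  exact this.symm

end Window

/-! ### Bounds in `L¹` -/

section L1

variable {Ω : Type*} [MeasurableSpace Ω] {P : Measure Ω}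

/-- `Y` is integrable with `E|Y| ≤ c`. -/
structure L1Bound (P : Measure Ω) (Y : Ω → ℝ) (c : ℝ) : Prop where
  integrable : Integrable Y P
  integral_abs_le : ∫ ω, |Y ω| ∂P ≤ c

namespace L1Bound

variable {Y Z : Ω → ℝ} {a c : ℝ}

lemma mono_const (h : L1Bound P Y a) (hac : a ≤ c) : L1Bound P Y c :=
  ⟨h.1, h.2.trans hac⟩

lemma abs (h : L1Bound P Y a) : L1Bound P (fun ω => |Y ω|) a :=
  ⟨h.1.abs, by simpa using h.2⟩

lemma add (h : L1Bound P Y a) (h' : L1Bound P Z c) : L1Bound P (fun ω => Y ω + Z ω) (a + c) := by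
  refine ⟨h.1.add h'.1, ?_⟩
  refine (integral_mono (h.1.add h'.1).abs (h.1.abs.add h'.1.abs)
    (fun ω => abs_add_le (Y ω) (Z ω))).trans ?_
  simp only [Pi.add_apply]
  rw [integral_add h.1.abs h'.1.abs]
  exact add_le_add h.2 h'.2

lemma const_mul (h : L1Bound P Y a) {k : ℝ} (hk : 0 ≤ k) :
    L1Bound P (fun ω => k * Y ω) (k * a) := by
  refine ⟨h.1.const_mul k, ?_⟩
  simp_rw [abs_mul, abs_of_nonneg hk]
  rw [integral_const_mul]
  exact mul_le_mul_of_nonneg_left h.2 hk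

lemma sum {ι : Type*} {J : Finset ι} {Y : ι → Ω → ℝ} {a : ι → ℝ}
    (h : ∀ i ∈ J, L1Bound P (Y i) (a i)) :
    L1Bound P (fun ω => ∑ i ∈ J, Y i ω) (∑ i ∈ J, a i) := by
  classical
  induction J using Finset.induction_on with
  | empty => exact ⟨by simp, by simp⟩
  | insert i J hi ih =>
    simp only [Finset.sum_insert hi]
    exact (h i (Finset.mem_insert_self i J)).add
      (ih fun j hj => h j (Finset.mem_insert_of_mem hj))

lemma sum_const {ι : Type*} {J : Finset ι} {Y : ι → Ω → ℝ} {a : ℝ}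
    (h : ∀ i ∈ J, L1Bound P (Y i) a) :
    L1Bound P (fun ω => ∑ i ∈ J, Y i ω) (J.card * a) := by
  simpa using L1Bound.sum h

lemma of_abs_le (h : L1Bound P Z a) (hY : AEStronglyMeasurable Y P) (hle : ∀ᵐ ω ∂P, |Y ω| ≤ Z ω) :
    L1Bound P Y a := by
  have hi : Integrable Y P := h.1.mono' hY (by simpa using hle)
  refine ⟨hi, (integral_mono_ae hi.abs h.1.abs ?_).trans h.2⟩
  filter_upwards [hle] with ω hω
  exact hω.trans (le_abs_self _)

lemma of_lintegral (hY : AEStronglyMeasurable Y P) (ha : 0 ≤ a)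
    (h : ∫⁻ ω, ‖Y ω‖ₑ ∂P ≤ ENNReal.ofReal a) : L1Bound P Y a := by
  have hi : Integrable Y P := ⟨hY, h.trans_lt ENNReal.ofReal_lt_top⟩
  refine ⟨hi, ?_⟩
  have := ofReal_integral_norm_eq_lintegral_enorm hi
  rw [← this] at h
  exact (ENNReal.ofReal_le_ofReal_iff ha).1 h

end L1Bound

lemma integral_abs_le_sqrt [IsProbabilityMeasure P] {Y : Ω → ℝ} (hY : MemLp Y 2 P) {B : ℝ}
    (hB : ∫ ω, Y ω ^ 2 ∂P ≤ B) : ∫ ω, |Y ω| ∂P ≤ √B := by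
  have h := variance_nonneg (fun ω => |Y ω|) P
  have hY' : MemLp (fun ω => |Y ω|) 2 P := hY.norm
  rw [variance_eq_sub hY'] at h
  refine Real.le_sqrt_of_sq_le (le_trans ?_ hB)
  have : ∫ ω, ((fun ω => |Y ω|) ^ 2) ω ∂P = ∫ ω, Y ω ^ 2 ∂P := by simp
  linarith [sq_nonneg (∫ ω, |Y ω| ∂P)]

/-- `L¹` bound for a sum of square integrable variables that are orthogonal unless `near`, each
being near at most `N` of them. -/
lemma L1Bound.sum_of_orthogonal [IsProbabilityMeasure P] {ι : Type*} {J : Finset ι}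
    {X : ι → Ω → ℝ} {B N : ℝ} (near : ι → ι → Prop) [DecidableRel near]
    (hX : ∀ i ∈ J, MemLp (X i) 2 P) (hB : ∀ i ∈ J, ∫ ω, X i ω ^ 2 ∂P ≤ B) (hB0 : 0 ≤ B)
    (hN : ∀ i ∈ J, ((J.filter (near i)).card : ℝ) ≤ N)
    (h0 : ∀ i ∈ J, ∀ j ∈ J, ¬ near i j → ∫ ω, X i ω * X j ω ∂P = 0) :
    L1Bound P (fun ω => ∑ i ∈ J, X i ω) (√(J.card * (N * B))) := by
  have hL : MemLp (fun ω => ∑ i ∈ J, X i ω) 2 P := memLp_finsetSum J hX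
  refine ⟨hL.integrable one_le_two, integral_abs_le_sqrt hL ?_⟩
  have hprod : ∀ i ∈ J, ∀ j ∈ J, Integrable (fun ω => X i ω * X j ω) P := fun i hi j hj =>
    (hX i hi).integrable_mul (hX j hj)
  have hle : ∀ i ∈ J, ∀ j ∈ J, ∫ ω, X i ω * X j ω ∂P ≤ B := by
    intro i hi j hj
    have h1 : ∫ ω, X i ω * X j ω ∂P ≤ ∫ ω, (1 / 2 * X i ω ^ 2 + 1 / 2 * X j ω ^ 2) ∂P := by
      refine integral_mono (hprod i hi j hj)
        (((hX i hi).integrable_sq.const_mul _).add ((hX j hj).integrable_sq.const_mul _))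
        fun ω => ?_
      simp only
      nlinarith [sq_nonneg (X i ω - X j ω)]
    rw [integral_add ((hX i hi).integrable_sq.const_mul _) ((hX j hj).integrable_sq.const_mul _),
      integral_const_mul, integral_const_mul] at h1
    linarith [hB i hi, hB j hj]
  simp_rw [sq, Finset.sum_mul_sum]
  rw [integral_finsetSum _ fun i hi => integrable_finsetSum _ fun j hj => hprod i hi j hj]
  refine (Finset.sum_le_card_nsmul J _ (N * B) fun i hi => ?_).trans (le_of_eq (nsmul_eq_mul _ _))
  rw [integral_finsetSum _ fun j hj => hprod i hi j hj,
    ← Finset.sum_filter_add_sum_filter_not J (near i)]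
  have hz : ∑ j ∈ J with ¬ near i j, ∫ ω, X i ω * X j ω ∂P = 0 :=
    Finset.sum_eq_zero fun j hj => h0 i hi j (Finset.mem_filter.1 hj).1 (Finset.mem_filter.1 hj).2
  rw [hz, add_zero]
  refine (Finset.sum_le_card_nsmul _ _ B fun j hj => hle i hi j (Finset.mem_filter.1 hj).1).trans ?_
  rw [nsmul_eq_mul]
  exact mul_le_mul_of_nonneg_right (hN i hi) hB0

end L1

namespace PLSModel

variable {Ω : Type*} [MeasurableSpace Ω] {P : Measure Ω}
  {E₁ E₂ : Type*} [MeasurableSpace E₁] [MeasurableSpace E₂] {p R : ℕ}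
  (m : PLSModel P E₁ E₂ p R)

/-! ### Laws of the histories -/

/-- The paired innovation `(η_k, ζ_k)`. -/
def innov (k : ℤ) (ω : Ω) : E₁ × E₂ := (m.η k ω, m.ζ k ω)

/-- The common law of the paired innovations. -/
def innovLaw : Measure (E₁ × E₂) := P.map (m.innov 0)

/-- The history of the paired innovations up to time `k`, newest first. -/
def past (k : ℤ) (ω : Ω) : ℕ → E₁ × E₂ := hist (fun i => m.innov i ω) k

/-- The conditioning history `(F_{k-1}, G_k)`. -/
def cond (k : ℤ) (ω : Ω) : (ℕ → E₁) × (ℕ → E₂) := (m.F (k - 1) ω, m.G k ω)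

/-- The conditioning history `(F_{k-1}^*, G_k^*)`. -/
def condStar (k : ℤ) (ω : Ω) : (ℕ → E₁) × (ℕ → E₂) := (m.Fstar (k - 1) ω, m.Gstar k ω)

end PLSModel

/-- Extracts the conditioning history `(F_{k-1}, G_k)` from the paired history up to time `k`: the
newest entry of the first component is dropped. -/
def toCond {E₁ E₂ : Type*} (s : ℕ → E₁ × E₂) : (ℕ → E₁) × (ℕ → E₂) :=
  (fun l => (s (l + 1)).1, fun l => (s l).2)

lemma measurable_toCond {E₁ E₂ : Type*} [MeasurableSpace E₁] [MeasurableSpace E₂] :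
    Measurable (toCond (E₁ := E₁) (E₂ := E₂)) := by
  unfold toCond; fun_prop

namespace PLSModel

variable {Ω : Type*} [MeasurableSpace Ω] {P : Measure Ω}
  {E₁ E₂ : Type*} [MeasurableSpace E₁] [MeasurableSpace E₂] {p R : ℕ}
  (m : PLSModel P E₁ E₂ p R)

/-- The common law of the conditioning histories `(F_{k-1}, G_k)`. -/
def condLaw : Measure ((ℕ → E₁) × (ℕ → E₂)) := P.map (m.cond 0)

lemma measurable_innov (k : ℤ) : Measurable (m.innov k) :=
  (m.measurable_η k).prodMk (m.measurable_ζ k)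

lemma measurable_past (k : ℤ) : Measurable (m.past k) :=
  measurable_pi_lambda _ fun _ => m.measurable_innov _

lemma measurable_cond (k : ℤ) : Measurable (m.cond k) :=
  (m.measurable_F _).prodMk (m.measurable_G _)

lemma toCond_past (k : ℤ) (ω : Ω) : toCond (m.past k ω) = m.cond k ω := by
  simp only [toCond, past, cond, hist, F, G, innov, Prod.mk.injEq]
  refine ⟨funext fun l => ?_, rfl⟩
  simp only [hist]
  congr 1
  push_cast; ring

lemma toCond_update_past (k : ℕ) (ω : Ω) :
    toCond (Function.update (m.past k ω) k (m.η' ω, m.ζ' ω)) = m.condStar k ω := by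
  have key : Function.update (m.past k ω) k (m.η' ω, m.ζ' ω)
      = hist (Function.update (fun i => m.innov i ω) 0 (m.η' ω, m.ζ' ω)) k := by
    funext l
    by_cases h : l = k
    · subst h; simp [hist]
    · rw [Function.update_of_ne h]
      have : (k : ℤ) - l ≠ 0 := by omega
      simp only [past, hist, Function.update_of_ne this]
  rw [key]
  simp only [toCond, condStar, hist, Fstar, Gstar, Prod.mk.injEq]
  refine ⟨funext fun l => ?_, funext fun l => ?_⟩
  · have e : (k : ℤ) - ((l + 1 : ℕ) : ℤ) = k - 1 - l := by push_cast; ring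
    rw [e, hist]
    by_cases h : (k : ℤ) - 1 - l = 0
    · rw [h]; simp
    · simp [Function.update_of_ne h, innov]
  · rw [hist]
    by_cases h : (k : ℤ) - l = 0
    · rw [h]; simp
    · simp [Function.update_of_ne h, innov]

variable [IsProbabilityMeasure P]

instance : IsProbabilityMeasure m.innovLaw :=
  Measure.isProbabilityMeasure_map (m.measurable_innov 0).aemeasurable

instance : IsProbabilityMeasure m.condLaw :=
  Measure.isProbabilityMeasure_map (m.measurable_cond 0).aemeasurable

omit [IsProbabilityMeasure P] in
lemma iIndepFun_innov : iIndepFun m.innov P :=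
  iIndepFun_prodMk_of_indepFun m.iIndep_η m.iIndep_ζ m.measurable_η m.measurable_ζ m.indep_η_ζ

lemma map_innov (k : ℤ) : P.map (m.innov k) = m.innovLaw := by
  have h : ∀ k, P.map (m.innov k) = (P.map (m.η 0)).prod (P.map (m.ζ 0)) := by
    intro k
    have hi : IndepFun (m.η k) (m.ζ k) P :=
      m.indep_η_ζ.comp (measurable_pi_apply k) (measurable_pi_apply k)
    rw [← (m.ident_η k).map_eq, ← (m.ident_ζ k).map_eq]
    exact hi.map_prod_eq_prod_map_map (m.measurable_η k).aemeasurable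
      (m.measurable_ζ k).aemeasurable
  rw [innovLaw, h, h]

lemma map_innov_copy : P.map (fun ω => (m.η' ω, m.ζ' ω)) = m.innovLaw := by
  have hi : IndepFun (m.η 0) (m.ζ 0) P :=
    m.indep_η_ζ.comp (measurable_pi_apply 0) (measurable_pi_apply 0)
  have e := hi.map_prod_eq_prod_map_map (m.measurable_η 0).aemeasurable
      (m.measurable_ζ 0).aemeasurable
  have e' := m.indep_η'_ζ'.map_prod_eq_prod_map_map m.measurable_η'.aemeasurable
    m.measurable_ζ'.aemeasurable
  rw [m.ident_η'.map_eq, m.ident_ζ'.map_eq, ← e] at e'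
  exact e'

lemma map_past (k : ℤ) : P.map (m.past k) = iidLaw m.innovLaw := by
  have hinj : Function.Injective (fun l : ℕ => k - (l : ℤ)) := fun a b h => by
    simp only [sub_right_inj, Nat.cast_inj] at h; exact h
  have h := (m.iIndepFun_innov.precomp hinj).map_fun_eq_infinitePi_map
    fun l => m.measurable_innov _
  simp only [m.map_innov] at h
  exact h

lemma map_cond (k : ℤ) : P.map (m.cond k) = m.condLaw := by
  have h : ∀ k, P.map (m.cond k) = (iidLaw m.innovLaw).map toCond := by
    intro k
    rw [← m.map_past k, Measure.map_map measurable_toCond (m.measurable_past k)]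
    congr 1
    funext ω
    exact (m.toCond_past k ω).symm
  rw [condLaw, h, h]

lemma map_toCond : (iidLaw m.innovLaw).map toCond = m.condLaw := by
  rw [← m.map_past 0, Measure.map_map measurable_toCond (m.measurable_past 0)]
  congr 1
  funext ω
  exact m.toCond_past 0 ω

lemma map_past_copy (k : ℤ) :
    P.map (fun ω => (m.past k ω, (m.η' ω, m.ζ' ω))) = (iidLaw m.innovLaw).prod m.innovLaw := by
  have h : IndepFun (m.past k) (fun ω => (m.η' ω, m.ζ' ω)) P := by
    refine (m.indep_copies.comp (φ := id)
      (ψ := fun z : (ℤ → E₁) × (ℤ → E₂) => fun l : ℕ => (z.1 (k - l), z.2 (k - l)))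
      measurable_id (by fun_prop)).symm
  rw [← m.map_past k, ← m.map_innov_copy]
  exact h.map_prod_eq_prod_map_map (m.measurable_past k).aemeasurable
    (m.measurable_η'.prodMk m.measurable_ζ').aemeasurable

lemma measurable_update {E : Type*} [MeasurableSpace E] (k : ℕ) :
    Measurable (fun z : (ℕ → E) × E => Function.update z.1 k z.2) := by
  refine measurable_pi_lambda _ fun l => ?_
  by_cases h : l = k
  · subst h; simpa using measurable_snd
  · simp only [Function.update_of_ne h]; fun_prop

/-- The cost of swapping a coordinate is the dependence measure. -/
lemma swapCost_toCond {g : (ℕ → E₁) × (ℕ → E₂) → ℝ} (hg : Measurable g) (k : ℕ) :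
    swapCost m.innovLaw (fun s => g (toCond s)) k
      = ∫⁻ ω, ‖g (m.cond k ω) - g (m.condStar k ω)‖ₑ ∂P := by
  have hu := measurable_update (E := E₁ × E₂) k
  have hc := measurable_toCond (E₁ := E₁) (E₂ := E₂)
  rw [swapCost, ← m.map_past_copy k, lintegral_map (by fun_prop)
    ((m.measurable_past k).prodMk (m.measurable_η'.prodMk m.measurable_ζ'))]
  simp only [m.toCond_past, m.toCond_update_past]

omit [IsProbabilityMeasure P] in
lemma measurable_condStar (k : ℕ) : Measurable (m.condStar k) := by
  have : m.condStar k = fun ω => toCond (Function.update (m.past k ω) k (m.η' ω, m.ζ' ω)) :=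
    funext fun ω => (m.toCond_update_past k ω).symm
  rw [this]
  exact measurable_toCond.comp ((measurable_update k).comp
    ((m.measurable_past k).prodMk (m.measurable_η'.prodMk m.measurable_ζ')))

/-- The perturbed history has the law of a history. -/
lemma map_condStar (k : ℕ) : P.map (m.condStar k) = m.condLaw := by
  have hupd : MeasurePreserving
      (fun z : (ℕ → E₁ × E₂) × (E₁ × E₂) => Function.update z.1 k z.2)
      ((iidLaw m.innovLaw).prod m.innovLaw) (iidLaw m.innovLaw) := by
    refine ⟨measurable_update k, ?_⟩
    rw [← (measurePreserving_splice_snd m.innovLaw k).map_eq,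
      Measure.map_map (measurable_update k) (measurePreserving_splice_snd m.innovLaw k).measurable]
    have : ((fun z : (ℕ → E₁ × E₂) × (E₁ × E₂) => Function.update z.1 k z.2) ∘
        fun z : (ℕ → E₁ × E₂) × (ℕ → E₁ × E₂) => (splice (k + 1) z.1 z.2, z.2 k))
        = fun z => splice k z.1 z.2 := by
      funext z; exact (splice_eq_update k z.1 z.2).symm
    rw [this, (measurePreserving_splice m.innovLaw k).map_eq]
  have h := m.map_past_copy k
  have : m.condStar k = fun ω => toCond (Function.update (m.past k ω) k (m.η' ω, m.ζ' ω)) :=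
    funext fun ω => (m.toCond_update_past k ω).symm
  rw [this, ← m.map_toCond, ← hupd.map_eq, ← h, Measure.map_map (measurable_update k)
    ((m.measurable_past k).prodMk (m.measurable_η'.prodMk m.measurable_ζ')),
    Measure.map_map measurable_toCond ((measurable_update k).comp
      ((m.measurable_past k).prodMk (m.measurable_η'.prodMk m.measurable_ζ')))]
  rfl

end PLSModel

namespace PLSModel

variable {Ω : Type*} [MeasurableSpace Ω] {P : Measure Ω}
  {E₁ E₂ : Type*} [MeasurableSpace E₁] [MeasurableSpace E₂] {p R : ℕ}
  (m : PLSModel P E₁ E₂ p R) [IsProbabilityMeasure P]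

/-! ### Law of large numbers under geometric dependence -/

/-- Functions of the last `w` innovations before time `i` are independent of the history up to time
`i - w`. -/
lemma indepFun_window {φ ψ : (ℕ → E₁ × E₂) → ℝ} (hφ : Measurable φ) (hψ : Measurable ψ) {w : ℕ}
    (hw : ∀ s t, (∀ l < w, s l = t l) → φ s = φ t) {i j : ℤ} (hij : j + w ≤ i) :
    IndepFun (fun ω => φ (m.past i ω)) (fun ω => ψ (m.past j ω)) P := by
  obtain ⟨ω₀⟩ := P.nonempty_of_neZero
  let c : E₁ × E₂ := m.innov 0 ω₀
  let fill : ({l // l < w} → E₁ × E₂) → ℕ → E₁ × E₂ := fun z l => if h : l < w then z ⟨l, h⟩ else c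
  have hfill : Measurable fill := by
    refine measurable_pi_lambda _ fun l => ?_
    by_cases h : l < w
    · simp only [fill, dif_pos h]; fun_prop
    · simp only [fill, dif_neg h]; fun_prop
  have h := indepFun_of_disjoint_indices m.iIndepFun_innov m.measurable_innov
    (σ := fun l : {l // l < w} => i - (l : ℕ)) (σ' := fun l : ℕ => j - l) (by
      rintro ⟨a, ha⟩ a'
      simp only [ne_eq]
      omega)
  have h' := h.comp (hφ.comp hfill) hψ
  refine h'.congr (ae_of_all _ fun ω => ?_) (ae_of_all _ fun ω => rfl)
  refine hw _ _ fun l hl => ?_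
  simp only [fill, dif_pos hl]
  rfl

lemma memLp_comp_past {φ : (ℕ → E₁ × E₂) → ℝ} (hφ : Measurable φ)
    (h2 : Integrable (fun s => φ s ^ 2) (iidLaw m.innovLaw)) (i : ℤ) :
    MemLp (fun ω => φ (m.past i ω)) 2 P := by
  have : MemLp φ 2 (P.map (m.past i)) := by
    rw [m.map_past]
    exact (memLp_two_iff_integrable_sq hφ.aestronglyMeasurable).2 h2
  exact this.comp_of_map (m.measurable_past i).aemeasurable

lemma integral_comp_past {φ : (ℕ → E₁ × E₂) → ℝ} (hφ : Measurable φ) (i : ℤ) :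
    ∫ ω, φ (m.past i ω) ∂P = ∫ s, φ s ∂(iidLaw m.innovLaw) := by
  rw [← m.map_past i, integral_map (m.measurable_past i).aemeasurable hφ.aestronglyMeasurable]

/-- Weak law of large numbers with a rate, for functions of the histories that are within `c`, in
`L¹`, of functions of the last `w` innovations. -/
lemma l1Bound_sum_centered {J : Finset ℕ} {g : ℕ → (ℕ → E₁) × (ℕ → E₂) → ℝ}
    (hg : ∀ i, Measurable (g i)) {B c : ℝ} {w : ℕ} (hc0 : 0 ≤ c) (hB0 : 0 ≤ B)
    (hI : ∀ i ∈ J, Integrable (fun h => g i h ^ 2) m.condLaw)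
    (hB : ∀ i ∈ J, ∫ h, g i h ^ 2 ∂m.condLaw ≤ B)
    (hc : ∀ i ∈ J, spliceCost m.innovLaw (fun s => g i (toCond s)) w ≤ ENNReal.ofReal c) :
    L1Bound P (fun ω => ∑ i ∈ J, (g i (m.cond i ω) - ∫ h, g i h ∂m.condLaw))
      (2 * (J.card * c) + √(J.card * ((2 * w + 1) * B))) := by
  let γ : ℕ → (ℕ → E₁ × E₂) → ℝ := fun i s => g i (toCond s)
  have hγ : ∀ i, Measurable (γ i) := fun i => (hg i).comp measurable_toCond
  have hγ2 : ∀ i ∈ J, Integrable (fun s => γ i s ^ 2) (iidLaw m.innovLaw) := fun i hi => by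
    have := hI i hi
    rw [← m.map_toCond] at this
    exact this.comp_measurable measurable_toCond
  have hγB : ∀ i ∈ J, ∫ s, γ i s ^ 2 ∂(iidLaw m.innovLaw) ≤ B := fun i hi => by
    have := hB i hi
    rwa [← m.map_toCond, integral_map measurable_toCond.aemeasurable
      ((hg i).pow_const 2).aestronglyMeasurable] at this
  have hγI : ∀ i ∈ J, Integrable (γ i) (iidLaw m.innovLaw) := fun i hi =>
    ((memLp_two_iff_integrable_sq (hγ i).aestronglyMeasurable).2 (hγ2 i hi)).integrable one_le_two
  let θ : ℕ → (ℕ → E₁ × E₂) → ℝ := fun i => windowMean m.innovLaw (γ i) w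
  have hθ : ∀ i, Measurable (θ i) := fun i => measurable_windowMean (hγ i) w
  have hθ2 := fun i hi => sq_windowMean_le (hγ i) (hγ2 i hi) w
  have hθL : ∀ i ∈ J, MemLp (fun ω => θ i (m.past i ω)) 2 P := fun i hi =>
    m.memLp_comp_past (hθ i) (hθ2 i hi).1 i
  have hmean : ∀ i, ∫ h, g i h ∂m.condLaw = ∫ s, γ i s ∂(iidLaw m.innovLaw) := fun i => by
    rw [← m.map_toCond, integral_map measurable_toCond.aemeasurable (hg i).aestronglyMeasurable]
  -- the window approximation
  have happ : ∀ i ∈ J, L1Bound (iidLaw m.innovLaw) (fun s => γ i s - θ i s) c := fun i hi =>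
    L1Bound.of_lintegral ((hγ i).sub (hθ i)).aestronglyMeasurable hc0
      ((lintegral_sub_windowMean_le (hγ i) (hγI i hi) w).trans (hc i hi))
  have happ' : ∀ i ∈ J, L1Bound P (fun ω => γ i (m.past i ω) - θ i (m.past i ω)) c := by
    intro i hi
    have hm : Measurable (fun s => γ i s - θ i s) := (hγ i).sub (hθ i)
    refine ⟨?_, ?_⟩
    · have := (happ i hi).1
      rw [← m.map_past i] at this
      exact this.comp_measurable (m.measurable_past i)
    · have := (happ i hi).2
      rwa [← m.integral_comp_past (φ := fun s => |γ i s - θ i s|) hm.abs i] at this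
  have hθI : ∀ i ∈ J, Integrable (θ i) (iidLaw m.innovLaw) := fun i hi =>
    ((memLp_two_iff_integrable_sq (hθ i).aestronglyMeasurable).2 (hθ2 i hi).1).integrable one_le_two
  have hconst : ∀ i ∈ J, L1Bound P (fun _ => ∫ s, θ i s ∂(iidLaw m.innovLaw)
      - ∫ s, γ i s ∂(iidLaw m.innovLaw)) c := by
    intro i hi
    refine ⟨integrable_const _, ?_⟩
    simp only [integral_const, probReal_univ, one_smul]
    rw [← integral_sub (hθI i hi) (hγI i hi)]
    refine (abs_integral_le_integral_abs).trans (le_trans (le_of_eq ?_) (happ i hi).2)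
    exact integral_congr_ae (ae_of_all _ fun s => abs_sub_comm _ _)
  -- the window means form a finitely dependent sequence
  have hvar : L1Bound P (fun ω => ∑ i ∈ J, (θ i (m.past i ω) - ∫ s, θ i s ∂(iidLaw m.innovLaw)))
      (√(J.card * ((2 * w + 1) * B))) := by
    refine L1Bound.sum_of_orthogonal (fun i j : ℕ => i < j + w ∧ j < i + w)
      (fun i hi => (hθL i hi).sub (memLp_const _)) (fun i hi => ?_) hB0 (fun i _ => ?_) ?_
    · have h1 := variance_le_expectation_sq (hθL i hi).aestronglyMeasurable
      rw [variance_eq_integral (hθL i hi).aestronglyMeasurable.aemeasurable,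
        m.integral_comp_past (hθ i)] at h1
      refine h1.trans ?_
      have h3 : ∫ ω, ((fun ω => θ i (m.past i ω)) ^ 2) ω ∂P
          = ∫ s, θ i s ^ 2 ∂(iidLaw m.innovLaw) :=
        m.integral_comp_past (φ := fun s => θ i s ^ 2) ((hθ i).pow_const 2) i
      rw [h3]
      exact ((hθ2 i hi).2).trans (hγB i hi)
    · have : (J.filter (fun j => i < j + w ∧ j < i + w)).card ≤ 2 * w + 1 := by
        refine (Finset.card_le_card (t := Finset.Icc (i - w) (i + w)) fun j hj => ?_).trans ?_
        · have := (Finset.mem_filter.1 hj).2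
          rw [Finset.mem_Icc]; omega
        · rw [Nat.card_Icc]; omega
      exact_mod_cast this
    · have hcov : ∀ i ∈ J, ∀ j ∈ J, j + w ≤ i →
          ∫ ω, (θ i (m.past i ω) - ∫ s, θ i s ∂(iidLaw m.innovLaw)) *
            (θ j (m.past j ω) - ∫ s, θ j s ∂(iidLaw m.innovLaw)) ∂P = 0 := by
        intro i hi j hj hij
        have h1 := (m.indepFun_window (hθ i) (hθ j) (fun s t h => windowMean_congr h)
          (i := i) (j := j) (w := w) (by exact_mod_cast hij)).covariance_eq_zero (hθL i hi) (hθL j hj)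
        rwa [covariance, m.integral_comp_past (hθ i), m.integral_comp_past (hθ j)] at h1
      intro i hi j hj hn
      by_cases h : j + w ≤ i
      · exact hcov i hi j hj h
      · have := hcov j hj i hi (by omega)
        simpa only [mul_comm] using this
  have h := ((L1Bound.sum_const happ').add (L1Bound.sum_const hconst)).add hvar
  have e : (fun ω => ∑ i ∈ J, (g i (m.cond i ω) - ∫ h, g i h ∂m.condLaw))
      = fun ω => ((∑ i ∈ J, (γ i (m.past i ω) - θ i (m.past i ω)))
        + (∑ i ∈ J, (∫ s, θ i s ∂(iidLaw m.innovLaw) - ∫ s, γ i s ∂(iidLaw m.innovLaw))))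
        + ∑ i ∈ J, (θ i (m.past i ω) - ∫ s, θ i s ∂(iidLaw m.innovLaw)) := by
    funext ω
    rw [← Finset.sum_add_distrib, ← Finset.sum_add_distrib]
    refine Finset.sum_congr rfl fun i _ => ?_
    rw [hmean i]
    simp only [γ, m.toCond_past]
    ring
  rw [e]
  exact h.mono_const (by linarith)

/-! ### Sums of martingale differences -/

lemma map_cond_η (k : ℤ) :
    P.map (fun ω => (m.cond k ω, m.η k ω)) = m.condLaw.prod (P.map (m.η 0)) := by
  rw [← m.map_cond k]
  exact m.map_innovation k

/-- Sums of functions of `(F_{i-1}, G_i)` and `η_i` that are centred in `η_i`. -/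
lemma l1Bound_sum_martingaleDiff {J : Finset ℕ} {z : ℕ → ((ℕ → E₁) × (ℕ → E₂)) × E₁ → ℝ}
    (hz : ∀ i, Measurable (z i)) {B : ℝ} (hB0 : 0 ≤ B)
    (hI : ∀ i ∈ J, Integrable (fun u => z i u ^ 2) (m.condLaw.prod (P.map (m.η 0))))
    (hB : ∀ i ∈ J, ∫ u, z i u ^ 2 ∂(m.condLaw.prod (P.map (m.η 0))) ≤ B)
    (h0 : ∀ i ∈ J, ∀ᵐ h ∂m.condLaw, ∫ e, z i (h, e) ∂(P.map (m.η 0)) = 0) :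
    L1Bound P (fun ω => ∑ i ∈ J, z i (m.cond i ω, m.η i ω)) (√(J.card * B)) := by
  have : IsProbabilityMeasure (P.map (m.η 0)) :=
    Measure.isProbabilityMeasure_map (m.measurable_η 0).aemeasurable
  have hX : ∀ i : ℕ, Measurable (fun ω => (m.cond i ω, m.η i ω)) := fun i =>
    (m.measurable_cond i).prodMk (m.measurable_η i)
  have hL : ∀ i ∈ J, MemLp (fun ω => z i (m.cond i ω, m.η i ω)) 2 P := by
    intro i hi
    have : MemLp (z i) 2 (P.map (fun ω => (m.cond i ω, m.η i ω))) := by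
      rw [m.map_cond_η]
      exact (memLp_two_iff_integrable_sq (hz i).aestronglyMeasurable).2 (hI i hi)
    exact this.comp_of_map (hX i).aemeasurable
  have key : ∀ i ∈ J, ∀ j ∈ J, i < j →
      ∫ ω, z i (m.cond i ω, m.η i ω) * z j (m.cond j ω, m.η j ω) ∂P = 0 := by
    intro i hi j hj hij
    -- the earlier summand is a function of the later conditioning history
    let back : (ℕ → E₁) × (ℕ → E₂) → ((ℕ → E₁) × (ℕ → E₂)) × E₁ := fun q =>
      ((fun l => q.1 (l + (j - i)), fun l => q.2 (l + (j - i))), q.1 (j - i - 1))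
    have hback : Measurable back := by fun_prop
    have hb : ∀ ω, back (m.cond j ω) = (m.cond i ω, m.η i ω) := by
      intro ω
      simp only [back, cond, F, G, hist, Prod.mk.injEq]
      refine ⟨⟨funext fun l => ?_, funext fun l => ?_⟩, ?_⟩
      · congr 1; push_cast [Nat.cast_sub hij.le]; ring
      · congr 1; push_cast [Nat.cast_sub hij.le]; ring
      · congr 1; omega
    have hprod : Integrable (fun ω => z i (m.cond i ω, m.η i ω) * z j (m.cond j ω, m.η j ω)) P :=
      (hL i hi).integrable_mul (hL j hj)
    let φ : ((ℕ → E₁) × (ℕ → E₂)) × E₁ → ℝ := fun u => z i (back u.1) * z j u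
    have hφ : Measurable φ := ((hz i).comp (hback.comp measurable_fst)).mul (hz j)
    have e : (fun ω => z i (m.cond i ω, m.η i ω) * z j (m.cond j ω, m.η j ω))
        = fun ω => φ (m.cond j ω, m.η j ω) := by
      funext ω; simp only [φ, hb]
    rw [e] at hprod ⊢
    have h1 : ∫ ω, φ (m.cond j ω, m.η j ω) ∂P = ∫ u, φ u ∂(m.condLaw.prod (P.map (m.η 0))) := by
      rw [← m.map_cond_η j, integral_map (hX j).aemeasurable hφ.aestronglyMeasurable]
    have h2 : Integrable φ (m.condLaw.prod (P.map (m.η 0))) := by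
      rw [← m.map_cond_η j]
      exact (integrable_map_measure hφ.aestronglyMeasurable (hX j).aemeasurable).2 hprod
    rw [h1, integral_prod _ h2]
    refine integral_eq_zero_of_ae ?_
    filter_upwards [h0 j hj] with h hh
    simp only [φ, Pi.zero_apply]
    rw [integral_const_mul, hh, mul_zero]
  have h := L1Bound.sum_of_orthogonal (P := P) (J := J) (N := 1) (B := B) (fun i j => i = j) hL
    (fun i hi => ?_) hB0 (fun i _ => ?_) ?_
  · simpa using h
  · have h1 : ∫ ω, z i (m.cond i ω, m.η i ω) ^ 2 ∂P
        = ∫ u, z i u ^ 2 ∂(m.condLaw.prod (P.map (m.η 0))) := by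
      rw [← m.map_cond_η i, integral_map (hX i).aemeasurable
        ((hz i).pow_const 2).aestronglyMeasurable]
    rw [h1]
    exact hB i hi
  · have : (J.filter (fun j => i = j)).card ≤ 1 :=
      Finset.card_le_one.2 fun a ha b hb =>
        (Finset.mem_filter.1 ha).2.symm.trans (Finset.mem_filter.1 hb).2
    exact_mod_cast this
  · intro i hi j hj hne
    rcases lt_or_gt_of_ne hne with h | h
    · exact key i hi j hj h
    · have := key j hj i hi h
      simpa only [mul_comm] using this

end PLSModel

/-! ### Measurability of local properties of distribution functions -/

section OneDim

variable {μ : Measure ℝ} [IsProbabilityMeasure μ]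

/-- By right-continuity of the distribution function, expansion bounds need only be checked at
rational points. -/
lemma abs_cdf_sub_le_of_rat {U : Set ℝ} (hU : IsOpen U) {f : ℝ} {ψ : ℝ → ℝ} (hψ : Continuous ψ)
    (h : ∀ q : ℚ, (q : ℝ) ∈ U → |μ.real (Iic (q : ℝ)) - μ.real (Iic 0) - q * f| ≤ ψ q) :
    ∀ s ∈ U, |μ.real (Iic s) - μ.real (Iic 0) - s * f| ≤ ψ s := by
  intro s hs
  have hF : Tendsto (fun u => μ.real (Iic u)) (𝓝[>] s) (𝓝 (μ.real (Iic s))) := by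
    have h1 := ((cdf μ).right_continuous s).mono_left (nhdsWithin_mono s Ioi_subset_Ici_self)
    have e : (cdf μ : ℝ → ℝ) = fun u => μ.real (Iic u) := funext fun u => cdf_eq_real μ u
    rw [e] at h1
    exact h1
  have hid : Tendsto (fun u : ℝ => u * f) (𝓝[>] s) (𝓝 (s * f)) :=
    (Continuous.tendsto (by fun_prop) s).mono_left nhdsWithin_le_nhds
  refine le_of_tendsto_of_tendsto_of_frequently ((hF.sub_const _).sub hid).abs
    ((hψ.tendsto s).mono_left nhdsWithin_le_nhds) ?_
  rw [Filter.frequently_iff]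
  intro V hV
  obtain ⟨u, hu, hV⟩ := mem_nhdsGT_iff_exists_Ioo_subset.1
    (Filter.inter_mem hV (mem_nhdsWithin_of_mem_nhds (hU.mem_nhds hs)))
  obtain ⟨q, hq1, hq2⟩ := exists_rat_btwn (mem_Ioi.1 hu)
  have hq := hV ⟨hq1, hq2⟩
  exact ⟨q, hq.1, h q hq.2⟩

lemma RegularLaw.iff_rat {f A : ℝ} : RegularLaw μ f A ↔
    (∀ q : ℚ, |μ.real (Iic (q : ℝ)) - μ.real (Iic 0)| ≤ A * |(q : ℝ)|) ∧
    (∀ q : ℚ, |μ.real (Iic (q : ℝ)) - μ.real (Iic 0) - q * f| ≤ A * (q : ℝ) ^ 2) := by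
  refine ⟨fun h => ⟨fun q => h.linear q, fun q => h.quadratic q⟩, fun h => ⟨fun s => ?_, fun s => ?_⟩⟩
  · have := abs_cdf_sub_le_of_rat (μ := μ) isOpen_univ (f := 0) (ψ := fun s => A * |s|)
      (by fun_prop) (fun q _ => by simpa using h.1 q) s (mem_univ s)
    simpa using this
  · exact abs_cdf_sub_le_of_rat (μ := μ) isOpen_univ (ψ := fun s => A * s ^ 2)
      (by fun_prop) (fun q _ => h.2 q) s (mem_univ s)

omit [IsProbabilityMeasure μ] in
lemma RegularLaw.hasDerivAt {f A : ℝ} (h : RegularLaw μ f A) :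
    HasDerivAt (fun u => μ.real (Iic u)) f 0 := by
  rw [hasDerivAt_iff_isLittleO_nhds_zero]
  simp only [zero_add, smul_eq_mul]
  have h1 : (fun s : ℝ => μ.real (Iic s) - μ.real (Iic 0) - s * f) =O[𝓝 0] fun s : ℝ => s ^ 2 := by
    refine Asymptotics.IsBigO.of_bound A (Eventually.of_forall fun s => ?_)
    simpa using h.quadratic s
  exact h1.trans_isLittleO (by simpa using Asymptotics.isLittleO_pow_id (𝕜 := ℝ) one_lt_two)

omit [IsProbabilityMeasure μ] in
lemma RegularLaw.abs_slope_le {f A : ℝ} (h : RegularLaw μ f A) : |f| ≤ 2 * A := by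
  have h1 := h.linear 1
  have h2 := h.quadratic 1
  norm_num at h1 h2
  have h3 : |f| ≤ |μ.real (Iic 1) - μ.real (Iic 0)| + |μ.real (Iic 1) - μ.real (Iic 0) - f| := by
    have := abs_sub (μ.real (Iic 1) - μ.real (Iic 0)) (μ.real (Iic 1) - μ.real (Iic 0) - f)
    rwa [sub_sub_cancel] at this
  linarith

/-- Differentiability at zero as a countable condition, for measurability in the history. -/
lemma hasDerivAt_cdf_iff_rat {f : ℝ} : HasDerivAt (fun u => μ.real (Iic u)) f 0 ↔
    ∀ k : ℕ, ∃ j : ℕ, ∀ q : ℚ, |(q : ℝ)| < 1 / ((j : ℝ) + 1) →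
      |μ.real (Iic (q : ℝ)) - μ.real (Iic 0) - q * f| ≤ 1 / ((k : ℝ) + 1) * |(q : ℝ)| := by
  rw [hasDerivAt_iff_isLittleO_nhds_zero, Asymptotics.isLittleO_iff]
  simp only [zero_add, smul_eq_mul, Real.norm_eq_abs]
  constructor
  · intro h k
    obtain ⟨δ, hδ, hb⟩ := Metric.eventually_nhds_iff.1 (h (c := 1 / ((k : ℝ) + 1)) (by positivity))
    obtain ⟨j, hj⟩ := exists_nat_one_div_lt hδ
    exact ⟨j, fun q hq => hb (by rw [dist_zero_right]; exact hq.trans hj)⟩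
  · intro h c hc
    obtain ⟨k, hk⟩ := exists_nat_one_div_lt hc
    obtain ⟨j, hj⟩ := h k
    have hopen : IsOpen {s : ℝ | |s| < 1 / ((j : ℝ) + 1)} :=
      isOpen_lt continuous_abs continuous_const
    have hext := abs_cdf_sub_le_of_rat (μ := μ) hopen (f := f)
      (ψ := fun s => 1 / ((k : ℝ) + 1) * |s|) (by fun_prop) hj
    filter_upwards [hopen.mem_nhds (by simp; positivity)] with s hs
    exact (hext s hs).trans (mul_le_mul_of_nonneg_right hk.le (abs_nonneg s))

end OneDim

/-- A differentiable distribution function with bounded derivative, Lipschitz near zero, gives a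
regular law. -/
lemma RegularLaw.of_differentiable {μ : Measure ℝ} {M c : ℝ} (hc : 0 < c)
    (hd : Differentiable ℝ (fun u => μ.real (Iic u)))
    (hM : ∀ u, |deriv (fun u => μ.real (Iic u)) u| ≤ M)
    (hL : ∀ u₁ u₂ : ℝ, -c < u₁ → u₁ < u₂ → u₂ < c →
      |(deriv (fun u => μ.real (Iic u)) u₁ - deriv (fun u => μ.real (Iic u)) u₂) / (u₁ - u₂)| ≤ M) :
    RegularLaw μ (deriv (fun u => μ.real (Iic u)) 0) (M + 2 * M / c) := by
  set F : ℝ → ℝ := fun u => μ.real (Iic u) with hF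
  have hM0 : 0 ≤ M := (abs_nonneg _).trans (hM 0)
  have hlin : ∀ s, |F s - F 0| ≤ M * |s| := by
    intro s
    have := Convex.norm_image_sub_le_of_norm_deriv_le (f := F) (s := univ) (x := 0) (y := s)
      (fun x _ => hd x) (fun x _ => hM x) convex_univ (mem_univ _) (mem_univ _)
    simpa using this
  have hlip : ∀ u, |u| < c → |deriv F u - deriv F 0| ≤ M * |u| := by
    intro u hu
    obtain ⟨h1, h2⟩ := abs_lt.1 hu
    rcases lt_trichotomy u 0 with h | h | h
    · have := hL u 0 h1 h hc
      rwa [sub_zero, abs_div, div_le_iff₀ (abs_pos.2 h.ne)] at this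
    · subst h; simp
    · have := hL 0 u (by linarith) h h2
      rwa [zero_sub, abs_div, abs_neg, div_le_iff₀ (abs_pos.2 h.ne'), abs_sub_comm] at this
  refine ⟨fun s => (hlin s).trans ?_, fun s => ?_⟩
  · have : 0 ≤ 2 * M / c := by positivity
    exact mul_le_mul_of_nonneg_right (by linarith) (abs_nonneg s)
  · change |F s - F 0 - s * deriv F 0| ≤ _
    by_cases hs : |s| < c
    · have hG : ∀ x ∈ uIcc 0 s, HasDerivWithinAt (fun u => F u - u * deriv F 0)
          (deriv F x - deriv F 0) (uIcc 0 s) x := fun x _ => by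
        have h2 := ((hd x).hasDerivAt.sub ((hasDerivAt_id x).mul_const (deriv F 0)))
        simp only [one_mul] at h2
        exact h2.hasDerivWithinAt
      have hb : ∀ x ∈ uIcc 0 s, ‖deriv F x - deriv F 0‖ ≤ M * |s| := by
        intro x hx
        have hxs : |x| ≤ |s| := by simpa using abs_sub_left_of_mem_uIcc hx
        exact (hlip x (hxs.trans_lt hs)).trans (mul_le_mul_of_nonneg_left hxs hM0)
      have := Convex.norm_image_sub_le_of_norm_hasDerivWithin_le hG hb (convex_uIcc 0 s)
        left_mem_uIcc right_mem_uIcc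
      simp only [zero_mul, sub_zero, Real.norm_eq_abs] at this
      have e : F s - s * deriv F 0 - F 0 = F s - F 0 - s * deriv F 0 := by ring
      rw [e] at this
      have h2 : 0 ≤ 2 * M / c * s ^ 2 := by positivity
      rw [mul_assoc, abs_mul_abs_self, ← sq] at this
      linarith
    · have hs' : c ≤ |s| := not_lt.1 hs
      -- away from zero the linear bound suffices, since `|s| ≤ s² / c`
      have h1 : |F s - F 0 - s * deriv F 0| ≤ 2 * M * |s| := by
        refine (abs_sub _ _).trans ?_
        rw [abs_mul]
        have := mul_le_mul_of_nonneg_left (hM 0) (abs_nonneg s)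
        linarith [hlin s]
      have h2 : 2 * M * |s| ≤ 2 * M / c * s ^ 2 := by
        rw [div_mul_eq_mul_div, le_div_iff₀ hc, ← sq_abs s, sq, ← mul_assoc]
        exact mul_le_mul_of_nonneg_left hs' (by positivity)
      have h3 : 0 ≤ M * s ^ 2 := by positivity
      linarith

namespace PLSModel

variable {Ω : Type*} [MeasurableSpace Ω] {P : Measure Ω}
  {E₁ E₂ : Type*} [MeasurableSpace E₁] [MeasurableSpace E₂] {p R : ℕ}
  (m : PLSModel P E₁ E₂ p R)

/-! ### The conditional law of the errors -/

/-- The error `D_r(t, F_k, G_k)` as a function of `((F_{k-1}, G_k), η_k)`. -/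
def errFun (r : Fin (R + 1)) (t : ℝ) (z : ((ℕ → E₁) × (ℕ → E₂)) × E₁) : ℝ :=
  m.D r t (push z.2 z.1.1) z.1.2

/-- The conditional law of `D_r(t, F_k, G_k)` given `(F_{k-1}, G_k) = h`. -/
def errLaw (r : Fin (R + 1)) (t : ℝ) (h : (ℕ → E₁) × (ℕ → E₂)) : Measure ℝ :=
  (P.map (m.η 0)).map fun e => m.errFun r t (h, e)

/-- A measurable version of the conditional density at zero: the limit of the difference quotients at
`1 / (n + 1)`, which is the derivative wherever that exists. -/
def densityVersion (r : Fin (R + 1)) (t : ℝ) (h : (ℕ → E₁) × (ℕ → E₂)) : ℝ :=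
  limUnder atTop fun n : ℕ =>
    ((n : ℝ) + 1) * (m.condCDF r t h.1 h.2 (1 / ((n : ℝ) + 1)) - m.condCDF r t h.1 h.2 0)

lemma measurable_errFun (r : Fin (R + 1)) (t : ℝ) : Measurable (m.errFun r t) :=
  (m.measurable_D r t).comp ((measurable_push.comp (measurable_snd.prodMk measurable_fst.fst)).prodMk
    measurable_fst.snd)

lemma real_errLaw_Iic (r : Fin (R + 1)) (t u : ℝ) (h : (ℕ → E₁) × (ℕ → E₂)) :
    (m.errLaw r t h).real (Iic u) = m.condCDF r t h.1 h.2 u := by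
  have hm : Measurable (fun e => m.errFun r t (h, e)) :=
    (m.measurable_errFun r t).comp measurable_prodMk_left
  rw [errLaw, map_measureReal_apply hm measurableSet_Iic]
  rfl

lemma condCDF_eq (r : Fin (R + 1)) (t : ℝ) (h : (ℕ → E₁) × (ℕ → E₂)) :
    m.condCDF r t h.1 h.2 = fun u => (m.errLaw r t h).real (Iic u) :=
  funext fun u => (m.real_errLaw_Iic r t u h).symm

lemma densityVersion_eq {r : Fin (R + 1)} {t f : ℝ} {h : (ℕ → E₁) × (ℕ → E₂)}
    (hd : HasDerivAt (fun u => (m.errLaw r t h).real (Iic u)) f 0) :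
    m.densityVersion r t h = f := by
  refine Tendsto.limUnder_eq ?_
  have h1 := hd.tendsto_slope_zero_right
  have h2 : Tendsto (fun n : ℕ => 1 / ((n : ℝ) + 1)) atTop (𝓝[>] 0) :=
    tendsto_nhdsWithin_iff.2 ⟨tendsto_one_div_add_atTop_nhds_zero_nat,
      Eventually.of_forall fun n => by simp only [mem_Ioi]; positivity⟩
  refine (h1.comp h2).congr fun n => ?_
  simp [Function.comp, m.real_errLaw_Iic]

lemma integral_errLaw {φ : ℝ → ℝ} (hφ : Measurable φ) (r : Fin (R + 1)) (t : ℝ)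
    (h : (ℕ → E₁) × (ℕ → E₂)) :
    ∫ ε, φ ε ∂(m.errLaw r t h) = ∫ e, φ (m.errFun r t (h, e)) ∂(P.map (m.η 0)) :=
  integral_map ((m.measurable_errFun r t).comp measurable_prodMk_left).aemeasurable
    hφ.aestronglyMeasurable

variable [IsProbabilityMeasure P]

instance : IsProbabilityMeasure (P.map (m.η 0)) :=
  Measure.isProbabilityMeasure_map (m.measurable_η 0).aemeasurable

instance (r : Fin (R + 1)) (t : ℝ) (h : (ℕ → E₁) × (ℕ → E₂)) :
    IsProbabilityMeasure (m.errLaw r t h) :=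
  Measure.isProbabilityMeasure_map
    ((m.measurable_errFun r t).comp measurable_prodMk_left).aemeasurable

lemma measurable_real_errLaw_Iic (r : Fin (R + 1)) (t u : ℝ) :
    Measurable (fun h => (m.errLaw r t h).real (Iic u)) := by
  have hA : MeasurableSet (m.errFun r t ⁻¹' Iic u) := m.measurable_errFun r t measurableSet_Iic
  have := (measurable_measure_prodMk_left (ν := P.map (m.η 0)) hA).ennreal_toReal
  convert this using 2 with h
  have hm : Measurable (fun e => m.errFun r t (h, e)) :=
    (m.measurable_errFun r t).comp measurable_prodMk_left
  rw [errLaw, measureReal_def, Measure.map_apply hm measurableSet_Iic]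
  rfl

lemma measurable_densityVersion (r : Fin (R + 1)) (t : ℝ) : Measurable (m.densityVersion r t) := by
  refine (StronglyMeasurable.limUnder fun n => ?_).measurable
  simp only [← m.real_errLaw_Iic]
  exact (((m.measurable_real_errLaw_Iic r t _).sub
    (m.measurable_real_errLaw_Iic r t _)).const_mul _).stronglyMeasurable

lemma measurableSet_regularLaw (r : Fin (R + 1)) (t A : ℝ) :
    MeasurableSet {h | RegularLaw (m.errLaw r t h) (m.densityVersion r t h) A} := by
  simp only [RegularLaw.iff_rat, ofPred_and, ofPred_forall]
  have hF := m.measurable_real_errLaw_Iic r t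
  have hd := m.measurable_densityVersion r t
  refine MeasurableSet.inter (MeasurableSet.iInter fun q => ?_) (MeasurableSet.iInter fun q => ?_)
  · exact measurableSet_le ((hF q).sub (hF 0)).abs measurable_const
  · exact measurableSet_le (((hF q).sub (hF 0)).sub (hd.const_mul _)).abs measurable_const

lemma measurableSet_hasDerivAt (r : Fin (R + 1)) (t : ℝ) :
    MeasurableSet {h | HasDerivAt (fun u => (m.errLaw r t h).real (Iic u))
      (m.densityVersion r t h) 0} := by
  simp only [hasDerivAt_cdf_iff_rat, ofPred_forall, ofPred_exists]
  have hF := m.measurable_real_errLaw_Iic r t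
  have hd := m.measurable_densityVersion r t
  refine MeasurableSet.iInter fun k => MeasurableSet.iUnion fun j => MeasurableSet.iInter fun q =>
    MeasurableSet.iInter fun _ => ?_
  exact measurableSet_le (((hF q).sub (hF 0)).sub (hd.const_mul _)).abs measurable_const

variable {m}

/-- Almost every history admits a density at zero, given by `densityVersion`. -/
lemma ae_hasDerivAt [NeZero p] (h : m.ErrorRegular) {r : Fin (R + 1)} {t : ℝ} (ht : t ∈ m.piece' r) :
    ∀ᵐ h ∂m.condLaw, HasDerivAt (fun u => (m.errLaw r t h).real (Iic u))
      (m.densityVersion r t h) 0 := by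
  rw [condLaw, ae_map_iff (m.measurable_cond 0).aemeasurable (m.measurableSet_hasDerivAt r t)]
  filter_upwards [h.differentiable r t ht] with ω hω
  have h1 := hω 0 (NeZero.pos p)
  have e0 : m.condCDFDeriv 0 r t (m.F (-1) ω) (m.G 0 ω) = m.condCDF r t (m.F (-1) ω) (m.G 0 ω) := by
    funext u; simp [condCDFDeriv]
  rw [e0] at h1
  have h2 := (h1 0).hasDerivAt
  have e : m.condCDF r t (m.F (-1) ω) (m.G 0 ω)
      = fun u => (m.errLaw r t (m.cond 0 ω)).real (Iic u) := m.condCDF_eq r t (m.cond 0 ω)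
  rw [e] at h2
  rwa [m.densityVersion_eq h2]

/-- Regularity holds at the history `(F_{-1}, G_0)`, hence at almost every history. -/
lemma ae_regularLaw [NeZero p] (h : m.ErrorRegular) (h' : m.DensityRegular) :
    ∃ A : ℝ, ∀ r, ∀ t ∈ m.piece r, ∀ᵐ h ∂m.condLaw,
      RegularLaw (m.errLaw r t h) (m.densityVersion r t h) A := by
  obtain ⟨c, hc, ε, -, M, hb⟩ := h'.bounds
  refine ⟨M + 2 * M / c, fun r t ht => ?_⟩
  rw [condLaw, ae_map_iff (m.measurable_cond 0).aemeasurable (m.measurableSet_regularLaw r t _)]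
  filter_upwards [h.differentiable r t (Ioo_subset_Ioc_self ht), hb r t ht] with ω hω hω'
  have h1 := hω 0 (NeZero.pos p)
  have e0 : m.condCDFDeriv 0 r t (m.F (-1) ω) (m.G 0 ω) = m.condCDF r t (m.F (-1) ω) (m.G 0 ω) := by
    funext u; simp [condCDFDeriv]
  rw [e0] at h1
  simp only [condDensity] at hω'
  have e : m.condCDF r t (m.F (-1) ω) (m.G 0 ω)
      = fun u => (m.errLaw r t (m.cond 0 ω)).real (Iic u) := m.condCDF_eq r t (m.cond 0 ω)
  rw [e] at h1 hω'
  have h2 := RegularLaw.of_differentiable hc h1 hω'.2.1 hω'.2.2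
  rwa [← m.densityVersion_eq h2.hasDerivAt] at h2

/-- The density at zero agrees almost surely with its measurable version along any random history
with the common law, in particular along `(F_{k-1}, G_k)` and `(F_{k-1}^*, G_k^*)`. -/
lemma ae_condDensity_eq [NeZero p] (h : m.ErrorRegular) {r : Fin (R + 1)} {t : ℝ}
    (ht : t ∈ m.piece' r) {X : Ω → (ℕ → E₁) × (ℕ → E₂)} (hX : Measurable X)
    (hlaw : P.map X = m.condLaw) :
    ∀ᵐ ω ∂P, m.condDensity r t (X ω).1 (X ω).2 0 = m.densityVersion r t (X ω) := by
  have h1 := ae_hasDerivAt h ht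
  rw [← hlaw] at h1
  filter_upwards [ae_of_ae_map hX.aemeasurable h1] with ω hω
  rw [condDensity, m.condCDF_eq, hω.deriv]

end PLSModel

/-! ### Fourth moments and Hölder's inequality -/

section Moments

variable {Ω : Type*} [MeasurableSpace Ω] {P : Measure Ω}

lemma l1Bound_norm_pow_four {V : Type*} [NormedAddCommGroup V] {X : Ω → V} {M : ℝ} (hM : 0 ≤ M)
    (hX : AEStronglyMeasurable X P) (h : eLpNorm X 4 P ≤ ENNReal.ofReal M) :
    L1Bound P (fun ω => ‖X ω‖ ^ 4) (M ^ 4) := by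
  refine L1Bound.of_lintegral (hX.norm.pow 4) (by positivity) ?_
  have h1 := eLpNorm_nnreal_pow_eq_lintegral (f := X) (μ := P) (p := 4) (by norm_num)
  simp only [NNReal.coe_ofNat, ENNReal.coe_ofNat, ENNReal.rpow_ofNat] at h1
  simp only [enorm_pow, enorm_norm]
  rw [← h1, ENNReal.ofReal_pow hM]
  exact pow_le_pow_left' h 4

lemma eLpNorm_mul_three_le {a b c : Ω → ℝ} [IsProbabilityMeasure P] (ha : AEStronglyMeasurable a P)
    (hb : AEStronglyMeasurable b P) (hc : AEStronglyMeasurable c P) :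
    eLpNorm (fun ω => a ω * (b ω * c ω)) 1 P ≤ eLpNorm a 4 P * (eLpNorm b 4 P * eLpNorm c 4 P) := by
  have : ENNReal.HolderTriple 4 4 2 := ⟨by
    have e : (4 : ℝ≥0∞) = 2 * 2 := by norm_num
    rw [e, ENNReal.mul_inv (by simp) (by simp), ← two_mul, ← mul_assoc,
      ENNReal.mul_inv_cancel (by simp) (by simp), one_mul]⟩
  have h1 : eLpNorm (fun ω => b ω * c ω) 2 P ≤ eLpNorm b 4 P * eLpNorm c 4 P :=
    eLpNorm_smul_le_mul_eLpNorm (f := c) (φ := b) (p := 4) (q := 4) hc hb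
  have h2 : eLpNorm (fun ω => a ω * (b ω * c ω)) 1 P
      ≤ eLpNorm a 2 P * eLpNorm (fun ω => b ω * c ω) 2 P :=
    eLpNorm_smul_le_mul_eLpNorm (f := fun ω => b ω * c ω) (φ := a) (p := 2) (q := 2)
      (hb.mul hc) ha
  exact h2.trans (mul_le_mul' (eLpNorm_le_eLpNorm_of_exponent_le (by norm_num) ha) h1)

end Moments

namespace PLSModel

variable {Ω : Type*} [MeasurableSpace Ω] {P : Measure Ω}
  {E₁ E₂ : Type*} [MeasurableSpace E₁] [MeasurableSpace E₂] {p R : ℕ}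
  (m : PLSModel P E₁ E₂ p R)

/-! ### The predictors and errors in terms of the histories -/

lemma piece'_unique {t : ℝ} {r r' : Fin (R + 1)} (h : t ∈ m.piece' r) (h' : t ∈ m.piece' r') :
    r = r' := by
  have key : ∀ {r r' : Fin (R + 1)}, t ∈ m.piece' r → t ∈ m.piece' r' → ¬ r < r' := by
    intro r r' h h' hlt
    have h1 : m.b r.succ ≤ m.b r'.castSucc := by
      refine m.b_strictMono.monotone ?_
      rw [Fin.le_def]
      simpa using hlt
    exact absurd h.2 (not_le.2 (h1.trans_lt h'.1))
  exact le_antisymm (not_lt.1 (key h' h)) (not_lt.1 (key h h'))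

lemma exists_mem_piece' {t : ℝ} (h0 : 0 < t) (h1 : t ≤ 1) : ∃ r, t ∈ m.piece' r := by
  have key : ∀ k : Fin (R + 2), t ≤ m.b k → ∃ r, t ∈ m.piece' r := by
    intro k
    induction k using Fin.induction with
    | zero => intro h; rw [m.b_zero] at h; linarith
    | succ k ih =>
      intro h
      by_cases hk : t ≤ m.b k.castSucc
      · exact ih hk
      · exact ⟨k, not_le.1 hk, h⟩
  exact key (Fin.last (R + 1)) (by rw [m.b_last]; exact h1)

lemma exists_index {n i : ℕ} (hi : i ∈ Finset.Icc 1 n) : ∃ r, (i : ℝ) / n ∈ m.piece' r := by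
  obtain ⟨h1, h2⟩ := Finset.mem_Icc.1 hi
  have hn : (0 : ℝ) < n := by exact_mod_cast lt_of_lt_of_le h1 h2
  refine m.exists_mem_piece' (div_pos (by exact_mod_cast h1) hn) ?_
  rw [div_le_one hn]
  exact_mod_cast h2

lemma mem_piece_of_ne {t : ℝ} {r : Fin (R + 1)} (h : t ∈ m.piece' r) (hne : ∀ r, t ≠ m.b r) :
    t ∈ m.piece r := ⟨h.1, lt_of_le_of_ne h.2 (hne _)⟩

lemma sum_ite_piece' {V : Type*} [AddCommMonoid V] {t : ℝ} {r : Fin (R + 1)} (h : t ∈ m.piece' r)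
    (v : Fin (R + 1) → V) [∀ r, Decidable (t ∈ m.piece' r)] :
    ∑ r, (if t ∈ m.piece' r then v r else 0) = v r := by
  rw [Finset.sum_eq_single r, if_pos h]
  · intro r' _ hr'
    rw [if_neg fun h' => hr' (m.piece'_unique h' h)]
  · intro h'; exact absurd (Finset.mem_univ r) h'

lemma x_eq {n i : ℕ} {r : Fin (R + 1)} (h : (i : ℝ) / n ∈ m.piece' r) (ω : Ω) :
    m.x n i ω = m.H r ((i : ℝ) / n) (m.cond i ω).1 (m.cond i ω).2 := by
  classical
  exact m.sum_ite_piece' h _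

lemma err_eq {n i : ℕ} {r : Fin (R + 1)} (h : (i : ℝ) / n ∈ m.piece' r) (ω : Ω) :
    m.err n i ω = m.errFun r ((i : ℝ) / n) (m.cond i ω, m.η i ω) := by
  classical
  refine (m.sum_ite_piece' h _).trans ?_
  simp only [errFun, cond, m.push_F]

lemma densityAtZero_eq {n i : ℕ} {r : Fin (R + 1)} (h : (i : ℝ) / n ∈ m.piece' r) (ω : Ω) :
    m.densityAtZero n i ω = m.condDensity r ((i : ℝ) / n) (m.cond i ω).1 (m.cond i ω).2 0 := by
  classical
  exact m.sum_ite_piece' h _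

lemma measurable_H_comp (r : Fin (R + 1)) (t : ℝ) (k : ℤ) :
    Measurable (fun ω => m.H r t (m.cond k ω).1 (m.cond k ω).2) :=
  (m.measurable_H r t).comp (m.measurable_cond k)

lemma measurable_x {n i : ℕ} (hi : i ∈ Finset.Icc 1 n) : Measurable (m.x n i) := by
  obtain ⟨r, hr⟩ := m.exists_index hi
  rw [funext (m.x_eq hr)]
  exact m.measurable_H_comp r _ i

variable {m} [IsProbabilityMeasure P]

/-- The moments of order `4 + κ` are only needed for a uniform bound in `L⁴`, which includes the break
points. -/
lemma exists_moment_bound (h : m.DesignRegular) : ∃ M : ℝ, 0 ≤ M ∧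
    ∀ n : ℕ, ∀ i ∈ Finset.Icc 1 n, eLpNorm (m.x n i) 4 P ≤ ENNReal.ofReal M := by
  obtain ⟨κ, hκ, M, hM⟩ := h.moments
  refine ⟨max M 0, le_max_right _ _, fun n i hi => ?_⟩
  refine (eLpNorm_le_eLpNorm_of_exponent_le ?_
    (m.measurable_x hi).aestronglyMeasurable).trans ((hM n i hi).trans
      (ENNReal.ofReal_le_ofReal (le_max_left _ _)))
  rw [ENNReal.ofReal_add (by norm_num) hκ.le]
  exact le_trans (by simp) (le_add_of_nonneg_right zero_le)

lemma eLpNorm_H_le {M : ℝ} {n i : ℕ} (hx : eLpNorm (m.x n i) 4 P ≤ ENNReal.ofReal M)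
    {r : Fin (R + 1)} (h : (i : ℝ) / n ∈ m.piece' r) :
    eLpNorm (fun h => m.H r ((i : ℝ) / n) h.1 h.2) 4 m.condLaw ≤ ENNReal.ofReal M := by
  rw [← m.map_cond i, eLpNorm_map_measure (m.measurable_H r _).aestronglyMeasurable
    (m.measurable_cond i).aemeasurable]
  rwa [funext (m.x_eq h)] at hx

/-! ### Dependence of the weighted products of predictors -/

variable (m) in
/-- The entry `(a, a')` of `f_r(t, 0 | h) H_r(t, h) H_r(t, h)ᵀ`, with the measurable version of the
density. -/
def weightedEntry (r : Fin (R + 1)) (t : ℝ) (a a' : Fin p) (h : (ℕ → E₁) × (ℕ → E₂)) : ℝ :=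
  m.densityVersion r t h * (m.H r t h.1 h.2 a * m.H r t h.1 h.2 a')

variable (m) in
omit [IsProbabilityMeasure P] in
lemma measurable_H_apply (r : Fin (R + 1)) (t : ℝ) (a : Fin p) :
    Measurable (fun h : (ℕ → E₁) × (ℕ → E₂) => m.H r t h.1 h.2 a) :=
  (EuclideanSpace.proj (𝕜 := ℝ) a).continuous.measurable.comp (m.measurable_H r t)

variable (m) in
lemma measurable_weightedEntry (r : Fin (R + 1)) (t : ℝ) (a a' : Fin p) :
    Measurable (m.weightedEntry r t a a') :=
  (m.measurable_densityVersion r t).mul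
    ((m.measurable_H_apply r t a).mul (m.measurable_H_apply r t a'))

/-- Bound for the swap cost by the dependence measures of its factors. -/
lemma swapCost_weightedEntry_le {r : Fin (R + 1)} {t : ℝ} {A M : ℝ}
    (hA : ∀ᵐ h ∂m.condLaw, |m.densityVersion r t h| ≤ A)
    (hM : eLpNorm (fun h => m.H r t h.1 h.2) 4 m.condLaw ≤ ENNReal.ofReal M)
    (a a' : Fin p) (k : ℕ) :
    swapCost m.innovLaw (fun s => m.weightedEntry r t a a' (toCond s)) k ≤
      eLpNorm (fun ω => m.densityVersion r t (m.cond k ω) - m.densityVersion r t (m.condStar k ω)) 4 P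
        * (ENNReal.ofReal M * ENNReal.ofReal M)
      + 2 * (ENNReal.ofReal A * ENNReal.ofReal M) *
        eLpNorm (fun ω => m.H r t (m.cond k ω).1 (m.cond k ω).2
          - m.H r t (m.condStar k ω).1 (m.condStar k ω).2) 4 P := by
  rw [m.swapCost_toCond (m.measurable_weightedEntry r t a a')]
  have hX := m.measurable_cond k
  have hX' := m.measurable_condStar k
  have hf := m.measurable_densityVersion r t
  have hH := fun a => m.measurable_H_apply r t a
  set f : Ω → ℝ := fun ω => m.densityVersion r t (m.cond k ω) with hfd
  set f' : Ω → ℝ := fun ω => m.densityVersion r t (m.condStar k ω) with hfd'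
  let g : Fin p → Ω → ℝ := fun a ω => m.H r t (m.cond k ω).1 (m.cond k ω).2 a
  let g' : Fin p → Ω → ℝ := fun a ω => m.H r t (m.condStar k ω).1 (m.condStar k ω).2 a
  have hfm : Measurable f := hf.comp hX
  have hfm' : Measurable f' := hf.comp hX'
  have hgm : ∀ a, Measurable (g a) := fun a => (hH a).comp hX
  have hgm' : ∀ a, Measurable (g' a) := fun a => (hH a).comp hX'
  have hg : ∀ a, eLpNorm (g a) 4 P ≤ ENNReal.ofReal M := by
    intro a
    refine le_trans ?_ hM
    rw [← m.map_cond k, eLpNorm_map_measure (m.measurable_H r t).aestronglyMeasurable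
      hX.aemeasurable]
    exact eLpNorm_mono fun ω => PiLp.norm_apply_le _ a
  have hg' : ∀ a, eLpNorm (g' a) 4 P ≤ ENNReal.ofReal M := by
    intro a
    refine le_trans ?_ hM
    rw [← m.map_condStar k, eLpNorm_map_measure (m.measurable_H r t).aestronglyMeasurable
      hX'.aemeasurable]
    exact eLpNorm_mono fun ω => PiLp.norm_apply_le _ a
  have hf' : eLpNorm f' 4 P ≤ ENNReal.ofReal A := by
    have h1 : ∀ᵐ ω ∂P, ‖f' ω‖ ≤ A := by
      have : ∀ᵐ h ∂(P.map (m.condStar k)), |m.densityVersion r t h| ≤ A := by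
        rw [m.map_condStar]; exact hA
      exact ae_of_ae_map hX'.aemeasurable this
    refine (eLpNorm_le_of_ae_bound h1).trans (le_of_eq ?_)
    simp
  have hd : ∀ a, eLpNorm (fun ω => g a ω - g' a ω) 4 P ≤
      eLpNorm (fun ω => m.H r t (m.cond k ω).1 (m.cond k ω).2
          - m.H r t (m.condStar k ω).1 (m.condStar k ω).2) 4 P := fun a =>
    eLpNorm_mono fun ω => PiLp.norm_apply_le
      (m.H r t (m.cond k ω).1 (m.cond k ω).2 - m.H r t (m.condStar k ω).1 (m.condStar k ω).2) a
  set ΔH := eLpNorm (fun ω => m.H r t (m.cond k ω).1 (m.cond k ω).2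
          - m.H r t (m.condStar k ω).1 (m.condStar k ω).2) 4 P with hΔH
  have e : (fun ω => m.weightedEntry r t a a' (m.cond k ω)
        - m.weightedEntry r t a a' (m.condStar k ω))
      = fun ω => ((f ω - f' ω) * (g a ω * g a' ω) + f' ω * ((g a ω - g' a ω) * g a' ω))
        + f' ω * (g' a ω * (g a' ω - g' a' ω)) := by
    funext ω
    simp only [weightedEntry, f, f', g, g']
    ring
  have h1 : ∫⁻ ω, ‖m.weightedEntry r t a a' (m.cond k ω)
      - m.weightedEntry r t a a' (m.condStar k ω)‖ₑ ∂P
      = eLpNorm (fun ω => ((f ω - f' ω) * (g a ω * g a' ω) + f' ω * ((g a ω - g' a ω) * g a' ω))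
        + f' ω * (g' a ω * (g a' ω - g' a' ω))) 1 P := by
    rw [← e, eLpNorm_one_eq_lintegral_enorm]
  have m1 : Measurable (fun ω => (f ω - f' ω) * (g a ω * g a' ω)) := by fun_prop
  have m2 : Measurable (fun ω => f' ω * ((g a ω - g' a ω) * g a' ω)) := by fun_prop
  have m3 : Measurable (fun ω => f' ω * (g' a ω * (g a' ω - g' a' ω))) := by fun_prop
  rw [h1]
  refine (eLpNorm_add_le (m1.add m2).aestronglyMeasurable m3.aestronglyMeasurable le_rfl).trans ?_
  refine (add_le_add_left (eLpNorm_add_le m1.aestronglyMeasurable m2.aestronglyMeasurable le_rfl)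
    _).trans ?_
  have b1 := eLpNorm_mul_three_le (P := P) (hfm.sub hfm').aestronglyMeasurable
    (hgm a).aestronglyMeasurable (hgm a').aestronglyMeasurable
  have b2 := eLpNorm_mul_three_le (P := P) hfm'.aestronglyMeasurable
    ((hgm a).sub (hgm' a)).aestronglyMeasurable (hgm a').aestronglyMeasurable
  have b3 := eLpNorm_mul_three_le (P := P) hfm'.aestronglyMeasurable
    (hgm' a).aestronglyMeasurable ((hgm a').sub (hgm' a')).aestronglyMeasurable
  have c1 := b1.trans (mul_le_mul' le_rfl (mul_le_mul' (hg a) (hg a')))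
  have c2 := b2.trans (mul_le_mul' hf' (mul_le_mul' (hd a) (hg a')))
  have c3 := b3.trans (mul_le_mul' hf' (mul_le_mul' (hg' a) (hd a')))
  refine (add_le_add (add_le_add c1 c2) c3).trans (le_of_eq ?_)
  rw [add_assoc]
  congr 1
  ring

/-- The approximation cost of the weighted products by functions of the last `w` innovations decays
geometrically, uniformly over the pieces. -/
lemma exists_spliceCost_bound [NeZero p] (h : m.DesignRegular) (h' : m.ErrorRegular) (A M : ℝ)
    (hA0 : 0 ≤ A) (hM0 : 0 ≤ M) :
    ∃ C ≥ (0 : ℝ), ∃ χ ∈ Ioo (0 : ℝ) 1, ∃ k₀ : ℕ, ∀ r, ∀ t ∈ m.piece r,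
      (∀ᵐ h ∂m.condLaw, |m.densityVersion r t h| ≤ A) →
      eLpNorm (fun h => m.H r t h.1 h.2) 4 m.condLaw ≤ ENNReal.ofReal M →
      ∀ a a',
      Integrable (m.weightedEntry r t a a') m.condLaw → ∀ w ≥ k₀,
      spliceCost m.innovLaw (fun s => m.weightedEntry r t a a' (toCond s)) w
        ≤ ENNReal.ofReal (C * χ ^ w) := by
  obtain ⟨χ₁, hχ₁, C₁, hd₁⟩ := h.dependence
  obtain ⟨c, hc, hdep⟩ := h'.dependence
  obtain ⟨χ₂, hχ₂, C₂, hd₂⟩ := hdep 1 (NeZero.one_le)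
  obtain ⟨k₁, hk₁⟩ := eventually_atTop.1 hd₁
  obtain ⟨k₂, hk₂⟩ := eventually_atTop.1 hd₂
  set χ := max χ₁ χ₂ with hχ
  have hχ0 : 0 < χ := lt_max_of_lt_left hχ₁.1
  have hχ1 : χ < 1 := max_lt hχ₁.2 hχ₂.2
  set C₀ := |C₂| * (M * M) + 2 * (A * M) * |C₁| with hC₀
  have hC₀0 : 0 ≤ C₀ := by positivity
  refine ⟨C₀ / (1 - χ), div_nonneg hC₀0 (by linarith), χ, ⟨hχ0, hχ1⟩, max k₁ k₂, ?_⟩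
  intro r t ht hA hM a a' hint w hw
  have hswap : ∀ k ≥ max k₁ k₂, swapCost m.innovLaw
      (fun s => m.weightedEntry r t a a' (toCond s)) k ≤ ENNReal.ofReal (C₀ * χ ^ k) := by
    intro k hk
    have b1 : eLpNorm (fun ω => m.H r t (m.cond k ω).1 (m.cond k ω).2
          - m.H r t (m.condStar k ω).1 (m.condStar k ω).2) 4 P
        ≤ ENNReal.ofReal (|C₁| * χ ^ k) := by
      refine le_trans ?_ ((hk₁ k (le_of_max_le_left hk)).trans (ENNReal.ofReal_le_ofReal ?_))
      · exact le_iSup_of_le r (le_iSup₂_of_le (f := fun t (_ : t ∈ m.piece r) =>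
          eLpNorm (fun ω => m.H r t (m.F (k - 1) ω) (m.G k ω)
            - m.H r t (m.Fstar (k - 1) ω) (m.Gstar k ω)) 4 P) t ht le_rfl)
      · exact mul_le_mul (le_abs_self _) (pow_le_pow_left₀ hχ₁.1.le (le_max_left _ _) k)
          (pow_nonneg hχ₁.1.le k) (abs_nonneg _)
    have b2 : eLpNorm (fun ω => m.densityVersion r t (m.cond k ω)
          - m.densityVersion r t (m.condStar k ω)) 4 P ≤ ENNReal.ofReal (|C₂| * χ ^ k) := by
      refine le_trans ?_ ((hk₂ k (le_of_max_le_right hk)).trans (ENNReal.ofReal_le_ofReal ?_))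
      · refine le_trans (le_of_eq ?_) (le_iSup_of_le r (le_iSup₂_of_le t ht
          (le_iSup₂_of_le (0 : EuclideanSpace ℝ (Fin p)) (Metric.mem_ball_self hc) le_rfl)))
        refine eLpNorm_congr_ae ?_
        filter_upwards [ae_condDensity_eq h' (Ioo_subset_Ioc_self ht) (m.measurable_cond k)
          (m.map_cond k), ae_condDensity_eq h' (Ioo_subset_Ioc_self ht) (m.measurable_condStar k)
          (m.map_condStar k)] with ω h1 h2
        rw [← h1, ← h2]
        simp only [condDensity, condCDFDeriv, iteratedDeriv_one, inner_zero_right]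
        rfl
      · exact mul_le_mul (le_abs_self _) (pow_le_pow_left₀ hχ₂.1.le (le_max_right _ _) k)
          (pow_nonneg hχ₂.1.le k) (abs_nonneg _)
    refine (swapCost_weightedEntry_le hA hM a a' k).trans ?_
    refine (add_le_add (mul_le_mul' b2 le_rfl) (mul_le_mul' le_rfl b1)).trans (le_of_eq ?_)
    have e2 : (2 : ℝ≥0∞) = ENNReal.ofReal 2 := by simp
    rw [e2, ← ENNReal.ofReal_mul hM0, ← ENNReal.ofReal_mul (by positivity),
      ← ENNReal.ofReal_mul hA0, ← ENNReal.ofReal_mul (by positivity),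
      ← ENNReal.ofReal_mul (by positivity), ← ENNReal.ofReal_add (by positivity) (by positivity)]
    congr 1
    rw [hC₀]; ring
  have hmeas : Measurable (fun s => m.weightedEntry r t a a' (toCond s)) :=
    (m.measurable_weightedEntry r t a a').comp measurable_toCond
  have hint' : Integrable (fun s => m.weightedEntry r t a a' (toCond s)) (iidLaw m.innovLaw) := by
    rw [← m.map_toCond] at hint
    exact hint.comp_measurable measurable_toCond
  refine (spliceCost_le_tsum hmeas hint' w).trans ?_
  refine (ENNReal.tsum_le_tsum fun k => hswap (w + k) (by omega)).trans ?_
  have hs : Summable (fun k : ℕ => C₀ * χ ^ (w + k)) := by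
    simp_rw [pow_add, ← mul_assoc]
    exact (summable_geometric_of_lt_one hχ0.le hχ1).mul_left _
  rw [← ENNReal.ofReal_tsum_of_nonneg (fun k => by positivity) hs]
  refine le_of_eq (congrArg ENNReal.ofReal ?_)
  simp_rw [pow_add, ← mul_assoc]
  rw [tsum_mul_left, tsum_geometric_of_lt_one hχ0.le hχ1]
  ring

end PLSModel

namespace PLSModel

variable {Ω : Type*} [MeasurableSpace Ω] {P : Measure Ω}
  {E₁ E₂ : Type*} [MeasurableSpace E₁] [MeasurableSpace E₂] {p R : ℕ}
  (m : PLSModel P E₁ E₂ p R)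

/-! ### Single summands -/

open Classical in
/-- The index `r` with `b_r < i/n ≤ b_{r+1}`, for `1 ≤ i ≤ n`; zero for other `i`, where no such
index need exist. -/
def idx (n i : ℕ) : Fin (R + 1) :=
  if h : ∃ r, (i : ℝ) / n ∈ m.piece' r then h.choose else 0

/-- The predictor `x_i` as a function of the conditioning history. -/
def predictor (n i : ℕ) (h : (ℕ → E₁) × (ℕ → E₂)) : EuclideanSpace ℝ (Fin p) :=
  m.H (m.idx n i) ((i : ℝ) / n) h.1 h.2

/-- The error `ε_i` as a function of the conditioning history and the newest innovation. -/
def error (n i : ℕ) (z : ((ℕ → E₁) × (ℕ → E₂)) × E₁) : ℝ :=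
  m.errFun (m.idx n i) ((i : ℝ) / n) z

/-- The conditional law of `ε_i`. -/
def errorLaw (n i : ℕ) (h : (ℕ → E₁) × (ℕ → E₂)) : Measure ℝ :=
  m.errLaw (m.idx n i) ((i : ℝ) / n) h

/-- The conditional density of `ε_i` at zero, in its measurable version. -/
def slope (n i : ℕ) (h : (ℕ → E₁) × (ℕ → E₂)) : ℝ :=
  m.densityVersion (m.idx n i) ((i : ℝ) / n) h

/-- The entry `(a, a')` of `f_r(i/n, 0 | h) x_i x_iᵀ`, as a function of the history `h`. -/
def entry (n i : ℕ) (a a' : Fin p) : (ℕ → E₁) × (ℕ → E₂) → ℝ :=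
  m.weightedEntry (m.idx n i) ((i : ℝ) / n) a a'

/-- The conditional mean of the excess `excess (x_iᵀ δ) ε_i` given the history. -/
def meanExcess (n i : ℕ) (δ : EuclideanSpace ℝ (Fin p)) (h : (ℕ → E₁) × (ℕ → E₂)) : ℝ :=
  ∫ ε, excess (inner ℝ (m.predictor n i h) δ) ε ∂(m.errorLaw n i h)

/-- The excess minus its conditional mean given the history, as a function of the history and the
newest innovation. -/
def centredExcess (n : ℕ) (δ : EuclideanSpace ℝ (Fin p)) (i : ℕ)
    (z : ((ℕ → E₁) × (ℕ → E₂)) × E₁) : ℝ :=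
  excess (inner ℝ (m.predictor n i z.1) δ) (m.error n i z) - m.meanExcess n i δ z.1

/-- The time points `i` for which `i/n` is not a break point. -/
def regularTimes (n : ℕ) : Finset ℕ :=
  open Classical in (Finset.Icc 1 n).filter fun i => ∀ r, (i : ℝ) / n ≠ m.b r

/-- The time points `i` for which `i/n` is a break point. -/
def breakTimes (n : ℕ) : Finset ℕ :=
  open Classical in (Finset.Icc 1 n).filter fun i => ¬ ∀ r, (i : ℝ) / n ≠ m.b r

lemma idx_spec {n i : ℕ} (hi : i ∈ Finset.Icc 1 n) : (i : ℝ) / n ∈ m.piece' (m.idx n i) := by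
  have h := m.exists_index hi
  rw [idx, dif_pos h]
  exact h.choose_spec

lemma x_eq_predictor {n i : ℕ} (hi : i ∈ Finset.Icc 1 n) (ω : Ω) :
    m.x n i ω = m.predictor n i (m.cond i ω) := m.x_eq (m.idx_spec hi) ω

lemma err_eq_error {n i : ℕ} (hi : i ∈ Finset.Icc 1 n) (ω : Ω) :
    m.err n i ω = m.error n i (m.cond i ω, m.η i ω) := m.err_eq (m.idx_spec hi) ω

lemma mem_Icc_of_regular {n i : ℕ} (hi : i ∈ m.regularTimes n) : i ∈ Finset.Icc 1 n :=
  (Finset.mem_filter.1 hi).1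

lemma mem_Icc_of_break {n i : ℕ} (hi : i ∈ m.breakTimes n) : i ∈ Finset.Icc 1 n :=
  (Finset.mem_filter.1 hi).1

lemma idx_mem_piece {n i : ℕ} (hi : i ∈ m.regularTimes n) : (i : ℝ) / n ∈ m.piece (m.idx n i) :=
  m.mem_piece_of_ne (m.idx_spec (m.mem_Icc_of_regular hi)) (Finset.mem_filter.1 hi).2

lemma card_regularTimes_le (n : ℕ) : (m.regularTimes n).card ≤ n := by
  refine (Finset.card_le_card (Finset.filter_subset _ _)).trans ?_
  simp

lemma card_breakTimes_le (n : ℕ) : (m.breakTimes n).card ≤ R + 2 := by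
  classical
  have hex : ∀ i ∈ m.breakTimes n, ∃ r, (i : ℝ) / n = m.b r := fun i hi => by
    simpa using (Finset.mem_filter.1 hi).2
  choose! f hf using hex
  have := Finset.card_le_card_of_injOn (s := m.breakTimes n) (t := Finset.univ) f
    (fun _ _ => Finset.mem_coe.2 (Finset.mem_univ _)) (fun i hi j hj hij => by
      have hn : (n : ℝ) ≠ 0 := by
        have := Finset.mem_Icc.1 (m.mem_Icc_of_break hi)
        have : n ≠ 0 := by omega
        exact_mod_cast this
      have h1 : (i : ℝ) / n = j / n := by rw [hf i hi, hf j hj, hij]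
      have h2 : (i : ℝ) = j := by field_simp at h1; exact h1
      exact_mod_cast h2)
  simpa using this

lemma sum_Icc_eq {V : Type*} [AddCommMonoid V] (n : ℕ) (v : ℕ → V) :
    ∑ i ∈ Finset.Icc 1 n, v i = ∑ i ∈ m.regularTimes n, v i + ∑ i ∈ m.breakTimes n, v i := by
  classical
  exact (Finset.sum_filter_add_sum_filter_not _ _ _).symm

lemma measurable_predictor (n i : ℕ) : Measurable (m.predictor n i) := m.measurable_H _ _

lemma measurable_error (n i : ℕ) : Measurable (m.error n i) := m.measurable_errFun _ _

/-- The uniform bounds that the argument uses: almost every conditional law of the errors is regular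
with constant `A`, at all times in the open pieces, and the predictors are bounded by `M` in `L⁴`. -/
structure UniformBounds (A M : ℝ) : Prop where
  nonneg_A : 0 ≤ A
  nonneg_M : 0 ≤ M
  law : ∀ r, ∀ t ∈ m.piece r, ∀ᵐ h ∂m.condLaw,
    RegularLaw (m.errLaw r t h) (m.densityVersion r t h) A
  moment : ∀ n : ℕ, ∀ i ∈ Finset.Icc 1 n, eLpNorm (m.x n i) 4 P ≤ ENNReal.ofReal M

variable [IsProbabilityMeasure P]

instance (n i : ℕ) (h : (ℕ → E₁) × (ℕ → E₂)) : IsProbabilityMeasure (m.errorLaw n i h) :=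
  inferInstanceAs (IsProbabilityMeasure (m.errLaw _ _ h))

omit [IsProbabilityMeasure P] in
lemma meanExcess_eq (n i : ℕ) (δ : EuclideanSpace ℝ (Fin p)) (h : (ℕ → E₁) × (ℕ → E₂)) :
    m.meanExcess n i δ h
      = ∫ e, excess (inner ℝ (m.predictor n i h) δ) (m.error n i (h, e)) ∂(P.map (m.η 0)) :=
  m.integral_errLaw (measurable_excess.comp measurable_prodMk_left) _ _ h

omit [IsProbabilityMeasure P] in
lemma measurable_excess_error (n i : ℕ) (δ : EuclideanSpace ℝ (Fin p)) :
    Measurable fun z : ((ℕ → E₁) × (ℕ → E₂)) × E₁ =>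
      excess (inner ℝ (m.predictor n i z.1) δ) (m.error n i z) := by
  refine measurable_excess.comp (Measurable.prodMk ?_ (m.measurable_error n i))
  exact ((m.measurable_predictor n i).comp measurable_fst).inner_const

lemma measurable_meanExcess (n i : ℕ) (δ : EuclideanSpace ℝ (Fin p)) :
    Measurable (m.meanExcess n i δ) := by
  rw [funext (m.meanExcess_eq n i δ)]
  exact (m.measurable_excess_error n i δ).stronglyMeasurable.integral_prod_right.measurable

lemma measurable_centredExcess (n : ℕ) (δ : EuclideanSpace ℝ (Fin p)) (i : ℕ) :
    Measurable (m.centredExcess n δ i) :=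
  (m.measurable_excess_error n i δ).sub ((m.measurable_meanExcess n i δ).comp measurable_fst)

omit [IsProbabilityMeasure P] in
lemma meanExcess_nonneg (n i : ℕ) (δ : EuclideanSpace ℝ (Fin p)) (h : (ℕ → E₁) × (ℕ → E₂)) :
    0 ≤ m.meanExcess n i δ h := integral_excess_nonneg _

lemma meanExcess_le (n i : ℕ) (δ : EuclideanSpace ℝ (Fin p)) (h : (ℕ → E₁) × (ℕ → E₂)) :
    m.meanExcess n i δ h ≤ |inner ℝ (m.predictor n i h) δ| := by
  refine (integral_mono (integrable_excess _) (integrable_const _)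
    (fun ε => excess_le (inner ℝ (m.predictor n i h) δ) ε)).trans (le_of_eq ?_)
  simp

lemma integral_centredExcess (n : ℕ) (δ : EuclideanSpace ℝ (Fin p)) (i : ℕ)
    (h : (ℕ → E₁) × (ℕ → E₂)) :
    ∫ e, m.centredExcess n δ i (h, e) ∂(P.map (m.η 0)) = 0 := by
  simp only [centredExcess]
  rw [integral_sub, ← m.meanExcess_eq]
  · simp
  · exact Integrable.of_bound (C := |inner ℝ (m.predictor n i h) δ|)
      ((m.measurable_excess_error n i δ).comp measurable_prodMk_left).aestronglyMeasurable
      (ae_of_all _ fun e => abs_excess_le _ _)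
  · exact integrable_const _

variable {m} {A M : ℝ}

namespace UniformBounds

omit [IsProbabilityMeasure P] in
lemma ae_regularLaw (hU : m.UniformBounds A M) {n i : ℕ} (hi : i ∈ m.regularTimes n) :
    ∀ᵐ h ∂m.condLaw, RegularLaw (m.errorLaw n i h) (m.slope n i h) A :=
  hU.law _ _ (m.idx_mem_piece hi)

lemma eLpNorm_predictor (hU : m.UniformBounds A M) {n i : ℕ} (hi : i ∈ Finset.Icc 1 n) :
    eLpNorm (m.predictor n i) 4 m.condLaw ≤ ENNReal.ofReal M :=
  eLpNorm_H_le (hU.moment n i hi) (m.idx_spec hi)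

lemma l1Bound_pow (hU : m.UniformBounds A M) {n i : ℕ} (hi : i ∈ Finset.Icc 1 n) {q : ℕ}
    (hq : q ≤ 4) : L1Bound m.condLaw (fun h => ‖m.predictor n i h‖ ^ q) (1 + M ^ 4) := by
  have h4 := l1Bound_norm_pow_four hU.nonneg_M (m.measurable_predictor n i).aestronglyMeasurable
    (hU.eLpNorm_predictor hi)
  have h1 : L1Bound m.condLaw (fun _ => (1 : ℝ)) 1 := ⟨integrable_const _, by simp⟩
  refine (h1.add h4).of_abs_le ((m.measurable_predictor n i).norm.pow_const q).aestronglyMeasurable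
    (ae_of_all _ fun h => ?_)
  rw [abs_of_nonneg (by positivity)]
  set s := ‖m.predictor n i h‖
  have hs : 0 ≤ s := norm_nonneg _
  rcases le_total s 1 with h | h
  · exact (pow_le_one₀ hs h).trans (by linarith [pow_nonneg hs 4])
  · exact (pow_le_pow_right₀ h hq).trans (by linarith)

end UniformBounds

lemma L1Bound_comp_cond {φ : (ℕ → E₁) × (ℕ → E₂) → ℝ} {c : ℝ} (h : L1Bound m.condLaw φ c)
    (i : ℤ) : L1Bound P (fun ω => φ (m.cond i ω)) c := by
  obtain ⟨h1, h2⟩ := h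
  rw [← m.map_cond i] at h1 h2
  refine ⟨h1.comp_measurable (m.measurable_cond i), ?_⟩
  have h3 : AEStronglyMeasurable (fun h => |φ h|) (P.map (m.cond i)) := h1.1.norm
  rwa [integral_map (m.measurable_cond i).aemeasurable h3] at h2

namespace UniformBounds

/-- The centred excesses have second moments of cubic order. -/
lemma sq_centredExcess (hU : m.UniformBounds A M) {n i : ℕ} (hi : i ∈ m.regularTimes n)
    {δ : EuclideanSpace ℝ (Fin p)} {a : ℝ} (hδ : ‖δ‖ ≤ a) :
    Integrable (fun z => m.centredExcess n δ i z ^ 2) (m.condLaw.prod (P.map (m.η 0))) ∧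
    ∫ z, m.centredExcess n δ i z ^ 2 ∂(m.condLaw.prod (P.map (m.η 0)))
      ≤ 4 * A * a ^ 3 * (1 + M ^ 4) := by
  have hi' := m.mem_Icc_of_regular hi
  have ha : 0 ≤ a := (norm_nonneg _).trans hδ
  have hv : ∀ h, |inner ℝ (m.predictor n i h) δ| ≤ ‖m.predictor n i h‖ * a := fun h =>
    (abs_real_inner_le_norm _ _).trans (mul_le_mul_of_nonneg_left hδ (norm_nonneg _))
  have hint : Integrable (fun z => m.centredExcess n δ i z ^ 2)
      (m.condLaw.prod (P.map (m.η 0))) := by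
    have h2 := (hU.l1Bound_pow hi' (q := 2) (by norm_num)).1
    have h3 : Integrable (fun z : ((ℕ → E₁) × (ℕ → E₂)) × E₁ => a ^ 2 * ‖m.predictor n i z.1‖ ^ 2)
        (m.condLaw.prod (P.map (m.η 0))) := (h2.comp_fst (P.map (m.η 0))).const_mul (a ^ 2)
    refine h3.mono' ((m.measurable_centredExcess n δ i).pow_const 2).aestronglyMeasurable
      (ae_of_all _ fun z => ?_)
    rw [Real.norm_eq_abs, abs_of_nonneg (sq_nonneg _), ← mul_pow, mul_comm a]
    refine sq_le_sq' ?_ ?_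
    · have h4 := m.meanExcess_le n i δ z.1
      have h5 := excess_nonneg (inner ℝ (m.predictor n i z.1) δ) (m.error n i z)
      simp only [centredExcess]
      linarith [hv z.1]
    · have h4 := m.meanExcess_nonneg n i δ z.1
      have h5 := excess_le (inner ℝ (m.predictor n i z.1) δ) (m.error n i z)
      simp only [centredExcess]
      linarith [hv z.1]
  refine ⟨hint, ?_⟩
  rw [integral_prod _ hint]
  have h3 := hU.l1Bound_pow hi' (q := 3) (by norm_num)
  have h3' := h3.const_mul (k := 4 * A * a ^ 3) (by have := hU.nonneg_A; positivity)
  refine (integral_mono_ae hint.integral_prod_left h3'.1 ?_).trans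
    ((integral_mono h3'.1 h3'.1.abs fun h => le_abs_self _).trans h3'.2)
  filter_upwards [hU.ae_regularLaw hi] with h hh
  set v := inner ℝ (m.predictor n i h) δ with hvd
  have hle1 : m.meanExcess n i δ h ≤ A * v ^ 2 := hh.integral_excess_le v
  have hme : m.meanExcess n i δ h ^ 2 ≤ A * |v| ^ 3 := by
    have h1 := mul_le_mul (m.meanExcess_le n i δ h) hle1 (m.meanExcess_nonneg n i δ h)
      (abs_nonneg _)
    rw [← sq_abs v] at h1
    calc m.meanExcess n i δ h ^ 2 = m.meanExcess n i δ h * m.meanExcess n i δ h := sq _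
      _ ≤ _ := h1
      _ = A * |v| ^ 3 := by ring
  have hex : Measurable (fun e => excess v (m.error n i (h, e))) :=
    (m.measurable_excess_error n i δ).comp measurable_prodMk_left
  have hexI : Integrable (fun e => excess v (m.error n i (h, e))) (P.map (m.η 0)) :=
    Integrable.of_bound hex.aestronglyMeasurable |v| (ae_of_all _ fun e => abs_excess_le _ _)
  have hb : ∫ e, m.centredExcess n δ i (h, e) ^ 2 ∂(P.map (m.η 0))
      ≤ ∫ e, (2 * |v| * excess v (m.error n i (h, e)) + 2 * (A * |v| ^ 3)) ∂(P.map (m.η 0)) := by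
    refine integral_mono_of_nonneg (ae_of_all _ fun e => sq_nonneg _)
      ((hexI.const_mul _).add (integrable_const _)) (ae_of_all _ fun e => ?_)
    simp only [centredExcess]
    have := sq_excess_le v (m.error n i (h, e))
    nlinarith [sq_nonneg (excess v (m.error n i (h, e)) + m.meanExcess n i δ h)]
  refine hb.trans ?_
  rw [integral_add (hexI.const_mul _) (integrable_const _), integral_const_mul,
    ← m.meanExcess_eq]
  simp only [integral_const, probReal_univ, one_smul]
  have h6 : 2 * |v| * m.meanExcess n i δ h ≤ 2 * (A * |v| ^ 3) := by
    have := mul_le_mul_of_nonneg_left hle1 (abs_nonneg v)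
    rw [← sq_abs v] at this
    nlinarith
  have h7 : |v| ^ 3 ≤ (‖m.predictor n i h‖ * a) ^ 3 := pow_le_pow_left₀ (abs_nonneg _) (hv h) 3
  have h8 : A * |v| ^ 3 ≤ A * (‖m.predictor n i h‖ * a) ^ 3 :=
    mul_le_mul_of_nonneg_left h7 hU.nonneg_A
  rw [mul_pow] at h8
  linarith

/-- `L¹` bound of the centred sum at a fixed `δ`. -/
lemma l1Bound_sum_centredExcess (hU : m.UniformBounds A M) (n : ℕ)
    {δ : EuclideanSpace ℝ (Fin p)} {a : ℝ} (hδ : ‖δ‖ ≤ a) :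
    L1Bound P (fun ω => ∑ i ∈ m.regularTimes n, m.centredExcess n δ i (m.cond i ω, m.η i ω))
      (√(n * (4 * A * a ^ 3 * (1 + M ^ 4)))) := by
  have ha : 0 ≤ a := (norm_nonneg _).trans hδ
  have hB : 0 ≤ 4 * A * a ^ 3 * (1 + M ^ 4) := by
    have := hU.nonneg_A; have := hU.nonneg_M; positivity
  have h := m.l1Bound_sum_martingaleDiff (J := m.regularTimes n) (m.measurable_centredExcess n δ)
    hB (fun i hi => (hU.sq_centredExcess hi hδ).1)
    (fun i hi => (hU.sq_centredExcess hi hδ).2)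
    (fun i _ => ae_of_all _ (m.integral_centredExcess n δ i))
  refine h.mono_const (Real.sqrt_le_sqrt (mul_le_mul_of_nonneg_right ?_ hB))
  exact_mod_cast m.card_regularTimes_le n

/-- The errors are rarely small compared with the predictors. -/
lemma l1Bound_smallError (hU : m.UniformBounds A M) {n i : ℕ} (hi : i ∈ m.regularTimes n)
    {a : ℝ} (ha : 0 ≤ a) :
    L1Bound P (fun ω => ‖m.x n i ω‖ *
      (Icc (-(‖m.x n i ω‖ * a)) (‖m.x n i ω‖ * a)).indicator (fun _ => (1 : ℝ)) (m.err n i ω))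
      (8 * A * a * (1 + M ^ 4)) := by
  have hi' := m.mem_Icc_of_regular hi
  let φ : ((ℕ → E₁) × (ℕ → E₂)) × E₁ → ℝ := fun z => ‖m.predictor n i z.1‖ *
    (Icc (-(‖m.predictor n i z.1‖ * a)) (‖m.predictor n i z.1‖ * a)).indicator
      (fun _ => (1 : ℝ)) (m.error n i z)
  have hpm : Measurable (fun z : ((ℕ → E₁) × (ℕ → E₂)) × E₁ => ‖m.predictor n i z.1‖) :=
    ((m.measurable_predictor n i).comp measurable_fst).norm
  have hφ : Measurable φ := by
    refine hpm.mul ?_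
    have hS : MeasurableSet {z : ((ℕ → E₁) × (ℕ → E₂)) × E₁ |
        m.error n i z ∈ Icc (-(‖m.predictor n i z.1‖ * a)) (‖m.predictor n i z.1‖ * a)} :=
      (measurableSet_le (hpm.mul_const a).neg (m.measurable_error n i)).inter
        (measurableSet_le (m.measurable_error n i) (hpm.mul_const a))
    exact (measurable_const (a := (1 : ℝ))).indicator hS
  have hφ0 : ∀ z, 0 ≤ φ z := fun z =>
    mul_nonneg (norm_nonneg _) (indicator_nonneg (fun _ _ => zero_le_one) _)
  have hφI : Integrable φ (m.condLaw.prod (P.map (m.η 0))) := by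
    have h1 := (hU.l1Bound_pow hi' (q := 1) (by norm_num)).1
    simp only [pow_one] at h1
    refine (h1.comp_fst (P.map (m.η 0))).mono' hφ.aestronglyMeasurable (ae_of_all _ fun z => ?_)
    rw [Real.norm_eq_abs, abs_of_nonneg (hφ0 z)]
    refine mul_le_of_le_one_right (norm_nonneg _) ?_
    exact indicator_le_self' (f := fun _ => (1 : ℝ)) (fun _ _ => zero_le_one) _
  have hb : ∫ z, φ z ∂(m.condLaw.prod (P.map (m.η 0))) ≤ 8 * A * a * (1 + M ^ 4) := by
    rw [integral_prod _ hφI]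
    have h2 := (hU.l1Bound_pow hi' (q := 2) (by norm_num)).const_mul (k := 8 * A * a)
      (by have := hU.nonneg_A; positivity)
    refine (integral_mono_ae hφI.integral_prod_left h2.1 ?_).trans
      ((integral_mono h2.1 h2.1.abs fun h => le_abs_self _).trans h2.2)
    filter_upwards [hU.ae_regularLaw hi] with h hh
    set s := ‖m.predictor n i h‖ with hs
    have e : ∫ e, φ (h, e) ∂(P.map (m.η 0))
        = s * (m.errorLaw n i h).real (Icc (-(s * a)) (s * a)) := by
      simp only [φ, ← hs]
      rw [integral_const_mul, ← integral_indicator_one measurableSet_Icc]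
      congr 1
      exact (m.integral_errLaw ((measurable_const (a := (1 : ℝ))).indicator measurableSet_Icc)
        _ _ h).symm
    rw [e]
    have := mul_le_mul_of_nonneg_left (hh.real_Icc_le (a := s * a) (by positivity))
      (norm_nonneg (m.predictor n i h))
    rw [← hs] at this
    nlinarith
  have hX : Measurable (fun ω => (m.cond i ω, m.η i ω)) :=
    (m.measurable_cond i).prodMk (m.measurable_η i)
  have e : (fun ω => ‖m.x n i ω‖ *
      (Icc (-(‖m.x n i ω‖ * a)) (‖m.x n i ω‖ * a)).indicator (fun _ => (1 : ℝ)) (m.err n i ω))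
      = fun ω => φ (m.cond i ω, m.η i ω) := by
    funext ω
    simp only [φ, m.x_eq_predictor hi', m.err_eq_error hi']
  rw [e]
  rw [← m.map_cond_η i] at hφI hb
  refine ⟨hφI.comp_measurable hX, ?_⟩
  rw [integral_map hX.aemeasurable hφ.aestronglyMeasurable] at hb
  simpa only [abs_of_nonneg (hφ0 _)] using hb

end UniformBounds

end PLSModel

/-! ### A grid of the ball -/

section Grid

variable {p : ℕ}

/-- The integer multi-indices with entries in `[-L, L]`. -/
def gridIndices (p L : ℕ) : Finset (Fin p → ℤ) :=
  Fintype.piFinset fun _ => Finset.Icc (-(L : ℤ)) L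

/-- The grid point `(ρ / L) k`. -/
def gridPoint (ρ : ℝ) (L : ℕ) (k : Fin p → ℤ) : EuclideanSpace ℝ (Fin p) :=
  WithLp.toLp 2 fun a => ρ / L * k a

lemma card_gridIndices (p L : ℕ) : (gridIndices p L).card = (2 * L + 1) ^ p := by
  rw [gridIndices, Fintype.card_piFinset]
  simp only [Int.card_Icc, Finset.prod_const, Finset.card_univ, Fintype.card_fin]
  congr 1
  omega

lemma euclidean_norm_le {v : EuclideanSpace ℝ (Fin p)} {c : ℝ} (hc : 0 ≤ c)
    (h : ∀ a, |v a| ≤ c) : ‖v‖ ≤ p * c := by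
  rw [EuclideanSpace.norm_eq]
  refine Real.sqrt_le_iff.2 ⟨by positivity, ?_⟩
  have h1 : ∑ a, ‖v a‖ ^ 2 ≤ p * c ^ 2 := by
    refine (Finset.sum_le_card_nsmul _ _ (c ^ 2) fun a _ => ?_).trans (le_of_eq (by simp))
    exact pow_le_pow_left₀ (norm_nonneg _) (h a) 2
  have h2 : (p : ℝ) * c ^ 2 ≤ (p : ℝ) ^ 2 * c ^ 2 := by
    refine mul_le_mul_of_nonneg_right ?_ (sq_nonneg c)
    exact_mod_cast Nat.le_self_pow two_ne_zero p
  rw [mul_pow]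
  exact h1.trans h2

lemma norm_gridPoint_le {ρ : ℝ} (hρ : 0 ≤ ρ) {L : ℕ} {k : Fin p → ℤ} (hk : k ∈ gridIndices p L) :
    ‖gridPoint ρ L k‖ ≤ p * ρ := by
  refine euclidean_norm_le hρ fun a => ?_
  have h := Finset.mem_Icc.1 (Fintype.mem_piFinset.1 hk a)
  have h1 : |(k a : ℝ)| ≤ L := abs_le.2 ⟨by exact_mod_cast h.1, by exact_mod_cast h.2⟩
  simp only [gridPoint]
  rw [abs_mul, abs_div, abs_of_nonneg hρ, Nat.abs_cast, div_mul_eq_mul_div]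
  exact div_le_of_le_mul₀ (Nat.cast_nonneg _) hρ (mul_le_mul_of_nonneg_left h1 hρ)

lemma exists_gridPoint_near {ρ : ℝ} (hρ : 0 < ρ) {L : ℕ} (hL : 0 < L)
    {δ : EuclideanSpace ℝ (Fin p)} (hδ : ‖δ‖ ≤ ρ) :
    ∃ k ∈ gridIndices p L, ‖δ - gridPoint ρ L k‖ ≤ p * (ρ / L) := by
  have hL' : (0 : ℝ) < L := by exact_mod_cast hL
  have hc : 0 < ρ / L := div_pos hρ hL'
  refine ⟨fun a => ⌊δ a / (ρ / L)⌋, Fintype.mem_piFinset.2 fun a => ?_,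
    euclidean_norm_le hc.le fun a => ?_⟩
  · have h1 : |δ a| ≤ ρ := (PiLp.norm_apply_le δ a).trans hδ
    have h2 : |δ a / (ρ / L)| ≤ L := by
      rw [abs_div, abs_of_pos hc, div_le_iff₀ hc, mul_div_cancel₀ _ hL'.ne']
      exact h1
    obtain ⟨h3, h4⟩ := abs_le.1 h2
    rw [Finset.mem_Icc]
    refine ⟨Int.le_floor.2 (by push_cast; exact h3), ?_⟩
    have h5 : ((⌊δ a / (ρ / L)⌋ : ℤ) : ℝ) ≤ ((L : ℤ) : ℝ) := by
      push_cast; exact (Int.floor_le _).trans h4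
    exact_mod_cast h5
  · have h1 : δ a - ρ / L * ⌊δ a / (ρ / L)⌋ = ρ / L * Int.fract (δ a / (ρ / L)) := by
      rw [Int.fract, mul_sub, mul_div_cancel₀ _ hc.ne']
    have h2 : (δ - gridPoint ρ L fun a => ⌊δ a / (ρ / L)⌋) a
        = δ a - ρ / L * ⌊δ a / (ρ / L)⌋ := rfl
    rw [h2, h1, abs_mul, abs_of_pos hc, abs_of_nonneg (Int.fract_nonneg _)]
    exact mul_le_of_le_one_right hc.le (Int.fract_lt_one _).le

end Grid

namespace PLSModel

variable {Ω : Type*} [MeasurableSpace Ω] {P : Measure Ω}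
  {E₁ E₂ : Type*} [MeasurableSpace E₁] [MeasurableSpace E₂] {p R : ℕ}
  {m : PLSModel P E₁ E₂ p R} {A M : ℝ}

/-! ### The matrix `K_n` -/

section Weighted

variable [IsProbabilityMeasure P]

lemma densityAtZero_mul_ae_eq [NeZero p] (h : m.ErrorRegular) {n i : ℕ} (hi : i ∈ Finset.Icc 1 n)
    (a a' : Fin p) :
    (fun ω => m.densityAtZero n i ω * (m.x n i ω a * m.x n i ω a'))
      =ᵐ[P] fun ω => m.entry n i a a' (m.cond i ω) := by
  filter_upwards [ae_condDensity_eq h (m.idx_spec hi) (m.measurable_cond i) (m.map_cond i)]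
    with ω hω
  rw [m.densityAtZero_eq (m.idx_spec hi), hω, m.x_eq_predictor hi]
  rfl

lemma measurable_entry (n i : ℕ) (a a' : Fin p) : Measurable (m.entry n i a a') :=
  m.measurable_weightedEntry _ _ a a'

/-- The entries of `K_n` depend on the law of the histories only, also at the break points. -/
lemma integral_densityAtZero_mul [NeZero p] (h : m.ErrorRegular) {n i : ℕ}
    (hi : i ∈ Finset.Icc 1 n) (a a' : Fin p) :
    ∫ ω, m.densityAtZero n i ω * (m.x n i ω a * m.x n i ω a') ∂P
      = ∫ h, m.entry n i a a' h ∂m.condLaw := by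
  rw [integral_congr_ae (densityAtZero_mul_ae_eq h hi a a'), ← m.map_cond i,
    integral_map (m.measurable_cond i).aemeasurable
      (measurable_entry n i a a').aestronglyMeasurable]

namespace UniformBounds

omit [IsProbabilityMeasure P] in
lemma ae_abs_entry_le (hU : m.UniformBounds A M) {n i : ℕ} (hi : i ∈ m.regularTimes n)
    (a a' : Fin p) :
    ∀ᵐ h ∂m.condLaw, |m.entry n i a a' h| ≤ 2 * A * ‖m.predictor n i h‖ ^ 2 := by
  filter_upwards [hU.ae_regularLaw hi] with h hh
  have h1 : |m.slope n i h| ≤ 2 * A := hh.abs_slope_le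
  have h2 : |m.predictor n i h a| ≤ ‖m.predictor n i h‖ :=
    PiLp.norm_apply_le (m.predictor n i h) a
  have h3 : |m.predictor n i h a'| ≤ ‖m.predictor n i h‖ :=
    PiLp.norm_apply_le (m.predictor n i h) a'
  have e : m.entry n i a a' h = m.slope n i h * (m.predictor n i h a * m.predictor n i h a') := rfl
  rw [e, abs_mul, abs_mul, sq]
  exact mul_le_mul h1 (mul_le_mul h2 h3 (abs_nonneg _) (norm_nonneg _))
    (mul_nonneg (abs_nonneg _) (abs_nonneg _)) ((abs_nonneg _).trans h1)

lemma integrable_entry (hU : m.UniformBounds A M) {n i : ℕ} (hi : i ∈ m.regularTimes n)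
    (a a' : Fin p) : Integrable (m.entry n i a a') m.condLaw :=
  (((hU.l1Bound_pow (m.mem_Icc_of_regular hi) (q := 2) (by norm_num)).1).const_mul (2 * A)).mono'
    (measurable_entry n i a a').aestronglyMeasurable (hU.ae_abs_entry_le hi a a')

lemma l1Bound_sq_entry (hU : m.UniformBounds A M) {n i : ℕ} (hi : i ∈ m.regularTimes n)
    (a a' : Fin p) :
    L1Bound m.condLaw (fun h => m.entry n i a a' h ^ 2) ((2 * A) ^ 2 * (1 + M ^ 4)) := by
  refine ((hU.l1Bound_pow (m.mem_Icc_of_regular hi) le_rfl).const_mul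
    (sq_nonneg (2 * A))).of_abs_le
    ((measurable_entry n i a a').pow_const 2).aestronglyMeasurable ?_
  filter_upwards [hU.ae_abs_entry_le hi a a'] with h hh
  rw [abs_pow]
  refine (pow_le_pow_left₀ (abs_nonneg _) hh 2).trans (le_of_eq ?_)
  ring

end UniformBounds

end Weighted

/-- Knight's identity for the remainder. -/
lemma remainder_eq (τ : ℝ) (β₀ : EuclideanSpace ℝ (Fin p)) (n : ℕ) (ω : Ω)
    (β : EuclideanSpace ℝ (Fin p)) :
    m.remainder τ β₀ n ω β
      = ∑ i ∈ Finset.Icc 1 n, excess (inner ℝ (m.x n i ω) (β - β₀)) (m.err n i ω)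
        - 1 / 2 * ∑ i ∈ Finset.Icc 1 n, ∑ a, ∑ a', (β - β₀) a * (β - β₀) a' *
          ∫ ω, m.densityAtZero n i ω * (m.x n i ω a * m.x n i ω a') ∂P := by
  have h1 : ∀ i, checkLoss τ (m.y β₀ n i ω - inner ℝ (m.x n i ω) β)
        - checkLoss τ (m.y β₀ n i ω - inner ℝ (m.x n i ω) β₀)
      = excess (inner ℝ (m.x n i ω) (β - β₀)) (m.err n i ω)
        - inner ℝ (m.x n i ω) (β - β₀) * score τ (m.err n i ω) := by
    intro i
    rw [← checkLoss_sub_checkLoss]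
    simp only [y, inner_sub_right]
    congr 2 <;> ring
  have h2 : inner ℝ (β - β₀) (m.gradSum τ n ω)
      = ∑ i ∈ Finset.Icc 1 n, inner ℝ (m.x n i ω) (β - β₀) * score τ (m.err n i ω) := by
    rw [gradSum, inner_sum]
    refine Finset.sum_congr rfl fun i _ => ?_
    rw [inner_smul_right, real_inner_comm, mul_comm]
  have h3 : (β - β₀).ofLp ⬝ᵥ (m.weightedDesign n).mulVec (β - β₀).ofLp
      = ∑ i ∈ Finset.Icc 1 n, ∑ a, ∑ a', (β - β₀) a * (β - β₀) a' *
          ∫ ω, m.densityAtZero n i ω * (m.x n i ω a * m.x n i ω a') ∂P := by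
    rw [weightedDesign, Matrix.sum_mulVec, dotProduct_sum]
    refine Finset.sum_congr rfl fun i _ => ?_
    simp only [dotProduct, Matrix.mulVec, Matrix.of_apply, Finset.mul_sum]
    refine Finset.sum_congr rfl fun a _ => Finset.sum_congr rfl fun a' _ => ?_
    ring
  rw [remainder, h2, h3, Finset.sum_congr rfl fun i _ => h1 i, Finset.sum_sub_distrib]
  ring

/-! ### The majorant of the remainder -/

section Majorant

variable [IsProbabilityMeasure P]

/-- Local Lipschitz bound for a centred summand. -/
lemma abs_centredExcess_sub_le {n i : ℕ} {h : (ℕ → E₁) × (ℕ → E₂)} {e : E₁}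
    (hh : RegularLaw (m.errorLaw n i h) (m.slope n i h) A)
    {δ δ' : EuclideanSpace ℝ (Fin p)} {a : ℝ} (hδ : ‖δ‖ ≤ a) (hδ' : ‖δ'‖ ≤ a) :
    |m.centredExcess n δ i (h, e) - m.centredExcess n δ' i (h, e)| ≤ ‖δ - δ'‖ *
      (‖m.predictor n i h‖ * (Icc (-(‖m.predictor n i h‖ * a)) (‖m.predictor n i h‖ * a)).indicator
        (fun _ => (1 : ℝ)) (m.error n i (h, e)) + 8 * A * a * ‖m.predictor n i h‖ ^ 2) := by
  have ha : 0 ≤ a := (norm_nonneg _).trans hδ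
  set x := m.predictor n i h with hx
  set b := ‖x‖ * a with hb
  have hb0 : 0 ≤ b := mul_nonneg (norm_nonneg _) ha
  have hv : |inner ℝ x δ| ≤ b :=
    (abs_real_inner_le_norm _ _).trans (mul_le_mul_of_nonneg_left hδ (norm_nonneg _))
  have hv' : |inner ℝ x δ'| ≤ b :=
    (abs_real_inner_le_norm _ _).trans (mul_le_mul_of_nonneg_left hδ' (norm_nonneg _))
  have hd : |inner ℝ x δ - inner ℝ x δ'| ≤ ‖x‖ * ‖δ - δ'‖ := by
    rw [← inner_sub_right]; exact abs_real_inner_le_norm _ _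
  have hind : ∀ ε, 0 ≤ (Icc (-b) b).indicator (fun _ => (1 : ℝ)) ε := fun ε =>
    indicator_nonneg (fun _ _ => zero_le_one) _
  have h1 := (abs_excess_sub_excess_le_indicator (ε := m.error n i (h, e)) hv hv').trans
    (mul_le_mul_of_nonneg_right hd (hind _))
  have h2 : |m.meanExcess n i δ h - m.meanExcess n i δ' h| ≤ ‖x‖ * ‖δ - δ'‖ * (8 * A * b) := by
    simp only [meanExcess]
    rw [← hx, ← integral_sub (integrable_excess _) (integrable_excess _)]
    refine abs_integral_le_integral_abs.trans ?_
    have hI : Integrable ((Icc (-b) b).indicator (fun _ => (1 : ℝ))) (m.errorLaw n i h) :=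
      (integrable_const (1 : ℝ)).indicator measurableSet_Icc
    refine (integral_mono ((integrable_excess _).sub (integrable_excess _)).abs
      (hI.const_mul (‖x‖ * ‖δ - δ'‖)) fun ε => ?_).trans ?_
    · exact (abs_excess_sub_excess_le_indicator hv hv').trans
        (mul_le_mul_of_nonneg_right hd (hind _))
    · rw [integral_const_mul]
      refine mul_le_mul_of_nonneg_left ?_ (by positivity)
      have h3 : ∫ ε, (Icc (-b) b).indicator (fun _ => (1 : ℝ)) ε ∂(m.errorLaw n i h)
          = (m.errorLaw n i h).real (Icc (-b) b) := integral_indicator_one measurableSet_Icc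
      rw [h3]
      exact hh.real_Icc_le hb0
  have e0 : m.centredExcess n δ i (h, e) - m.centredExcess n δ' i (h, e)
      = (excess (inner ℝ x δ) (m.error n i (h, e)) - excess (inner ℝ x δ') (m.error n i (h, e)))
        - (m.meanExcess n i δ h - m.meanExcess n i δ' h) := by
    simp only [centredExcess, hx]; ring
  rw [e0]
  refine (abs_sub _ _).trans ((add_le_add h1 h2).trans (le_of_eq ?_))
  rw [hb]; ring

/-- The conditional mean of the excess is a quadratic form in `δ` up to a cubic error. -/
lemma abs_meanExcess_sub_le {n i : ℕ} {h : (ℕ → E₁) × (ℕ → E₂)}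
    (hh : RegularLaw (m.errorLaw n i h) (m.slope n i h) A)
    {δ : EuclideanSpace ℝ (Fin p)} {a : ℝ} (hδ : ‖δ‖ ≤ a) :
    |m.meanExcess n i δ h - 1 / 2 * ∑ b, ∑ b', δ b * δ b' * m.entry n i b b' h|
      ≤ A * a ^ 3 * ‖m.predictor n i h‖ ^ 3 := by
  have h1 := hh.abs_integral_excess_sub_le (inner ℝ (m.predictor n i h) δ)
  have e : ∑ b, ∑ b', δ b * δ b' * m.entry n i b b' h
      = m.slope n i h * (inner ℝ (m.predictor n i h) δ) ^ 2 := by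
    rw [PiLp.inner_apply, sq, Finset.sum_mul_sum, Finset.mul_sum]
    refine Finset.sum_congr rfl fun b _ => ?_
    rw [Finset.mul_sum]
    refine Finset.sum_congr rfl fun b' _ => ?_
    have : m.entry n i b b' h = m.slope n i h * (m.predictor n i h b * m.predictor n i h b') := rfl
    rw [this]
    simp only [RCLike.inner_apply, conj_trivial]
    ring
  rw [e]
  refine h1.trans ?_
  have hv : |inner ℝ (m.predictor n i h) δ| ≤ ‖m.predictor n i h‖ * a :=
    (abs_real_inner_le_norm _ _).trans (mul_le_mul_of_nonneg_left hδ (norm_nonneg _))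
  have := mul_le_mul_of_nonneg_left (pow_le_pow_left₀ (abs_nonneg _) hv 3) hh.nonneg
  rw [mul_pow] at this
  linarith

lemma abs_quadratic_le {δ : EuclideanSpace ℝ (Fin p)} {ρ : ℝ} (hδ : ‖δ‖ ≤ ρ)
    (c : Fin p → Fin p → ℝ) :
    |∑ a, ∑ a', δ a * δ a' * c a a'| ≤ ρ ^ 2 * ∑ a, ∑ a', |c a a'| := by
  have hδa : ∀ a, |δ a| ≤ ρ := fun a => (PiLp.norm_apply_le δ a).trans hδ
  have hρ : 0 ≤ ρ := (norm_nonneg _).trans hδ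
  rw [Finset.mul_sum]
  refine (Finset.abs_sum_le_sum_abs _ _).trans (Finset.sum_le_sum fun a _ => ?_)
  rw [Finset.mul_sum]
  refine (Finset.abs_sum_le_sum_abs _ _).trans (Finset.sum_le_sum fun a' _ => ?_)
  rw [abs_mul, abs_mul, sq]
  exact mul_le_mul_of_nonneg_right
    (mul_le_mul (hδa a) (hδa a') (abs_nonneg _) hρ) (abs_nonneg _)

variable (m) in
/-- The random Lipschitz modulus of the centred sum on the ball of radius `a`. -/
def lipschitzModulus (A : ℝ) (n : ℕ) (a : ℝ) (ω : Ω) : ℝ :=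
  ∑ i ∈ m.regularTimes n, (‖m.x n i ω‖ *
    (Icc (-(‖m.x n i ω‖ * a)) (‖m.x n i ω‖ * a)).indicator (fun _ => (1 : ℝ)) (m.err n i ω)
      + 8 * A * a * ‖m.x n i ω‖ ^ 2)

variable (m) in
/-- A bound of the remainder that is uniform over the ball of radius `ρ`: the centred sums at the
grid points, the oscillation between grid points, the cubic error of the conditional means, the
fluctuation of the quadratic form, and the contribution of the break points. -/
def majorant (A : ℝ) (n : ℕ) (ρ : ℝ) (L : ℕ) (ω : Ω) : ℝ :=
  ∑ k ∈ gridIndices p L,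
      |∑ i ∈ m.regularTimes n, m.centredExcess n (gridPoint ρ L k) i (m.cond i ω, m.η i ω)|
    + p * (ρ / L) * m.lipschitzModulus A n (p * ρ) ω
    + ∑ i ∈ m.regularTimes n, A * ρ ^ 3 * ‖m.x n i ω‖ ^ 3
    + 1 / 2 * ρ ^ 2 * ∑ a, ∑ a', |∑ i ∈ m.regularTimes n,
        (m.entry n i a a' (m.cond i ω) - ∫ h, m.entry n i a a' h ∂m.condLaw)|
    + ∑ i ∈ m.breakTimes n, ρ * ‖m.x n i ω‖
    + 1 / 2 * ρ ^ 2 * ∑ a, ∑ a', |∑ i ∈ m.breakTimes n, ∫ h, m.entry n i a a' h ∂m.condLaw|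

/-- The majorant bounds the remainder on the whole ball, outside one null set. -/
lemma UniformBounds.ae_abs_remainder_le [NeZero p] (hU : m.UniformBounds A M) (h : m.ErrorRegular)
    (τ : ℝ) (β₀ : EuclideanSpace ℝ (Fin p)) (n : ℕ) {ρ : ℝ} (hρ : 0 < ρ) {L : ℕ} (hL : 0 < L) :
    ∀ᵐ ω ∂P, ∀ β, ‖β - β₀‖ ≤ ρ → |m.remainder τ β₀ n ω β| ≤ m.majorant A n ρ L ω := by
  have hlaw : ∀ᵐ ω ∂P, ∀ i ∈ m.regularTimes n,
      RegularLaw (m.errorLaw n i (m.cond i ω)) (m.slope n i (m.cond i ω)) A := by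
    rw [eventually_all_finset]
    intro i hi
    have := hU.ae_regularLaw hi
    rw [← m.map_cond i] at this
    exact ae_of_ae_map (m.measurable_cond i).aemeasurable this
  filter_upwards [hlaw] with ω hω β hβ
  set δ := β - β₀ with hδ
  have hp : (1 : ℝ) ≤ p := by exact_mod_cast NeZero.one_le
  have hδp : ‖δ‖ ≤ p * ρ := hβ.trans (by nlinarith)
  obtain ⟨k, hk, hkδ⟩ := exists_gridPoint_near hρ hL hβ
  have hx : ∀ i ∈ m.regularTimes n, m.x n i ω = m.predictor n i (m.cond i ω) := fun i hi =>
    m.x_eq_predictor (m.mem_Icc_of_regular hi) ω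
  have hε : ∀ i ∈ m.regularTimes n, m.err n i ω = m.error n i (m.cond i ω, m.η i ω) := fun i hi =>
    m.err_eq_error (m.mem_Icc_of_regular hi) ω
  -- the decomposition
  have hdec : m.remainder τ β₀ n ω β
      = ∑ i ∈ m.regularTimes n, m.centredExcess n δ i (m.cond i ω, m.η i ω)
        + ∑ i ∈ m.regularTimes n, (m.meanExcess n i δ (m.cond i ω)
          - 1 / 2 * ∑ a, ∑ a', δ a * δ a' * m.entry n i a a' (m.cond i ω))
        + 1 / 2 * ∑ a, ∑ a', δ a * δ a' * ∑ i ∈ m.regularTimes n,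
          (m.entry n i a a' (m.cond i ω) - ∫ h, m.entry n i a a' h ∂m.condLaw)
        + ∑ i ∈ m.breakTimes n, excess (inner ℝ (m.x n i ω) δ) (m.err n i ω)
        - 1 / 2 * ∑ a, ∑ a', δ a * δ a' *
          ∑ i ∈ m.breakTimes n, ∫ h, m.entry n i a a' h ∂m.condLaw := by
    have hswap : ∀ (J : Finset ℕ) (c : ℕ → Fin p → Fin p → ℝ),
        ∑ a, ∑ a', δ a * δ a' * ∑ i ∈ J, c i a a'
          = ∑ i ∈ J, ∑ a, ∑ a', δ a * δ a' * c i a a' := by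
      intro J c
      simp only [Finset.mul_sum]
      rw [Finset.sum_comm (s := J)]
      exact Finset.sum_congr rfl fun a _ => Finset.sum_comm
    have hK : ∑ i ∈ Finset.Icc 1 n, ∑ a, ∑ a', δ a * δ a' *
          ∫ ω, m.densityAtZero n i ω * (m.x n i ω a * m.x n i ω a') ∂P
        = ∑ i ∈ Finset.Icc 1 n, ∑ a, ∑ a', δ a * δ a' * ∫ h, m.entry n i a a' h ∂m.condLaw :=
      Finset.sum_congr rfl fun i hi => Finset.sum_congr rfl fun a _ =>
        Finset.sum_congr rfl fun a' _ => by rw [integral_densityAtZero_mul h hi]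
    have hreg : ∑ i ∈ m.regularTimes n, excess (inner ℝ (m.x n i ω) δ) (m.err n i ω)
        = ∑ i ∈ m.regularTimes n, m.centredExcess n δ i (m.cond i ω, m.η i ω)
          + ∑ i ∈ m.regularTimes n, m.meanExcess n i δ (m.cond i ω) := by
      rw [← Finset.sum_add_distrib]
      refine Finset.sum_congr rfl fun i hi => ?_
      rw [hx i hi, hε i hi, centredExcess, sub_add_cancel]
    rw [remainder_eq, ← hδ, hK, m.sum_Icc_eq n, m.sum_Icc_eq n, hreg, hswap, hswap]
    simp only [mul_sub, Finset.sum_sub_distrib, ← Finset.mul_sum]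
    ring
  -- the centred sum: compare with the nearest grid point
  have hcent : |∑ i ∈ m.regularTimes n, m.centredExcess n δ i (m.cond i ω, m.η i ω)|
      ≤ ∑ k ∈ gridIndices p L,
          |∑ i ∈ m.regularTimes n, m.centredExcess n (gridPoint ρ L k) i (m.cond i ω, m.η i ω)|
        + p * (ρ / L) * m.lipschitzModulus A n (p * ρ) ω := by
    have h1 : |∑ i ∈ m.regularTimes n, m.centredExcess n (gridPoint ρ L k) i (m.cond i ω, m.η i ω)|
        ≤ ∑ k ∈ gridIndices p L,
          |∑ i ∈ m.regularTimes n, m.centredExcess n (gridPoint ρ L k) i (m.cond i ω, m.η i ω)| :=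
      Finset.single_le_sum (f := fun k => |∑ i ∈ m.regularTimes n,
        m.centredExcess n (gridPoint ρ L k) i (m.cond i ω, m.η i ω)|)
        (fun _ _ => abs_nonneg _) hk
    have h2 : |∑ i ∈ m.regularTimes n, m.centredExcess n δ i (m.cond i ω, m.η i ω)
        - ∑ i ∈ m.regularTimes n, m.centredExcess n (gridPoint ρ L k) i (m.cond i ω, m.η i ω)|
        ≤ p * (ρ / L) * m.lipschitzModulus A n (p * ρ) ω := by
      rw [← Finset.sum_sub_distrib, lipschitzModulus, Finset.mul_sum]
      refine (Finset.abs_sum_le_sum_abs _ _).trans (Finset.sum_le_sum fun i hi => ?_)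
      rw [hx i hi, hε i hi]
      refine (abs_centredExcess_sub_le (hω i hi) hδp (norm_gridPoint_le hρ.le hk)).trans
        (mul_le_mul_of_nonneg_right hkδ ?_)
      have hA := hU.nonneg_A
      exact add_nonneg (mul_nonneg (norm_nonneg _) (indicator_nonneg (fun _ _ => zero_le_one) _))
        (by positivity)
    have h3 := abs_add_le
      (∑ i ∈ m.regularTimes n, m.centredExcess n (gridPoint ρ L k) i (m.cond i ω, m.η i ω))
      (∑ i ∈ m.regularTimes n, m.centredExcess n δ i (m.cond i ω, m.η i ω)
        - ∑ i ∈ m.regularTimes n, m.centredExcess n (gridPoint ρ L k) i (m.cond i ω, m.η i ω))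
    rw [add_sub_cancel] at h3
    linarith
  have hmean : |∑ i ∈ m.regularTimes n, (m.meanExcess n i δ (m.cond i ω)
          - 1 / 2 * ∑ a, ∑ a', δ a * δ a' * m.entry n i a a' (m.cond i ω))|
      ≤ ∑ i ∈ m.regularTimes n, A * ρ ^ 3 * ‖m.x n i ω‖ ^ 3 := by
    refine (Finset.abs_sum_le_sum_abs _ _).trans (Finset.sum_le_sum fun i hi => ?_)
    rw [hx i hi]
    exact abs_meanExcess_sub_le (hω i hi) hβ
  have hbreak : |∑ i ∈ m.breakTimes n, excess (inner ℝ (m.x n i ω) δ) (m.err n i ω)|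
      ≤ ∑ i ∈ m.breakTimes n, ρ * ‖m.x n i ω‖ := by
    refine (Finset.abs_sum_le_sum_abs _ _).trans (Finset.sum_le_sum fun i _ => ?_)
    refine (abs_excess_le _ _).trans ((abs_real_inner_le_norm _ _).trans ?_)
    rw [mul_comm]
    exact mul_le_mul_of_nonneg_right hβ (norm_nonneg _)
  have hq1 := abs_quadratic_le hβ fun a a' => ∑ i ∈ m.regularTimes n,
    (m.entry n i a a' (m.cond i ω) - ∫ h, m.entry n i a a' h ∂m.condLaw)
  have hq2 := abs_quadratic_le hβ fun a a' => ∑ i ∈ m.breakTimes n,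
    ∫ h, m.entry n i a a' h ∂m.condLaw
  rw [hdec, majorant]
  refine (abs_sub _ _).trans (add_le_add ((abs_add_le _ _).trans (add_le_add
    ((abs_add_le _ _).trans (add_le_add ((abs_add_le _ _).trans (add_le_add hcent hmean)) ?_))
    hbreak)) ?_)
  · rw [abs_mul, abs_of_pos (by norm_num : (0 : ℝ) < 1 / 2), mul_assoc]
    exact mul_le_mul_of_nonneg_left hq1 (by norm_num)
  · rw [abs_mul, abs_of_pos (by norm_num : (0 : ℝ) < 1 / 2), mul_assoc]
    exact mul_le_mul_of_nonneg_left hq2 (by norm_num)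

end Majorant

end PLSModel

/-! ### The bound tends to zero -/

/-- The `L¹` bound of the majorant on the ball of radius `ρ`, with grid size `L` and window `w`: its
six terms in the same order. `B` bounds the moments of the predictors, `C χ ^ w` the cost of the
window approximation, and `κ` the terms of `K_n` at the break points. -/
def majorantBound (p R : ℕ) (A B C χ κ : ℝ) (n w L : ℕ) (ρ : ℝ) : ℝ :=
  (2 * L + 1) ^ p * √(n * (4 * A * (p * ρ) ^ 3 * B))
    + p * (ρ / L) * (n * (8 * A * (p * ρ) * B + 8 * A * (p * ρ) * B))
    + n * (A * ρ ^ 3 * B)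
    + 1 / 2 * ρ ^ 2 * (p * (p * (2 * (n * (C * χ ^ w))
        + √(n * ((2 * w + 1) * ((2 * A) ^ 2 * B))))))
    + (R + 2) * (ρ * B)
    + 1 / 2 * ρ ^ 2 * κ

lemma tendsto_log_pow_mul_rpow (k : ℕ) :
    Tendsto (fun n : ℕ => Real.log n ^ k * (n : ℝ) ^ (-(1 / 4) : ℝ)) atTop (𝓝 0) := by
  have h := (isLittleO_log_rpow_rpow_atTop (k : ℝ) (s := 1 / 4) (by norm_num)).tendsto_div_nhds_zero
  refine (h.comp tendsto_natCast_atTop_atTop).congr fun n => ?_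
  simp only [Function.comp, Real.rpow_natCast]
  rw [Real.rpow_neg (Nat.cast_nonneg n), div_eq_mul_inv]

lemma tendsto_log_sq_mul_pow_sqrt {χ : ℝ} (hχ : χ ∈ Ioo (0 : ℝ) 1) :
    Tendsto (fun n : ℕ => Real.log n ^ 2 * χ ^ Nat.sqrt n) atTop (𝓝 0) := by
  have hs : Tendsto Nat.sqrt atTop atTop :=
    tendsto_atTop.2 fun b => eventually_atTop.2 ⟨b * b, fun n hn => Nat.le_sqrt.2 hn⟩
  have h1 := ((tendsto_pow_const_mul_const_pow_of_lt_one 2 hχ.1.le hχ.2).comp hs).const_mul 4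
  rw [mul_zero] at h1
  refine squeeze_zero' (Eventually.of_forall fun n => ?_) ?_ h1
  · exact mul_nonneg (sq_nonneg _) (pow_nonneg hχ.1.le _)
  · filter_upwards [eventually_ge_atTop 1] with n hn
    have hn' : (1 : ℝ) ≤ n := by exact_mod_cast hn
    have hlt : n < (Nat.sqrt n + 1) ^ 2 := by rw [sq]; exact Nat.lt_succ_sqrt n
    have h2 : Real.log n ≤ 2 * Nat.sqrt n := by
      have h3 : Real.log n ≤ Real.log (((Nat.sqrt n : ℝ) + 1) ^ 2) :=
        Real.log_le_log (by linarith) (by exact_mod_cast hlt.le)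
      rw [Real.log_pow] at h3
      have h4 := Real.log_le_sub_one_of_pos (x := (Nat.sqrt n : ℝ) + 1) (by positivity)
      push_cast at h3
      linarith
    have h5 := pow_le_pow_left₀ (Real.log_nonneg hn') h2 2
    have h6 := mul_le_mul_of_nonneg_right h5 (pow_nonneg hχ.1.le (Nat.sqrt n))
    simp only [Function.comp]
    linarith

/-- The estimate behind the choice of radius, grid and window: `u` plays the role of `n^{-1/4}` and
`l` that of `log n`. -/
lemma majorantBound_le {p R : ℕ} {A B C χ κ : ℝ} {n w L : ℕ} {l u : ℝ} (hA : 0 ≤ A) (hB : 0 ≤ B)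
    (hl : 1 ≤ l) (hu0 : 0 < u) (hu1 : u ≤ 1)
    (hn : n * u ^ 4 = 1) (hw : (w : ℝ) * u ^ 2 ≤ 1) (hL1 : l ^ 3 ≤ L) (hL2 : L ≤ l ^ 3 + 1) :
    majorantBound p R A B C χ κ n w L (u ^ 2 * l) ≤
      5 ^ p * √(4 * A * p ^ 3 * B) * (l ^ (3 * p + 2) * u)
      + 16 * A * p ^ 2 * B * l⁻¹
      + A * B * (l ^ 3 * u)
      + p ^ 2 * C * (l ^ 2 * χ ^ w)
      + p ^ 2 * √(3 * ((2 * A) ^ 2 * B)) * (l ^ 2 * u)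
      + (R + 2) * B * (l ^ 1 * u)
      + |κ| * (l ^ 2 * u) := by
  have hl0 : 0 < l := by linarith
  have hu2 : u ^ 2 ≤ u := by nlinarith
  have hu4 : u ^ 4 ≤ u := by nlinarith [pow_le_one₀ hu0.le hu1 (n := 2)]
  have hl3 : 1 ≤ l ^ 3 := one_le_pow₀ hl
  have hLpos : (0 : ℝ) < L := by linarith
  have t1 : (2 * (L : ℝ) + 1) ^ p * √(n * (4 * A * (p * (u ^ 2 * l)) ^ 3 * B))
      ≤ 5 ^ p * √(4 * A * p ^ 3 * B) * (l ^ (3 * p + 2) * u) := by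
    have h1 : (2 * (L : ℝ) + 1) ^ p ≤ (5 * l ^ 3) ^ p :=
      pow_le_pow_left₀ (by positivity) (by linarith) p
    have h2 : √(n * (4 * A * (p * (u ^ 2 * l)) ^ 3 * B)) ≤ √(4 * A * p ^ 3 * B) * (l ^ 2 * u) := by
      have e : √(4 * A * p ^ 3 * B) * (l ^ 2 * u) = √(4 * A * p ^ 3 * B * (l ^ 2 * u) ^ 2) := by
        rw [Real.sqrt_mul (x := 4 * A * p ^ 3 * B) (by positivity) ((l ^ 2 * u) ^ 2),
          Real.sqrt_sq (by positivity)]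
      rw [e]
      refine Real.sqrt_le_sqrt ?_
      have e2 : (n : ℝ) * (4 * A * (p * (u ^ 2 * l)) ^ 3 * B)
          = 4 * A * p ^ 3 * B * (l ^ 3 * u ^ 2) * (n * u ^ 4) := by ring
      rw [e2, hn, mul_one]
      refine mul_le_mul_of_nonneg_left ?_ (by positivity)
      rw [mul_pow, ← pow_mul]
      exact mul_le_mul_of_nonneg_right (pow_le_pow_right₀ hl (by norm_num)) (by positivity)
    refine (mul_le_mul h1 h2 (Real.sqrt_nonneg _) (by positivity)).trans (le_of_eq ?_)
    rw [mul_pow, ← pow_mul]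
    ring
  have t2 : p * (u ^ 2 * l / L) * (n * (8 * A * (p * (u ^ 2 * l)) * B + 8 * A * (p * (u ^ 2 * l)) * B))
      ≤ 16 * A * p ^ 2 * B * l⁻¹ := by
    have e : p * (u ^ 2 * l / L) *
        (n * (8 * A * (p * (u ^ 2 * l)) * B + 8 * A * (p * (u ^ 2 * l)) * B))
        = 16 * A * p ^ 2 * B * (l ^ 2 / L) * (n * u ^ 4) := by ring
    rw [e, hn, mul_one]
    refine mul_le_mul_of_nonneg_left ?_ (by positivity)
    rw [div_le_iff₀ hLpos, ← div_eq_inv_mul, le_div_iff₀ hl0]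
    linarith [pow_succ l 2]
  have t3 : n * (A * (u ^ 2 * l) ^ 3 * B) ≤ A * B * (l ^ 3 * u) := by
    have e : n * (A * (u ^ 2 * l) ^ 3 * B) = A * B * (l ^ 3 * u ^ 2) * (n * u ^ 4) := by ring
    rw [e, hn, mul_one]
    exact mul_le_mul_of_nonneg_left (mul_le_mul_of_nonneg_left hu2 (by positivity)) (by positivity)
  have t4 : 1 / 2 * (u ^ 2 * l) ^ 2 * (p * (p * (2 * (n * (C * χ ^ w))
        + √(n * ((2 * w + 1) * ((2 * A) ^ 2 * B))))))
      ≤ p ^ 2 * C * (l ^ 2 * χ ^ w) + p ^ 2 * √(3 * ((2 * A) ^ 2 * B)) * (l ^ 2 * u) := by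
    have h1 : u ^ 3 * √(n * ((2 * w + 1) * ((2 * A) ^ 2 * B))) ≤ √(3 * ((2 * A) ^ 2 * B)) := by
      rw [← Real.sqrt_sq (show (0 : ℝ) ≤ u ^ 3 by positivity), ← Real.sqrt_mul (by positivity)]
      refine Real.sqrt_le_sqrt ?_
      have e : (u ^ 3) ^ 2 * (n * ((2 * w + 1) * ((2 * A) ^ 2 * B)))
          = ((2 * A) ^ 2 * B) * (2 * (w * u ^ 2) + u ^ 2) * (n * u ^ 4) := by ring
      rw [e, hn, mul_one, mul_comm]
      exact mul_le_mul_of_nonneg_right (by linarith) (by positivity)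
    have e : 1 / 2 * (u ^ 2 * l) ^ 2 * (p * (p * (2 * (n * (C * χ ^ w))
        + √(n * ((2 * w + 1) * ((2 * A) ^ 2 * B))))))
        = p ^ 2 * C * (l ^ 2 * χ ^ w) * (n * u ^ 4)
          + 1 / 2 * (p ^ 2 * (l ^ 2 * u)
            * (u ^ 3 * √(n * ((2 * w + 1) * ((2 * A) ^ 2 * B))))) := by ring
    rw [e, hn, mul_one]
    have h2 := mul_le_mul_of_nonneg_left h1 (show 0 ≤ (p : ℝ) ^ 2 * (l ^ 2 * u) by positivity)
    have h3 : 0 ≤ (p : ℝ) ^ 2 * (l ^ 2 * u) * √(3 * ((2 * A) ^ 2 * B)) := by positivity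
    linarith
  have t5 : ((R : ℝ) + 2) * (u ^ 2 * l * B) ≤ (R + 2) * B * (l ^ 1 * u) := by
    have := mul_le_mul_of_nonneg_left hu2 (show 0 ≤ ((R : ℝ) + 2) * B * l by positivity)
    linarith
  have t6 : 1 / 2 * (u ^ 2 * l) ^ 2 * κ ≤ |κ| * (l ^ 2 * u) := by
    have h1 : 1 / 2 * (u ^ 2 * l) ^ 2 * κ ≤ 1 / 2 * (u ^ 2 * l) ^ 2 * |κ| :=
      mul_le_mul_of_nonneg_left (le_abs_self κ) (by positivity)
    have h2 := mul_le_mul_of_nonneg_left hu4 (show 0 ≤ |κ| * l ^ 2 by positivity)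
    have h3 : 0 ≤ (u ^ 2 * l) ^ 2 * |κ| := by positivity
    linarith
  unfold majorantBound
  linarith

/-- The window `√n` makes the geometric dependence negligible while keeping the variance of the
quadratic form small; the grid size `log³ n` beats the factor `n ρ² = log² n` of the oscillation
term, and the resulting number of grid points is a power of `log n`. -/
lemma tendsto_majorantBound (p R : ℕ) {A B : ℝ} (C : ℝ) {χ : ℝ} (κ : ℝ) (hA : 0 ≤ A) (hB : 0 ≤ B)
    (hχ : χ ∈ Ioo (0 : ℝ) 1) :
    ∃ c : ℕ → ℝ, Tendsto c atTop (𝓝 0) ∧ ∀ᶠ n : ℕ in atTop,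
      majorantBound p R A B C χ κ n (Nat.sqrt n) ⌈Real.log n ^ 3⌉₊
        ((n : ℝ) ^ (-(1 / 2) : ℝ) * Real.log n) ≤ c n := by
  have hlog := tendsto_log_pow_mul_rpow
  have hinv : Tendsto (fun n : ℕ => (Real.log n)⁻¹) atTop (𝓝 0) :=
    tendsto_inv_atTop_zero.comp (Real.tendsto_log_atTop.comp tendsto_natCast_atTop_atTop)
  have hsum := ((((((((hlog (3 * p + 2)).const_mul (5 ^ p * √(4 * A * p ^ 3 * B))).add
    (hinv.const_mul (16 * A * p ^ 2 * B))).add ((hlog 3).const_mul (A * B))).add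
    ((tendsto_log_sq_mul_pow_sqrt hχ).const_mul (p ^ 2 * C))).add
    ((hlog 2).const_mul (p ^ 2 * √(3 * ((2 * A) ^ 2 * B))))).add
    ((hlog 1).const_mul ((R + 2) * B))).add ((hlog 2).const_mul |κ|))
  simp only [mul_zero, add_zero] at hsum
  refine ⟨_, hsum, ?_⟩
  filter_upwards [eventually_ge_atTop 3] with n hn
  have hn' : (3 : ℝ) ≤ n := by exact_mod_cast hn
  have hn0 : (0 : ℝ) < n := by linarith
  have hl : 1 ≤ Real.log n := by
    rw [Real.le_log_iff_exp_le hn0]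
    linarith [Real.exp_one_lt_d9]
  have hρ : (n : ℝ) ^ (-(1 / 2) : ℝ) = ((n : ℝ) ^ (-(1 / 4) : ℝ)) ^ 2 := by
    rw [← Real.rpow_natCast, ← Real.rpow_mul hn0.le]; norm_num
  have hsq : ((n : ℝ) ^ (-(1 / 4) : ℝ)) ^ 4 = (n : ℝ)⁻¹ := by
    rw [← Real.rpow_natCast, ← Real.rpow_mul hn0.le, ← Real.rpow_neg_one]; norm_num
  have hu0 : (0 : ℝ) < (n : ℝ) ^ (-(1 / 4) : ℝ) := Real.rpow_pos_of_pos hn0 _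
  have hl3 : (0 : ℝ) ≤ Real.log n ^ 3 := by positivity
  rw [hρ]
  refine majorantBound_le hA hB hl hu0
    (Real.rpow_le_one_of_one_le_of_nonpos (by linarith) (by norm_num)) ?_ ?_ (Nat.le_ceil _)
    (Nat.ceil_lt_add_one hl3).le
  · rw [hsq, mul_inv_cancel₀ hn0.ne']
  · have h1 : ((Nat.sqrt n : ℝ) * ((n : ℝ) ^ (-(1 / 4) : ℝ)) ^ 2) ^ 2 ≤ 1 := by
      rw [mul_pow, ← pow_mul, hsq, ← div_eq_mul_inv, div_le_one hn0]
      exact_mod_cast Nat.sqrt_le' n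
    exact (sq_le_one_iff₀ (by positivity)).1 h1

namespace PLSModel

variable {Ω : Type*} [MeasurableSpace Ω] {P : Measure Ω} [IsProbabilityMeasure P]
  {E₁ E₂ : Type*} [MeasurableSpace E₁] [MeasurableSpace E₂] {p R : ℕ}
  {m : PLSModel P E₁ E₂ p R} {A M : ℝ}

omit [IsProbabilityMeasure P] in
/-- The break points contribute boundedly many terms of `K_n`, from a fixed finite set of values. -/
lemma exists_break_bound (m : PLSModel P E₁ E₂ p R) : ∃ κ : ℝ, ∀ n : ℕ,
    ∑ a, ∑ a', |∑ i ∈ m.breakTimes n, ∫ h, m.entry n i a a' h ∂m.condLaw| ≤ κ := by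
  let c : Fin p → Fin p → ℝ := fun a a' =>
    ∑ r, |∫ h, m.weightedEntry r (m.b r.succ) a a' h ∂m.condLaw|
  refine ⟨∑ a, ∑ a', ((R + 2 : ℕ) : ℝ) * c a a', fun n => Finset.sum_le_sum fun a _ =>
    Finset.sum_le_sum fun a' _ => ?_⟩
  have hc0 : 0 ≤ c a a' := Finset.sum_nonneg fun _ _ => abs_nonneg _
  refine (Finset.abs_sum_le_sum_abs _ _).trans
    ((Finset.sum_le_card_nsmul _ _ (c a a') fun i hi => ?_).trans ?_)
  · have hp := m.idx_spec (m.mem_Icc_of_break hi)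
    -- a break point in `(b_r, b_{r+1}]` is its right end
    have hb : (i : ℝ) / n = m.b (m.idx n i).succ := by
      have hex : ∃ r, (i : ℝ) / n = m.b r := by simpa using (Finset.mem_filter.1 hi).2
      obtain ⟨r, hr⟩ := hex
      rw [hr] at hp ⊢
      have h1 := m.b_strictMono.lt_iff_lt.1 hp.1
      have h2 := m.b_strictMono.le_iff_le.1 hp.2
      congr 1
      rw [Fin.lt_def] at h1
      rw [Fin.le_def] at h2
      ext
      simp at h1 h2 ⊢
      omega
    rw [entry, hb]
    exact Finset.single_le_sum (f := fun r => |∫ h, m.weightedEntry r (m.b r.succ) a a' h ∂m.condLaw|)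
      (fun _ _ => abs_nonneg _) (Finset.mem_univ _)
  · rw [nsmul_eq_mul]
    exact mul_le_mul_of_nonneg_right (by exact_mod_cast m.card_breakTimes_le n) hc0

namespace UniformBounds

lemma l1Bound_norm_x_pow (hU : m.UniformBounds A M) {n i : ℕ} (hi : i ∈ Finset.Icc 1 n) {q : ℕ}
    (hq : q ≤ 4) : L1Bound P (fun ω => ‖m.x n i ω‖ ^ q) (1 + M ^ 4) := by
  have := L1Bound_comp_cond (hU.l1Bound_pow hi hq) i
  simpa only [← m.x_eq_predictor hi] using this

/-- The six terms of the majorant are bounded in mean one by one. -/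
lemma l1Bound_majorant (hU : m.UniformBounds A M) {C χ κ : ℝ} (hC : 0 ≤ C) (hχ : 0 ≤ χ) {n w : ℕ}
    (hs : ∀ i ∈ m.regularTimes n, ∀ a a', spliceCost m.innovLaw
      (fun s => m.entry n i a a' (toCond s)) w ≤ ENNReal.ofReal (C * χ ^ w))
    (hκ : ∑ a, ∑ a', |∑ i ∈ m.breakTimes n, ∫ h, m.entry n i a a' h ∂m.condLaw| ≤ κ)
    {ρ : ℝ} (hρ : 0 ≤ ρ) (L : ℕ) :
    L1Bound P (m.majorant A n ρ L) (majorantBound p R A (1 + M ^ 4) C χ κ n w L ρ) := by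
  have hA := hU.nonneg_A
  have hM := hU.nonneg_M
  have hcard : ((m.regularTimes n).card : ℝ) ≤ n := by exact_mod_cast m.card_regularTimes_le n
  have hcard' : ((m.breakTimes n).card : ℝ) ≤ R + 2 := by exact_mod_cast m.card_breakTimes_le n
  have b1 : L1Bound P (fun ω => ∑ k ∈ gridIndices p L,
      |∑ i ∈ m.regularTimes n, m.centredExcess n (gridPoint ρ L k) i (m.cond i ω, m.η i ω)|)
      ((2 * L + 1) ^ p * √(n * (4 * A * (p * ρ) ^ 3 * (1 + M ^ 4)))) := by
    have := L1Bound.sum_const (J := gridIndices p L) fun k hk =>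
      (hU.l1Bound_sum_centredExcess n (norm_gridPoint_le hρ hk)).abs
    rw [card_gridIndices] at this
    exact_mod_cast this
  have b2 : L1Bound P (fun ω => p * (ρ / L) * m.lipschitzModulus A n (p * ρ) ω)
      (p * (ρ / L) * (n * (8 * A * (p * ρ) * (1 + M ^ 4) + 8 * A * (p * ρ) * (1 + M ^ 4)))) := by
    refine L1Bound.const_mul (L1Bound.mono_const (L1Bound.sum_const fun i hi =>
      (hU.l1Bound_smallError hi (a := p * ρ) (by positivity)).add
      ((hU.l1Bound_norm_x_pow (m.mem_Icc_of_regular hi) (q := 2) (by norm_num)).const_mul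
        (k := 8 * A * (p * ρ)) (by positivity))) ?_) (by positivity)
    exact mul_le_mul_of_nonneg_right hcard (by positivity)
  have b3 : L1Bound P (fun ω => ∑ i ∈ m.regularTimes n, A * ρ ^ 3 * ‖m.x n i ω‖ ^ 3)
      (n * (A * ρ ^ 3 * (1 + M ^ 4))) := by
    refine L1Bound.mono_const (L1Bound.sum_const fun i hi =>
      (hU.l1Bound_norm_x_pow (m.mem_Icc_of_regular hi) (q := 3) (by norm_num)).const_mul
        (k := A * ρ ^ 3) (by positivity)) ?_
    exact mul_le_mul_of_nonneg_right hcard (by positivity)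
  have b4 : L1Bound P (fun ω => 1 / 2 * ρ ^ 2 * ∑ a, ∑ a', |∑ i ∈ m.regularTimes n,
        (m.entry n i a a' (m.cond i ω) - ∫ h, m.entry n i a a' h ∂m.condLaw)|)
      (1 / 2 * ρ ^ 2 * (p * (p * (2 * (n * (C * χ ^ w))
        + √(n * ((2 * w + 1) * ((2 * A) ^ 2 * (1 + M ^ 4)))))))) := by
    refine L1Bound.const_mul ?_ (by positivity)
    have h1 : ∀ a a' : Fin p, L1Bound P (fun ω => |∑ i ∈ m.regularTimes n,
        (m.entry n i a a' (m.cond i ω) - ∫ h, m.entry n i a a' h ∂m.condLaw)|)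
        (2 * (n * (C * χ ^ w)) + √(n * ((2 * w + 1) * ((2 * A) ^ 2 * (1 + M ^ 4))))) := by
      intro a a'
      refine L1Bound.mono_const (L1Bound.abs (m.l1Bound_sum_centered (J := m.regularTimes n)
        (g := fun i => m.entry n i a a') (fun i => measurable_entry n i a a')
        (B := (2 * A) ^ 2 * (1 + M ^ 4)) (c := C * χ ^ w) (w := w) (by positivity) (by positivity)
        (fun i hi => (hU.l1Bound_sq_entry hi a a').1) (fun i hi => ?_)
        (fun i hi => hs i hi a a'))) ?_
      · exact (le_abs_self _).trans
          (abs_integral_le_integral_abs.trans (hU.l1Bound_sq_entry hi a a').2)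
      · refine add_le_add (mul_le_mul_of_nonneg_left
          (mul_le_mul_of_nonneg_right hcard (by positivity)) (by norm_num)) (Real.sqrt_le_sqrt ?_)
        exact mul_le_mul_of_nonneg_right hcard (by positivity)
    have h2 := L1Bound.sum_const (J := (Finset.univ : Finset (Fin p))) fun a _ =>
      L1Bound.sum_const (J := (Finset.univ : Finset (Fin p))) fun a' _ => h1 a a'
    simpa using h2
  have b5 : L1Bound P (fun ω => ∑ i ∈ m.breakTimes n, ρ * ‖m.x n i ω‖)
      ((R + 2) * (ρ * (1 + M ^ 4))) := by
    refine L1Bound.mono_const (L1Bound.sum_const fun i hi =>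
      L1Bound.const_mul (k := ρ) (a := 1 + M ^ 4) ?_ hρ) ?_
    · have := hU.l1Bound_norm_x_pow (m.mem_Icc_of_break hi) (q := 1) (by norm_num)
      simpa only [pow_one] using this
    · exact mul_le_mul_of_nonneg_right hcard' (by positivity)
  have b6 : L1Bound P (fun _ => 1 / 2 * ρ ^ 2 *
      ∑ a, ∑ a', |∑ i ∈ m.breakTimes n, ∫ h, m.entry n i a a' h ∂m.condLaw|)
      (1 / 2 * ρ ^ 2 * κ) := by
    refine L1Bound.const_mul ⟨integrable_const _, ?_⟩ (by positivity)
    simp only [integral_const, probReal_univ, one_smul]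
    rwa [abs_of_nonneg (Finset.sum_nonneg fun _ _ => Finset.sum_nonneg fun _ _ => abs_nonneg _)]
  exact ((((b1.add b2).add b3).add b4).add b5).add b6

end UniformBounds

lemma exists_uniformBounds [NeZero p] (h_design : m.DesignRegular) (h_error : m.ErrorRegular)
    (h_density : m.DensityRegular) : ∃ A M : ℝ, m.UniformBounds A M := by
  obtain ⟨A, hA⟩ := ae_regularLaw h_error h_density
  obtain ⟨M, hM0, hM⟩ := exists_moment_bound h_design
  refine ⟨A, M, ?_, hM0, hA, hM⟩
  have hr : m.b (0 : Fin (R + 1)).castSucc < m.b (0 : Fin (R + 1)).succ :=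
    m.b_strictMono (Fin.castSucc_lt_succ)
  obtain ⟨t, ht⟩ := nonempty_Ioo.2 hr
  obtain ⟨h, hh⟩ := (hA 0 t ht).exists
  exact hh.nonneg

end PLSModel

end QuantReg

end

theorem lemma1 {Ω : Type*} [MeasurableSpace Ω] {P : Measure Ω} [IsProbabilityMeasure P]
    {E₁ E₂ : Type*} [MeasurableSpace E₁] [MeasurableSpace E₂] {p R : ℕ} [NeZero p]
    (m : QuantReg.PLSModel P E₁ E₂ p R) (β₀ : EuclideanSpace ℝ (Fin p))
    (τ : ℝ) (hτ : τ ∈ Set.Ioo (0 : ℝ) 1)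
    (h_intercept : m.HasIntercept) (h_quantile : m.ZeroQuantile τ)
    (h_design : m.DesignRegular) (h_error : m.ErrorRegular)
    (h_density : m.DensityRegular) (h_nondeg : m.DesignNondegenerate) :
    (∀ n : ℕ, ∀ i ∈ Finset.Icc 1 n, (∀ r, (i : ℝ) / n ≠ m.b r) → ∀ a a' : Fin p,
      Integrable (fun ω => m.densityAtZero n i ω * (m.x n i ω a * m.x n i ω a')) P) ∧
    TendstoInMeasure P
      (fun (n : ℕ) ω =>
        ⨆ β : Metric.closedBall β₀ ((n : ℝ) ^ (-(1 / 2 : ℝ)) * Real.log n),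
          |m.remainder τ β₀ n ω β|)
      atTop (fun _ => 0) := by
  obtain ⟨A, M, hU⟩ := QuantReg.PLSModel.exists_uniformBounds h_design h_error h_density
  have hreg : ∀ {n i : ℕ}, i ∈ Finset.Icc 1 n → (∀ r, (i : ℝ) / n ≠ m.b r) →
      i ∈ m.regularTimes n := fun hi hne => Finset.mem_filter.2 ⟨hi, hne⟩
  refine ⟨fun n i hi hne a a' => ?_, ?_⟩
  · refine Integrable.congr ?_ (QuantReg.PLSModel.densityAtZero_mul_ae_eq h_error hi a a').symm
    have h := hU.integrable_entry (hreg hi hne) a a'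
    rw [← m.map_cond i] at h
    exact h.comp_measurable (m.measurable_cond i)
  have hA := hU.nonneg_A
  have hB : 0 ≤ 1 + M ^ 4 := by have := hU.nonneg_M; positivity
  obtain ⟨C, hC, χ, hχ, k₀, hsplice⟩ := QuantReg.PLSModel.exists_spliceCost_bound h_design h_error
    (2 * A) M (by positivity) hU.nonneg_M
  obtain ⟨κ, hκ⟩ := QuantReg.PLSModel.exists_break_bound m
  obtain ⟨c, hc, hcle⟩ := QuantReg.tendsto_majorantBound p R C κ hA hB hχ
  rw [tendstoInMeasure_iff_norm]
  intro ε hε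
  have hlim : Tendsto (fun n => ENNReal.ofReal (c n / ε)) atTop (𝓝 0) := by
    have := ENNReal.tendsto_ofReal (hc.div_const ε)
    simpa using this
  refine tendsto_of_tendsto_of_tendsto_of_le_of_le' tendsto_const_nhds hlim
    (Eventually.of_forall fun _ => zero_le) ?_
  filter_upwards [hcle, eventually_ge_atTop 3, eventually_ge_atTop (k₀ * k₀)] with n hn hn3 hnk
  have hn3' : (3 : ℝ) ≤ n := by exact_mod_cast hn3
  have hlog : 0 < Real.log n := Real.log_pos (by linarith)
  set ρ : ℝ := (n : ℝ) ^ (-(1 / 2 : ℝ)) * Real.log n with hρd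
  have hρ : 0 < ρ := mul_pos (Real.rpow_pos_of_pos (by linarith) _) hlog
  set L := ⌈Real.log n ^ 3⌉₊ with hLd
  have hL : 0 < L := Nat.ceil_pos.2 (by positivity)
  have hV := hU.l1Bound_majorant (n := n) (w := Nat.sqrt n) (κ := κ) hC hχ.1.le (fun i hi a a' =>
    hsplice _ _ (m.idx_mem_piece hi)
      ((hU.ae_regularLaw hi).mono fun h hh => hh.abs_slope_le)
      (hU.eLpNorm_predictor (m.mem_Icc_of_regular hi)) a a' (hU.integrable_entry hi a a')
      (Nat.sqrt n) (Nat.le_sqrt.2 hnk)) (hκ n) hρ.le L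
  have hae := hU.ae_abs_remainder_le h_error τ β₀ n hρ hL
  have hne : Nonempty (Metric.closedBall β₀ ρ) := ⟨⟨β₀, Metric.mem_closedBall_self hρ.le⟩⟩
  calc P {ω | ε ≤ ‖(⨆ β : Metric.closedBall β₀ ρ, |m.remainder τ β₀ n ω β|) - 0‖}
      ≤ P {ω | ε ≤ |m.majorant A n ρ L ω|} := by
        refine measure_mono_ae ?_
        filter_upwards [hae] with ω hω hmem
        refine le_trans (α := ℝ) hmem ?_
        rw [sub_zero, Real.norm_eq_abs, abs_of_nonneg (Real.iSup_nonneg fun _ => abs_nonneg _)]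
        refine ciSup_le fun β => (hω β ?_).trans (le_abs_self _)
        rw [← dist_eq_norm]
        exact β.2
    _ = ENNReal.ofReal (P.real {ω | ε ≤ |m.majorant A n ρ L ω|}) := (ofReal_measureReal).symm
    _ ≤ ENNReal.ofReal (c n / ε) := by
        refine ENNReal.ofReal_le_ofReal ?_
        rw [le_div_iff₀ hε, mul_comm]
        exact (mul_meas_ge_le_integral_of_nonneg (ae_of_all _ fun _ => abs_nonneg _)
          hV.1.abs ε).trans (hV.2.trans hn)
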